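/- For $\alpha>0$ let $\mathcal C^\alpha$ be the space of continuous $f:[0,1]\to\mathbb R$ with $\|f\|_\alpha=\|f\|_\infty+\sup_{0\le s<t\le1}\frac{|f_t-f_s|}{|t-s|^\alpha}<\infty$. Integrals $\int g\,df$ against Hölder paths are Young integrals (limits of Riemann sums as the mesh tends to $0$). For real $q\ge 1$ and $r\in\mathbb R$ write $r^{2q}=|r|^{2q}$ and $r^{2q-1}=|r|^{2q-2}r$. Put $K(t,\xi)=t\wedge\xi-t\xi$. Let $\gamma,\kappa\in(0,1)$ with $\gamma+\kappa>1$, let $p\ge1$ and $M>0$, and let $\varphi_M$ be a smooth function with bounded derivatives such that $\varphi_M(r)=1$ for $r<M$ and $\varphi_M(r)=0$ for $r>M+1$. Put $$\|x\|_{\gamma,p}^{2p}=\int_0^1\!\!\int_0^1\frac{(x_\zeta-x_\eta)^{2p}}{|\zeta-\eta|^{2p\gamma+2}}\,d\zeta\,d\eta,\qquad G_M(x)=\varphi_M\big(\|x\|_{\gamma,p}^{2p}\big).$$ **Theorem.** There is a constant $c>0$, depending only on $\gamma,\kappa,p,M,\varphi_M$, such that the following holds for every $\sigma\in\mathcal C^4(\mathbb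 R)$ that is bounded with bounded derivatives up to order $4$ and satisfies $\|\sigma^{(j)}\|_\infty\le \frac{c}{M+1}$ for $j=0,1,2$, and for every $\varepsilon>\frac1{2p}$. For each $x\in\mathcal C^{\gamma+\varepsilon}$ there is a unique $z=z(x)\in\mathcal C^\kappa$ with $z_0=0$ and $$z_t-z_s=\int_s^t\Big(\int_u^1 G_M(x)\sigma(z_\xi)\,dx_\xi\Big)du-(t-s)\int_0^1\xi\, G_M(x)\sigma(z_\xi)\,dx_\xi,\qquad 0\le s\le t\le1.$$ The map $x\mapsto z(x)$ from $\mathcal C^{\gamma+\varepsilon}$ to $\mathcal C^\kappa$ is Fréchet differentiable at every $x$. Its derivative is given, for all $h\in\mathcal C^{\gamma+\varepsilon}$ and $t\in[0,1]$, by $$(Dz(x)\cdot h)_t=\int_0^1\Phi_s(t)\,dh_s ,$$ where the Young integral on the right exists and, for each $s\in[0,1]$, $\Phi_s$ is the unique element of $\mathcal C^\kappa$ satisfying $$\Phi_s(t)=\Psi_s(t)+G_M(x)\int_0^1K(t,\xi)\,\sigma'(z_\xi)\,\Phi_s(\xi)\,dx_\xi,\qquad t\in[0,1],$$ with $$\Psi_s(t)=G_M(x)\,\sigma(z_s)\,K(t,s)+2\varphi_M'\big(\|x\|_{\gamma,p}^{2p}\big)\,\mu_s\int_0^1K(t,\xi)\,\sigma(z_\xi)\,dx_\xi,$$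 $$\mu_s=\int_0^s\Big(\int_s^1\rho_{\zeta\eta}\,d\zeta\Big)d\eta,\qquad \rho_{\zeta\eta}=2p\,\frac{(x_\zeta-x_\eta)^{2p-1}}{|\zeta-\eta|^{2\gamma p+2}} .$$ -/

import Mathlib

open scoped NNReal ContDiff

noncomputable section

/-- The `α`-Hölder continuous functions on `[0,1]`, as a subspace of `C([0,1])`. -/
def holderSubmodule (α : ℝ≥0) : Submodule ℝ C(unitInterval, ℝ) where
  carrier := {f | MemHolder α f}
  add_mem' := by
    intro f g hf hg
    simpa using MemHolder.add hf hg
  zero_mem' := by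
    exact (memHolder_zero : MemHolder α (0 : unitInterval → ℝ))
  smul_mem' := by
    intro c f hf
    simpa using MemHolder.smul (c := c) hf

/-- The Hölder space `C^α` on `[0,1]`; its norm is
`‖f‖_∞ + sup_{s < t} |f t - f s| / |t - s|^α`. -/
def HolderC (α : ℝ≥0) : Type := holderSubmodule α

namespace HolderC

variable {α : ℝ≥0}

instance : AddCommGroup (HolderC α) := inferInstanceAs (AddCommGroup (holderSubmodule α))

instance : Module ℝ (HolderC α) := inferInstanceAs (Module ℝ (holderSubmodule α))

/-- The underlying continuous function on `[0,1]`. -/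
def toC (f : HolderC α) : C(unitInterval, ℝ) := f.1

/-- Elements of `C^α` are evaluated at real times; only times in `[0,1]` matter
(outside, the function is extended by its end values). -/
def eval (f : HolderC α) (t : ℝ) : ℝ := f.toC (Set.projIcc 0 1 zero_le_one t)

instance : CoeFun (HolderC α) (fun _ => ℝ → ℝ) := ⟨eval⟩

instance : Norm (HolderC α) := ⟨fun f => ‖f.toC‖ + (nnHolderNorm α f.toC : ℝ)⟩

theorem normCore : NormedSpace.Core ℝ (HolderC α) where
  norm_nonneg f := add_nonneg (norm_nonneg _) (NNReal.coe_nonneg _)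
  norm_smul c f := by
    have h : nnHolderNorm α (c • (f.toC : unitInterval → ℝ)) = ‖c‖₊ * nnHolderNorm α f.toC :=
      MemHolder.nnHolderNorm_smul f.2 c
    change ‖c • f.toC‖ + (nnHolderNorm α (c • (f.toC : unitInterval → ℝ)) : ℝ) =
      ‖c‖ * (‖f.toC‖ + (nnHolderNorm α f.toC : ℝ))
    rw [h, norm_smul, NNReal.coe_mul, coe_nnnorm]
    ring
  norm_triangle f g := by
    have h : (nnHolderNorm α ((f.toC : unitInterval → ℝ) + (g.toC : unitInterval → ℝ)) : ℝ) ≤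
        (nnHolderNorm α f.toC : ℝ) + (nnHolderNorm α g.toC : ℝ) :=
      NNReal.coe_le_coe.mpr (MemHolder.nnHolderNorm_add_le f.2 g.2)
    have h' := norm_add_le f.toC g.toC
    exact (add_le_add h' h).trans_eq (add_add_add_comm _ _ _ _)
  norm_eq_zero_iff f := by
    constructor
    · intro h
      change ‖f.toC‖ + (nnHolderNorm α f.toC : ℝ) = 0 at h
      have h0 : ‖f.toC‖ = 0 :=
        le_antisymm (by linarith [NNReal.coe_nonneg (nnHolderNorm α f.toC)]) (norm_nonneg _)
      exact Subtype.ext (norm_eq_zero.mp h0)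
    · rintro rfl
      change ‖(0 : C(unitInterval, ℝ))‖ + (nnHolderNorm α (0 : unitInterval → ℝ) : ℝ) = 0
      simp

instance : NormedAddCommGroup (HolderC α) := NormedAddCommGroup.ofCore normCore

instance : NormedSpace ℝ (HolderC α) := NormedSpace.ofCore normCore

end HolderC

/-- `HasYoungIntegral g f a b I`: the Riemann sums `∑ g(θᵢ) (f(τᵢ₊₁) - f(τᵢ))` over tagged
partitions of `[a,b]` converge to `I` as the mesh tends to zero, i.e. `I = ∫_a^b g df`
(for `a ≤ b`). -/
def HasYoungIntegral (g f : ℝ → ℝ) (a b I : ℝ) : Prop :=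
  ∀ e : ℝ, 0 < e → ∃ δ : ℝ, 0 < δ ∧ ∀ (n : ℕ) (τ θ : ℕ → ℝ),
    Monotone τ → τ 0 = a → τ n = b →
    (∀ i < n, τ (i + 1) - τ i < δ) →
    (∀ i < n, θ i ∈ Set.Icc (τ i) (τ (i + 1))) →
    |(∑ i ∈ Finset.range n, g (θ i) * (f (τ (i + 1)) - f (τ i))) - I| < e

open Classical in
/-- The Young integral `∫_a^b g df` for `a ≤ b` (zero if the Riemann sums do not converge). -/
def youngIntegral (g f : ℝ → ℝ) (a b : ℝ) : ℝ :=
  if h : ∃ I, HasYoungIntegral g f a b I then h.choose else 0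

/-- The Dirichlet Green kernel `K(t,ξ) = t ∧ ξ - t ξ`. -/
def greenK (t ξ : ℝ) : ℝ := min t ξ - t * ξ

/-- The `2p`-th power `‖x‖_{γ,p}^{2p}` of the Sobolev type norm, with `r^{2p}` read as `|r|^{2p}`
for real `p ≥ 1`. -/
def sobolevPow (γ p : ℝ) (x : ℝ → ℝ) : ℝ :=
  ∫ η in (0 : ℝ)..1, ∫ ζ in (0 : ℝ)..1, |x ζ - x η| ^ (2 * p) / |ζ - η| ^ (2 * p * γ + 2)

/-- `φ` is an admissible cutoff at level `M`: smooth with bounded derivatives, equal to `1` below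
`M` and to `0` above `M + 1`. (A smooth function on `(0,∞)` that is `1` on `(0,M)` is extended
by `1` to `(-∞,0]`.) -/
structure IsCutoff (M : ℝ) (φ : ℝ → ℝ) : Prop where
  smooth : ContDiff ℝ ∞ φ
  bounded : ∀ n : ℕ, ∃ C : ℝ, ∀ r : ℝ, |iteratedDeriv n φ r| ≤ C
  eq_one : ∀ r : ℝ, r < M → φ r = 1
  eq_zero : ∀ r : ℝ, M + 1 < r → φ r = 0

/-- The cutoff functional `G_M(x) = φ_M(‖x‖_{γ,p}^{2p})`. -/
def cutoffG (φ : ℝ → ℝ) (γ p : ℝ) (x : ℝ → ℝ) : ℝ := φ (sobolevPow γ p x)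

/-- `z` solves the elliptic equation driven by `x` with coefficient
`σ_M(x,y) = G_M(x) σ(y)` and boundary value `z_0 = 0`. -/
def IsEllipticSolution (φ : ℝ → ℝ) (γ p : ℝ) (σ x z : ℝ → ℝ) : Prop :=
  z 0 = 0 ∧ ∀ s t : ℝ, 0 ≤ s → s ≤ t → t ≤ 1 →
    z t - z s =
      (∫ u in s..t, youngIntegral (fun ξ => cutoffG φ γ p x * σ (z ξ)) x u 1)
        - (t - s) * youngIntegral (fun ξ => ξ * (cutoffG φ γ p x * σ (z ξ))) x 0 1

/-- `ρ_{ζη} = 2p (x_ζ - x_η)^{2p-1} / |ζ - η|^{2γp+2}`, with `r^{2p-1}` read as the odd power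
`|r|^{2p-2} r` for real `p ≥ 1`. -/
def rhoKernel (γ p : ℝ) (x : ℝ → ℝ) (ζ η : ℝ) : ℝ :=
  2 * p * (|x ζ - x η| ^ (2 * p - 2) * (x ζ - x η)) / |ζ - η| ^ (2 * γ * p + 2)

/-- `μ_s = ∫_0^s (∫_s^1 ρ_{ζη} dζ) dη`. -/
def muTerm (γ p : ℝ) (x : ℝ → ℝ) (s : ℝ) : ℝ :=
  ∫ η in (0 : ℝ)..s, ∫ ζ in s..(1 : ℝ), rhoKernel γ p x ζ η

/-- `Ψ_s(t) = G_M(x) σ(z_s) K(t,s) + 2 φ_M'(‖x‖_{γ,p}^{2p}) μ_s ∫_0^1 K(t,ξ) σ(z_ξ) dx_ξ`. -/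
def psiKernel (φ : ℝ → ℝ) (γ p : ℝ) (σ x z : ℝ → ℝ) (s t : ℝ) : ℝ :=
  cutoffG φ γ p x * σ (z s) * greenK t s
    + 2 * deriv φ (sobolevPow γ p x) * muTerm γ p x s
      * youngIntegral (fun ξ => greenK t ξ * σ (z ξ)) x 0 1

end

/-! The point is to leave Hölder spaces and to solve for the primitive `W = G_M(x) ∫ σ(z) dx`
instead of for `z`. The equation says `z = P W`, where `P` is the Dirichlet solution operator `P W
(t) = t ∫_0^1 W - ∫_0^t W`. For continuous `W` the path `P W` is continuously differentiable with
derivative `Q W`, so `∫ σ(P W) dx` can be integrated by parts: it equals `σ(P W)(x - x_0) - ∫ (x -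
x_0) σ'(P W) Q W du` (`byParts`, `isYoungPath_byParts`). This expression is linear in `x` and
bounded in the sup norm of `x - x_0`, hence `W = G_M(x) byParts(W) x` is a fixed point equation in
the Banach algebra `C[0,1]`.

Smallness of `σ, σ', σ''` makes the map a contraction provided `|G_M(x)| ‖x - x_0‖_∞` is bounded
uniformly in `x`. Where the cutoff is nonzero, the Sobolev functional is at most `M + 1`, and a
Garsia–Rodemich–Rumsey type argument (`abs_sub_mean_le`, `norm_pin_le`) bounds `‖x - x_0‖_∞` by that
functional alone, without any Hölder norm. Therefore `c` can be fixed before `ε`.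

Differentiability is that of a fixed point (`hasFDerivAt_of_fixedPoint`). The partial derivative in
`W` is `G S F`, where `F` is the primitive of `σ'(z) dx` and `S F V` that of `σ'(z) P V dx`; its
norm is below `1`, so `1 - G S F` has an inverse `R`. The partial derivative in `x` involves the
derivative of the Sobolev functional, obtained under the integral sign (`hasFDerivAt_sobolevPow`);
the condition `ε > 1/(2p)` is what makes the integrals converge.

For the representation, `R` also solves the equation of `Φ_s` explicitly (`linearEquation_iff`).
Integrating that formula against `h` needs two facts: a Fubini theorem for the Green kernel
(`IsYoungPath.youngValue_greenPath`), which follows by parts because `s ↦ ∫ K(s,·) dF` is a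
primitive in `s`, and `∫ μ dh = (D‖x‖^{2p} · h)/2` (`youngValue_muTerm`), which rests on an explicit
primitive of `μ dh`.

Young integrals are handled through `IsYoungPath g x X`: the increments of `X` agree with `g r (x t
- x s)` up to a superlinear error for every tag `r` in `[s,t]`. This form is stable under algebra
and integration by parts, and it implies convergence of all tagged Riemann sums. -/

/-! ### Superlinear functions of an interval and a tag. -/

/-- `|F s r t| ≤ C (t - s)^θ` with some `θ > 1` for all `0 ≤ s ≤ r ≤ t ≤ 1`. -/
def Superlin (F : ℝ → ℝ → ℝ → ℝ) : Prop :=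
  ∃ C θ : ℝ, 1 < θ ∧ ∀ s r t, 0 ≤ s → s ≤ r → r ≤ t → t ≤ 1 → |F s r t| ≤ C * (t - s) ^ θ

namespace Superlin

variable {F F' : ℝ → ℝ → ℝ → ℝ}

theorem const_nonneg {C θ : ℝ}
    (h : ∀ s r t, 0 ≤ s → s ≤ r → r ≤ t → t ≤ 1 → |F s r t| ≤ C * (t - s) ^ θ) : 0 ≤ C := by
  have := h 0 0 1 le_rfl le_rfl zero_le_one le_rfl
  simp only [sub_zero, Real.one_rpow, mul_one] at this
  exact (abs_nonneg _).trans this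

theorem mono (h : Superlin F) (B : ℝ)
    (hB : ∀ s r t, 0 ≤ s → s ≤ r → r ≤ t → t ≤ 1 → |F' s r t| ≤ B * |F s r t|) :
    Superlin F' := by
  obtain ⟨C, θ, hθ, h⟩ := h
  refine ⟨|B| * C, θ, hθ, fun s r t hs hsr hrt ht => (hB s r t hs hsr hrt ht).trans ?_⟩
  calc B * |F s r t| ≤ |B| * |F s r t| := by gcongr; exact le_abs_self B
    _ ≤ |B| * (C * (t - s) ^ θ) := by gcongr; exact h s r t hs hsr hrt ht
    _ = _ := by ring

theorem congr (h : Superlin F)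
    (hF : ∀ s r t, 0 ≤ s → s ≤ r → r ≤ t → t ≤ 1 → F' s r t = F s r t) : Superlin F' :=
  h.mono 1 fun s r t hs hsr hrt ht => by rw [hF s r t hs hsr hrt ht, one_mul]

theorem weaken {C θ θ' : ℝ} (hθ' : 0 ≤ θ') (hle : θ' ≤ θ)
    (h : ∀ s r t, 0 ≤ s → s ≤ r → r ≤ t → t ≤ 1 → |F s r t| ≤ C * (t - s) ^ θ) :
    ∀ s r t, 0 ≤ s → s ≤ r → r ≤ t → t ≤ 1 → |F s r t| ≤ C * (t - s) ^ θ' := by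
  intro s r t hs hsr hrt ht
  have hC := const_nonneg h
  exact (h s r t hs hsr hrt ht).trans (mul_le_mul_of_nonneg_left
    (Real.rpow_le_rpow_of_exponent_ge' (by linarith) (by linarith) hθ' hle) hC)

theorem add (h : Superlin F) (h' : Superlin F') : Superlin (fun s r t => F s r t + F' s r t) := by
  obtain ⟨C, θ, hθ, h⟩ := h
  obtain ⟨C', θ', hθ', h'⟩ := h'
  have hm : 1 < min θ θ' := lt_min hθ hθ'
  refine ⟨C + C', min θ θ', hm, fun s r t hs hsr hrt ht => (abs_add_le _ _).trans ?_⟩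
  rw [add_mul]
  exact add_le_add (weaken (by linarith) (min_le_left _ _) h s r t hs hsr hrt ht)
    (weaken (by linarith) (min_le_right _ _) h' s r t hs hsr hrt ht)

theorem mul_bounded (h : Superlin F) (b : ℝ → ℝ → ℝ → ℝ) (B : ℝ)
    (hb : ∀ s r t, 0 ≤ s → s ≤ r → r ≤ t → t ≤ 1 → |b s r t| ≤ B) :
    Superlin (fun s r t => b s r t * F s r t) :=
  h.mono B fun s r t hs hsr hrt ht => by
    rw [abs_mul]
    exact mul_le_mul_of_nonneg_right (hb s r t hs hsr hrt ht) (abs_nonneg _)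

theorem const_mul (h : Superlin F) (c : ℝ) : Superlin (fun s r t => c * F s r t) :=
  h.mul_bounded (fun _ _ _ => c) |c| fun _ _ _ _ _ _ _ => le_rfl

theorem sub (h : Superlin F) (h' : Superlin F') : Superlin (fun s r t => F s r t - F' s r t) :=
  (h.add (h'.const_mul (-1))).congr fun _ _ _ _ _ _ _ => by ring

/-- Passing to a subinterval only shrinks the length. Applied with coinciding points, it compares
two tags of one interval, which is how second order terms arise in integration by parts. -/
theorem restrict (h : Superlin F) (a b c : ℝ → ℝ → ℝ → ℝ)
    (habc : ∀ s r t, s ≤ r → r ≤ t →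
      s ≤ a s r t ∧ a s r t ≤ b s r t ∧ b s r t ≤ c s r t ∧ c s r t ≤ t) :
    Superlin (fun s r t => F (a s r t) (b s r t) (c s r t)) := by
  obtain ⟨C, θ, hθ, h⟩ := h
  have hC := const_nonneg h
  refine ⟨C, θ, hθ, fun s r t hs hsr hrt ht => ?_⟩
  obtain ⟨h1, h2, h3, h4⟩ := habc s r t hsr hrt
  refine (h _ _ _ (hs.trans h1) h2 h3 (h4.trans ht)).trans ?_
  gcongr
  linarith

end Superlin

/-! ### Hölder increments on the unit interval. -/

/-- Hölder continuity of exponent `a` on `[0,1]`, for functions of a real variable. -/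
def IncrHolder (a : ℝ) (f : ℝ → ℝ) : Prop :=
  ∃ C : ℝ, ∀ s t, 0 ≤ s → s ≤ t → t ≤ 1 → |f t - f s| ≤ C * (t - s) ^ a

namespace IncrHolder

variable {a b : ℝ} {f g : ℝ → ℝ}

theorem const_nonneg {C : ℝ} (h : ∀ s t, 0 ≤ s → s ≤ t → t ≤ 1 → |f t - f s| ≤ C * (t - s) ^ a) :
    0 ≤ C := by
  have := h 0 1 le_rfl zero_le_one le_rfl
  simp only [sub_zero, Real.one_rpow, mul_one] at this
  exact (abs_nonneg _).trans this

theorem weaken (h : IncrHolder a f) (hb : 0 ≤ b) (hba : b ≤ a) : IncrHolder b f := by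
  obtain ⟨C, h⟩ := h
  have hC := const_nonneg h
  exact ⟨C, fun s t hs hst ht => (h s t hs hst ht).trans (mul_le_mul_of_nonneg_left
    (Real.rpow_le_rpow_of_exponent_ge' (by linarith) (by linarith) hb hba) hC)⟩

theorem bounded (h : IncrHolder a f) (ha : 0 ≤ a) :
    ∃ B, ∀ t, 0 ≤ t → t ≤ 1 → |f t| ≤ B := by
  obtain ⟨C, h⟩ := h
  have hC := const_nonneg h
  refine ⟨|f 0| + C, fun t ht ht1 => ?_⟩
  have h1 := h 0 t le_rfl ht ht1
  have h2 : (t - 0) ^ a ≤ 1 := Real.rpow_le_one (by linarith) (by linarith) ha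
  have h3 : |f t| ≤ |f 0| + |f t - f 0| := by
    calc |f t| = |f 0 + (f t - f 0)| := by ring_nf
      _ ≤ _ := abs_add_le _ _
  nlinarith

theorem mul (hf : IncrHolder a f) (hg : IncrHolder a g) (ha : 0 ≤ a) :
    IncrHolder a (fun t => f t * g t) := by
  obtain ⟨B, hB⟩ := hf.bounded ha
  obtain ⟨B', hB'⟩ := hg.bounded ha
  obtain ⟨C, hf⟩ := hf
  obtain ⟨C', hg⟩ := hg
  refine ⟨B * C' + B' * C, fun s t hs hst ht => ?_⟩
  have h0 : 0 ≤ B := (abs_nonneg _).trans (hB 0 le_rfl zero_le_one)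
  calc |f t * g t - f s * g s| = |f t * (g t - g s) + g s * (f t - f s)| := by ring_nf
    _ ≤ |f t| * |g t - g s| + |g s| * |f t - f s| := by
        rw [← abs_mul, ← abs_mul]; exact abs_add_le _ _
    _ ≤ B * (C' * (t - s) ^ a) + B' * (C * (t - s) ^ a) := by
        gcongr
        · exact hB t (hs.trans hst) ht
        · exact hg s t hs hst ht
        · exact (abs_nonneg _).trans (hB' s hs (hst.trans ht))
        · exact hB' s hs (hst.trans ht)
        · exact hf s t hs hst ht
    _ = _ := by ring

/-- This is the cost of moving a tag from the left end `s` to `r`; the condition `a + b > 1` is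
Young's condition. -/
theorem superlin_mul (hf : IncrHolder a f) (hg : IncrHolder b g) (hab : 1 < a + b)
    (ha : 0 < a) (hb : 0 < b) :
    Superlin (fun s r t => (f r - f s) * (g t - g s)) := by
  obtain ⟨C, hf⟩ := hf
  obtain ⟨C', hg⟩ := hg
  have hC := const_nonneg hf
  have hC' := const_nonneg hg
  refine ⟨C * C', a + b, hab, fun s r t hs hsr hrt ht => ?_⟩
  rw [abs_mul, Real.rpow_add_of_nonneg (by linarith) ha.le hb.le]
  calc |f r - f s| * |g t - g s| ≤ (C * (t - s) ^ a) * (C' * (t - s) ^ b) := by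
        have hts : 0 ≤ t - s := by linarith
        refine mul_le_mul ((hf s r hs hsr (hrt.trans ht)).trans ?_)
          (hg s t hs (hsr.trans hrt) ht) (abs_nonneg _) (by positivity)
        exact mul_le_mul_of_nonneg_left
          (Real.rpow_le_rpow (by linarith) (by linarith) ha.le) hC
    _ = _ := by ring

theorem add (hf : IncrHolder a f) (hg : IncrHolder a g) : IncrHolder a (fun t => f t + g t) := by
  obtain ⟨C, hf⟩ := hf
  obtain ⟨C', hg⟩ := hg
  refine ⟨C + C', fun s t hs hst ht => ?_⟩
  calc |f t + g t - (f s + g s)| = |(f t - f s) + (g t - g s)| := by ring_nf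
    _ ≤ _ := abs_add_le _ _
    _ ≤ _ := add_le_add (hf s t hs hst ht) (hg s t hs hst ht)
    _ = _ := by ring

theorem const (a c : ℝ) : IncrHolder a (fun _ => c) := ⟨0, fun s t _ _ _ => by simp⟩

end IncrHolder

/-! ### Indefinite Young integrals and their calculus. -/

/-- `X` is an indefinite Young integral of `g` against `x` on `[0,1]`. -/
def IsYoungPath (g x X : ℝ → ℝ) : Prop :=
  Superlin (fun s r t => X t - X s - g r * (x t - x s))

theorem HasYoungIntegral.unique {g f : ℝ → ℝ} {a b I I' : ℝ} (hab : a ≤ b)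
    (h : HasYoungIntegral g f a b I) (h' : HasYoungIntegral g f a b I') : I = I' := by
  by_contra hne
  have he : 0 < |I - I'| / 2 := by have := abs_pos.mpr (sub_ne_zero.mpr hne); linarith
  obtain ⟨δ, hδ, h⟩ := h _ he
  obtain ⟨δ', hδ', h'⟩ := h' _ he
  obtain ⟨n, hn⟩ := exists_nat_gt ((b - a) / min δ δ')
  have hm : 0 < min δ δ' := lt_min hδ hδ'
  have hn0 : (0 : ℝ) < n := lt_of_le_of_lt (div_nonneg (by linarith) hm.le) hn
  set τ : ℕ → ℝ := fun i => a + i * ((b - a) / n) with hτ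
  have hstep : ∀ i, τ (i + 1) - τ i = (b - a) / n := fun i => by simp only [hτ]; push_cast; ring
  have hmono : Monotone τ := monotone_nat_of_le_succ fun i => by
    have := hstep i
    have : 0 ≤ (b - a) / n := div_nonneg (by linarith) hn0.le
    linarith [hstep i]
  have hlt : (b - a) / n < min δ δ' := by
    rw [div_lt_iff₀ hn0]; rw [div_lt_iff₀ hm] at hn; linarith
  have h0 : τ 0 = a := by simp [hτ]
  have h1 : τ n = b := by simp only [hτ]; field_simp; ring
  have e1 := h n τ τ hmono h0 h1 (fun i _ => by rw [hstep]; exact hlt.trans_le (min_le_left _ _))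
    (fun i _ => ⟨le_rfl, hmono i.le_succ⟩)
  have e2 := h' n τ τ hmono h0 h1 (fun i _ => by rw [hstep]; exact hlt.trans_le (min_le_right _ _))
    (fun i _ => ⟨le_rfl, hmono i.le_succ⟩)
  have : |I - I'| < |I - I'| := by
    calc |I - I'| ≤ _ := abs_sub_le I (∑ i ∈ Finset.range n, g (τ i) * (f (τ (i + 1)) - f (τ i))) I'
      _ < |I - I'| / 2 + |I - I'| / 2 := by rw [abs_sub_comm I]; exact add_lt_add e1 e2
      _ = _ := by ring
  exact lt_irrefl _ this

theorem HasYoungIntegral.youngIntegral_eq {g f : ℝ → ℝ} {a b I : ℝ} (hab : a ≤ b)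
    (h : HasYoungIntegral g f a b I) : youngIntegral g f a b = I := by
  have hex : ∃ I, HasYoungIntegral g f a b I := ⟨I, h⟩
  rw [youngIntegral, dif_pos hex]
  exact HasYoungIntegral.unique hab hex.choose_spec h

namespace IsYoungPath

variable {g x X k D : ℝ → ℝ}

/-- The increments of `X` telescope, and the errors add up to at most `C · mesh^(θ - 1) · (b - a)`.
Arbitrary tags cost nothing since the error bound already allows them. -/
theorem hasYoungIntegral (h : IsYoungPath g x X) {a b : ℝ} (ha : 0 ≤ a)
    (hb : b ≤ 1) : HasYoungIntegral g x a b (X b - X a) := by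
  obtain ⟨C, θ, hθ, h⟩ := h
  have hC := Superlin.const_nonneg h
  intro e he
  have hpos : 0 < e / (C + 1) := by positivity
  -- Chosen so that `δ^(θ - 1) = e / (C + 1)`; the `+ 1` covers `C = 0` and makes the final
  -- inequality strict.
  refine ⟨(e / (C + 1)) ^ (1 / (θ - 1)), by positivity, fun n τ θ' hτ h0 hn hmesh htag => ?_⟩
  set δ := (e / (C + 1)) ^ (1 / (θ - 1)) with hδ
  have hδ1 : δ ^ (θ - 1) = e / (C + 1) := by
    rw [hδ, ← Real.rpow_mul hpos.le, one_div, inv_mul_cancel₀ (by linarith), Real.rpow_one]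
  have htel : X b - X a = ∑ i ∈ Finset.range n, (X (τ (i + 1)) - X (τ i)) := by
    rw [Finset.sum_range_sub (fun i => X (τ i)), hn, h0]
  have htel' : b - a = ∑ i ∈ Finset.range n, (τ (i + 1) - τ i) := by
    rw [Finset.sum_range_sub τ, hn, h0]
  rw [htel, ← Finset.sum_sub_distrib]
  calc |∑ i ∈ Finset.range n, (g (θ' i) * (x (τ (i + 1)) - x (τ i)) - (X (τ (i + 1)) - X (τ i)))|
      ≤ ∑ i ∈ Finset.range n, C * (e / (C + 1)) * (τ (i + 1) - τ i) := by
        refine (Finset.abs_sum_le_sum_abs _ _).trans (Finset.sum_le_sum fun i hi => ?_)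
        have hi' := Finset.mem_range.mp hi
        have hl : 0 ≤ τ (i + 1) - τ i := sub_nonneg.mpr (hτ i.le_succ)
        have h1 := h (τ i) (θ' i) (τ (i + 1)) (ha.trans (h0 ▸ hτ (Nat.zero_le i)))
          (htag i hi').1 (htag i hi').2 ((hn ▸ hτ hi' : τ (i + 1) ≤ b).trans hb)
        rw [abs_sub_comm]
        refine h1.trans ?_
        rw [mul_assoc]
        gcongr
        have : (τ (i + 1) - τ i) ^ θ = (τ (i + 1) - τ i) ^ (θ - 1) * (τ (i + 1) - τ i) := by
          nth_rewrite 3 [← Real.rpow_one (τ (i + 1) - τ i)]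
          rw [← Real.rpow_add_of_nonneg hl (by linarith) zero_le_one]
          ring_nf
        rw [this, ← hδ1]
        exact mul_le_mul_of_nonneg_right
          (Real.rpow_le_rpow hl (hmesh i hi').le (by linarith)) hl
    _ = C * (e / (C + 1)) * (b - a) := by rw [← Finset.mul_sum, ← htel']
    _ ≤ C * (e / (C + 1)) * 1 := by gcongr; linarith
    _ < e := by
        rw [mul_one, ← mul_div_assoc, div_lt_iff₀ (by linarith)]
        nlinarith

theorem youngIntegral_eq (h : IsYoungPath g x X) {a b : ℝ} (ha : 0 ≤ a) (hab : a ≤ b)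
    (hb : b ≤ 1) : youngIntegral g x a b = X b - X a :=
  (h.hasYoungIntegral ha hb).youngIntegral_eq hab

theorem unique {X' : ℝ → ℝ} (h : IsYoungPath g x X) (h' : IsYoungPath g x X') {t : ℝ}
    (ht : 0 ≤ t) (ht1 : t ≤ 1) : X t - X 0 = X' t - X' 0 :=
  (h.hasYoungIntegral le_rfl ht1).unique ht (h'.hasYoungIntegral le_rfl ht1)

theorem congr {g' x' X' : ℝ → ℝ} (h : IsYoungPath g x X)
    (hg : ∀ t, 0 ≤ t → t ≤ 1 → g' t = g t) (hx : ∀ t, 0 ≤ t → t ≤ 1 → x' t = x t)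
    (hX : ∀ t, 0 ≤ t → t ≤ 1 → X' t = X t) : IsYoungPath g' x' X' :=
  Superlin.congr h fun s r t hs hsr hrt ht => by
    rw [hX t (by linarith) ht, hX s hs (by linarith), hg r (by linarith) (by linarith),
      hx t (by linarith) ht, hx s hs (by linarith)]

theorem const_mul (h : IsYoungPath g x X) (c : ℝ) :
    IsYoungPath (fun t => c * g t) x (fun t => c * X t) :=
  (Superlin.const_mul h c).congr fun _ _ _ _ _ _ _ => by ring

theorem add {g' X' : ℝ → ℝ} (h : IsYoungPath g x X) (h' : IsYoungPath g' x X') :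
    IsYoungPath (fun t => g t + g' t) x (fun t => X t + X' t) :=
  (Superlin.add h h').congr fun _ _ _ _ _ _ _ => by ring

theorem const_mul_right (h : IsYoungPath g x X) (c : ℝ) :
    IsYoungPath g (fun t => c * x t) (fun t => c * X t) :=
  (Superlin.const_mul h c).congr fun _ _ _ _ _ _ _ => by ring

theorem add_right {x' X' : ℝ → ℝ} (h : IsYoungPath g x X) (h' : IsYoungPath g x' X') :
    IsYoungPath g (fun t => x t + x' t) (fun t => X t + X' t) :=
  (Superlin.add h h').congr fun _ _ _ _ _ _ _ => by ring

theorem one (x : ℝ → ℝ) : IsYoungPath (fun _ => 1) x (fun t => x t - x 0) :=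
  ⟨0, 2, by norm_num, fun s r t _ _ _ _ => by simp⟩

/-- Integration by parts: `∫ k g dx = k X - ∫ X dk` where `X = ∫ g dx`. -/
theorem mul (h : IsYoungPath g x X) (hD : IsYoungPath X k D) {B : ℝ}
    (hB : ∀ t, 0 ≤ t → t ≤ 1 → |k t| ≤ B) :
    IsYoungPath (fun t => k t * g t) x (fun t => k t * X t - D t) := by
  -- The remainder of `k X - D` is `k r` times the remainder of `X`, minus the remainder of `D`,
  -- minus `(X r - X t)(k t - k r)` and `(X r - X s)(k r - k s)`. Each of these two products is a
  -- difference of remainders of `D` with two tags on the same interval (`p1` and `p2`), so no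
  -- Hölder exponents of `X` and `k` are needed.
  have e1 := Superlin.mul_bounded h (fun _ r _ => k r) B
    (fun s r t hs hsr hrt ht => hB r (by linarith) (by linarith))
  have p1 := (Superlin.restrict hD (fun _ r _ => r) (fun _ _ t => t) (fun _ _ t => t)
    (fun s r t h1 h2 => ⟨h1, h2, le_rfl, le_rfl⟩)).sub
    (Superlin.restrict hD (fun _ r _ => r) (fun _ r _ => r) (fun _ _ t => t)
    (fun s r t h1 h2 => ⟨h1, le_rfl, h2, le_rfl⟩))
  have p2 := (Superlin.restrict hD (fun s _ _ => s) (fun s _ _ => s) (fun _ r _ => r)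
    (fun s r t h1 h2 => ⟨le_rfl, le_rfl, h1, h2⟩)).sub
    (Superlin.restrict hD (fun s _ _ => s) (fun _ r _ => r) (fun _ r _ => r)
    (fun s r t h1 h2 => ⟨le_rfl, h1, le_rfl, h2⟩))
  exact ((((e1.sub hD).sub p1)).sub p2).congr fun s r t _ _ _ _ => by ring

theorem incrHolder (h : IsYoungPath g x X) {a B : ℝ} (hx : IncrHolder a x) (ha : 0 ≤ a)
    (ha1 : a ≤ 1) (hB : ∀ t, 0 ≤ t → t ≤ 1 → |g t| ≤ B) : IncrHolder a X := by
  obtain ⟨C, θ, hθ, h⟩ := h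
  obtain ⟨C', hx⟩ := hx
  have hC := Superlin.const_nonneg h
  have hB0 : 0 ≤ B := (abs_nonneg _).trans (hB 0 le_rfl zero_le_one)
  refine ⟨C + B * C', fun s t hs hst ht => ?_⟩
  have h1 := Superlin.weaken ha (by linarith) h s s t hs le_rfl hst ht
  calc |X t - X s| = |(X t - X s - g s * (x t - x s)) + g s * (x t - x s)| := by ring_nf
    _ ≤ |X t - X s - g s * (x t - x s)| + |g s| * |x t - x s| := by
        rw [← abs_mul]; exact abs_add_le _ _
    _ ≤ C * (t - s) ^ a + B * (C' * (t - s) ^ a) := by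
        gcongr
        · exact hB s hs (by linarith)
        · exact hx s t hs hst ht
    _ = _ := by ring

end IsYoungPath

/-! ### Young's existence theorem. -/

/-- Left-point Riemann sums of `∫ g dx` stay close to their one-step value. -/
theorem riemannSum_sub_le {g x : ℝ → ℝ} {C θ : ℝ} (hθ : 1 < θ) (hC : 0 ≤ C)
    (h : ∀ s r t, 0 ≤ s → s ≤ r → r ≤ t → t ≤ 1 → ∀ u, r ≤ u → u ≤ t →
      |(g r - g s) * (x t - x u)| ≤ C * (t - s) ^ θ) (n : ℕ) :
    ∀ τ : ℕ → ℝ, Monotone τ → 0 ≤ τ 0 → τ n ≤ 1 →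
      |(∑ i ∈ Finset.range n, g (τ i) * (x (τ (i + 1)) - x (τ i))) - g (τ 0) * (x (τ n) - x (τ 0))|
        ≤ 2 * C / (1 - 2 ^ (1 - θ)) * (τ n - τ 0) ^ θ := by
  have h2 : (2 : ℝ) ^ (1 - θ) < 1 := Real.rpow_lt_one_of_one_lt_of_neg (by norm_num) (by linarith)
  -- `K` solves `2 C + 2^(1-θ) K = K`: one halving of the interval costs `2 C L^θ` and leaves two
  -- blocks that together contribute `2 K (L/2)^θ = 2^(1-θ) K L^θ`.
  set K := 2 * C / (1 - (2 : ℝ) ^ (1 - θ)) with hK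
  have hKid : 2 * C + K * (2 : ℝ) ^ (1 - θ) = K := by
    rw [hK]; field_simp [show 1 - (2 : ℝ) ^ (1 - θ) ≠ 0 by linarith]; ring
  have hK0 : 0 ≤ K := div_nonneg (by linarith) (by linarith)
  induction n using Nat.strong_induction_on with
  | _ n ih =>
  intro τ hτ h0 hn
  have hL0 : 0 ≤ τ n - τ 0 := sub_nonneg.mpr (hτ n.zero_le)
  rcases hL0.eq_or_lt with hL | hL
  · have hconst : ∀ i, i ≤ n → τ i = τ 0 := fun i hi =>
      le_antisymm ((hτ hi).trans (by linarith)) (hτ i.zero_le)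
    rw [Finset.sum_eq_zero, hconst n le_rfl]
    · simp
      positivity
    · intro i hi
      have := Finset.mem_range.mp hi
      rw [hconst i this.le, hconst (i + 1) this]; ring
  · set L := τ n - τ 0 with hLdef
    -- The partition interval from `τ m` to `τ (m + 1)` straddles the midpoint. The blocks before
    -- and after it both have length at most `L / 2`, so the strong induction applies to them.
    obtain ⟨m, hmn, hm1, hm2⟩ : ∃ m < n, τ m - τ 0 ≤ L / 2 ∧ L / 2 < τ (m + 1) - τ 0 := by
      have hex : ∃ k, L / 2 < τ k - τ 0 := ⟨n, by linarith⟩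
      have hk := Nat.find_spec hex
      have hk0 : Nat.find hex ≠ 0 := fun h0 => by rw [h0] at hk; linarith
      obtain ⟨m, hm⟩ := Nat.exists_eq_succ_of_ne_zero hk0
      have hle : Nat.find hex ≤ n := Nat.find_min' hex (by linarith)
      refine ⟨m, by omega, ?_, by rw [hm] at hk; exact hk⟩
      exact not_lt.mp (Nat.find_min hex (by omega))
    have hsum : ∑ i ∈ Finset.range n, g (τ i) * (x (τ (i + 1)) - x (τ i)) =
        (∑ i ∈ Finset.range m, g (τ i) * (x (τ (i + 1)) - x (τ i))) +
        g (τ m) * (x (τ (m + 1)) - x (τ m)) +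
        ∑ i ∈ Finset.range (n - m - 1), g (τ (m + 1 + i)) * (x (τ (m + 1 + i + 1)) - x (τ (m + 1 + i))) := by
      rw [← Finset.sum_range_succ, ← Finset.sum_range_add (fun i => g (τ i) * (x (τ (i + 1)) - x (τ i)))]
      congr 2; omega
    have i1 := ih m hmn τ hτ h0 ((hτ hmn.le).trans hn)
    have i2 := ih (n - m - 1) (by omega) (fun i => τ (m + 1 + i)) (fun a b hab => hτ (by omega))
      (h0.trans (hτ (Nat.zero_le _))) (by rw [show m + 1 + (n - m - 1) = n by omega]; exact hn)
    simp only [show m + 1 + (n - m - 1) = n by omega, add_zero, ← add_assoc] at i2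
    have hmm : τ m ≤ τ (m + 1) := hτ m.le_succ
    have hm0 : τ 0 ≤ τ m := hτ m.zero_le
    have hmn' : τ (m + 1) ≤ τ n := hτ hmn
    have e1 := h (τ 0) (τ m) (τ n) h0 hm0 (by linarith) hn
    have e1' := h (τ 0) (τ m) (τ (m + 1)) h0 hm0 hmm (by linarith) (τ m) le_rfl hmm
    have e2 := h (τ 0) (τ (m + 1)) (τ n) h0 (by linarith) hmn' hn (τ (m + 1)) le_rfl hmn'
    have hhalf : (L / 2) ^ θ * 2 = 2 ^ (1 - θ) * L ^ θ := by
      rw [Real.div_rpow hL0 (by norm_num), Real.rpow_sub (by norm_num), Real.rpow_one]; ring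
    have j1 : K * (τ m - τ 0) ^ θ ≤ K * (L / 2) ^ θ :=
      mul_le_mul_of_nonneg_left (Real.rpow_le_rpow (by linarith) hm1 (by linarith)) hK0
    have j2 : K * (τ n - τ (m + 1)) ^ θ ≤ K * (L / 2) ^ θ :=
      mul_le_mul_of_nonneg_left (Real.rpow_le_rpow (by linarith) (by linarith) (by linarith)) hK0
    have j3 : C * (τ (m + 1) - τ 0) ^ θ ≤ C * L ^ θ :=
      mul_le_mul_of_nonneg_left (Real.rpow_le_rpow (by linarith) (by linarith) (by linarith)) hC
    rw [hsum]
    set S1 := ∑ i ∈ Finset.range m, g (τ i) * (x (τ (i + 1)) - x (τ i))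
    set S2 := ∑ i ∈ Finset.range (n - m - 1),
      g (τ (m + 1 + i)) * (x (τ (m + 1 + i + 1)) - x (τ (m + 1 + i)))
    calc |S1 + g (τ m) * (x (τ (m + 1)) - x (τ m)) + S2 - g (τ 0) * (x (τ n) - x (τ 0))|
        = |(S1 - g (τ 0) * (x (τ m) - x (τ 0))) + (S2 - g (τ (m + 1)) * (x (τ n) - x (τ (m + 1))))
            + ((g (τ m) - g (τ 0)) * (x (τ (m + 1)) - x (τ m))
              + (g (τ (m + 1)) - g (τ 0)) * (x (τ n) - x (τ (m + 1))))| := by ring_nf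
      _ ≤ K * (L / 2) ^ θ + K * (L / 2) ^ θ + (C * L ^ θ + C * L ^ θ) := by
          refine (abs_add_le _ _).trans (add_le_add ((abs_add_le _ _).trans (add_le_add
            (i1.trans j1) (i2.trans j2))) ((abs_add_le _ _).trans (add_le_add
            (e1'.trans j3) e2)))
      _ = (2 * C + K * 2 ^ (1 - θ)) * L ^ θ := by rw [add_mul, mul_assoc K, ← hhalf]; ring
      _ = K * L ^ θ := by rw [hKid]

/-- Young's theorem: existence of the indefinite integral for Hölder exponents `a + b > 1`. -/
theorem exists_isYoungPath {g x : ℝ → ℝ} {a b : ℝ} (hg : IncrHolder a g) (hx : IncrHolder b x)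
    (ha : 0 < a) (hb : 0 < b) (hab : 1 < a + b) : ∃ X, IsYoungPath g x X := by
  have hsl := hg.superlin_mul hx hab ha hb
  obtain ⟨Cg, hg⟩ := hg
  obtain ⟨Cx, hx⟩ := hx
  have hCg := IncrHolder.const_nonneg hg
  have hCx := IncrHolder.const_nonneg hx
  set θ := a + b with hθdef
  set C := Cg * Cx with hCdef
  have hC : 0 ≤ C := mul_nonneg hCg hCx
  have key : ∀ s r u t ℓ, 0 ≤ s → s ≤ r → r ≤ 1 → 0 ≤ u → u ≤ t → t ≤ 1 → r - s ≤ ℓ → t - u ≤ ℓ →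
      |(g r - g s) * (x t - x u)| ≤ C * ℓ ^ θ := by
    intro s r u t ℓ hs hsr hr hu hut ht h1 h2
    have hℓ : 0 ≤ ℓ := by linarith
    rw [abs_mul, hθdef, Real.rpow_add_of_nonneg hℓ ha.le hb.le]
    calc |g r - g s| * |x t - x u| ≤ (Cg * ℓ ^ a) * (Cx * ℓ ^ b) := by
          refine mul_le_mul ((hg s r hs hsr hr).trans ?_) ((hx u t hu hut ht).trans ?_)
            (abs_nonneg _) (by positivity)
          · exact mul_le_mul_of_nonneg_left (Real.rpow_le_rpow (by linarith) h1 ha.le) hCg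
          · exact mul_le_mul_of_nonneg_left (Real.rpow_le_rpow (by linarith) h2 hb.le) hCx
      _ = _ := by ring
  set K := 2 * C / (1 - (2 : ℝ) ^ (1 - θ)) with hK
  have hmax := fun n => riemannSum_sub_le (g := g) (x := x) hab hC
    (fun s r t hs hsr hrt ht u hu hut => key s r u t (t - s) hs hsr (by linarith) (by linarith)
      hut ht (by linarith) (by linarith)) n
  -- Left-point sums over the uniform partition with `n + 1` intervals, stopped at time `t`. One
  -- fixed partition for all `t` makes the increments `X n t - X n s` again Riemann sums, up to the
  -- tag of the interval that contains `s`.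
  set X : ℕ → ℝ → ℝ := fun n t => ∑ i ∈ Finset.range (n + 1),
    g (i / ((n : ℝ) + 1)) * (x (min ((i + 1 : ℕ) / ((n : ℝ) + 1)) t) - x (min (i / ((n : ℝ) + 1)) t)) with hX
  have hloc : ∀ n s t, 0 ≤ s → s ≤ t → t ≤ 1 →
      |X n t - X n s - g s * (x t - x s)| ≤ K * (t - s) ^ θ + C * (1 / ((n : ℝ) + 1)) ^ θ := by
    intro n s t hs hst ht
    set N : ℝ := (n : ℝ) + 1 with hN
    have hN0 : 0 < N := by positivity
    set τ : ℕ → ℝ := fun i => max s (min (i / N) t) with hτ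
    have hτm : Monotone τ := fun i j hij => by
      simp only [hτ]; gcongr
    have hτ0 : τ 0 = s := by simp [hτ, hs]
    have hτn : τ (n + 1) = t := by
      simp only [hτ]; rw [show ((n + 1 : ℕ) : ℝ) / N = 1 by rw [hN]; push_cast; field_simp]
      rw [min_eq_right ht, max_eq_right hst]
    have hincr : X n t - X n s = ∑ i ∈ Finset.range (n + 1),
        g (i / N) * (x (τ (i + 1)) - x (τ i)) := by
      have hcl : ∀ u, x (min u t) - x (min u s) = x (max s (min u t)) - x s := by
        intro u
        rcases le_total u s with h | h
        · rw [min_eq_left h, min_eq_left (h.trans hst), max_eq_left h]; ring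
        · rw [min_eq_right h, max_eq_right (le_min h hst)]
      simp only [hX, ← Finset.sum_sub_distrib]
      refine Finset.sum_congr rfl fun i _ => ?_
      have e1 := hcl ((i + 1 : ℕ) / N)
      have e2 := hcl (i / N)
      simp only [hτ]
      linear_combination g (i / N) * (e1 - e2)
    have htag : |∑ i ∈ Finset.range (n + 1), (g (τ i) - g (i / N)) * (x (τ (i + 1)) - x (τ i))|
        ≤ C * (1 / N) ^ θ := by
      -- The truncated point `τ i` differs from the grid point `i / N` with a nonzero increment of
      -- `τ` only on the grid interval containing `s`, so a single term survives, and it vanishes as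
      -- `n` grows.
      have hb : ∀ i ∈ Finset.range (n + 1),
          |(g (τ i) - g (i / N)) * (x (τ (i + 1)) - x (τ i))| ≤
            if i = ⌊s * N⌋₊ then C * (1 / N) ^ θ else 0 := by
        intro i hi
        have hi' : (i : ℝ) + 1 ≤ N := by
          rw [hN]; exact_mod_cast Finset.mem_range.mp hi
        have hdiff : ((i + 1 : ℕ) : ℝ) / N = i / N + 1 / N := by push_cast; ring
        have hi0 : (0 : ℝ) ≤ i / N := by positivity
        have h1N : (0 : ℝ) ≤ 1 / N := by positivity
        have hi1 : (i : ℝ) / N + 1 / N ≤ 1 := by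
          rw [← add_div, div_le_one hN0]; exact hi'
        rcases le_total s (i / N) with h | h
        · have : (g (τ i) - g (i / N)) * (x (τ (i + 1)) - x (τ i)) = 0 := by
            rcases le_total (i / N : ℝ) t with h' | h'
            · have : τ i = i / N := by simp only [hτ]; rw [min_eq_left h', max_eq_right h]
              rw [this]; ring
            · have e1 : τ i = t := by simp only [hτ]; rw [min_eq_right h', max_eq_right hst]
              have e2 : τ (i + 1) = t := by
                simp only [hτ]; rw [hdiff, min_eq_right (by linarith), max_eq_right hst]
              rw [e1, e2]; ring
          rw [this, abs_zero]; split_ifs <;> positivity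
        · have e1 : τ i = s := by
            simp only [hτ]; rw [min_eq_left (h.trans hst), max_eq_left h]
          rcases le_or_gt ((i + 1 : ℕ) / N : ℝ) s with h' | h'
          · have e2 : τ (i + 1) = s := by
              simp only [hτ]; rw [min_eq_left (h'.trans hst), max_eq_left h']
            rw [e1, e2, sub_self, mul_zero, abs_zero]; split_ifs <;> positivity
          · have hfl : i = ⌊s * N⌋₊ := by
              symm; rw [Nat.floor_eq_iff (by positivity)]
              rw [div_le_iff₀ hN0] at h
              rw [lt_div_iff₀ hN0] at h'
              push_cast at h'
              exact ⟨h, h'⟩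
            rw [if_pos hfl, e1]
            have hle : τ (i + 1) ≤ i / N + 1 / N := by
              simp only [hτ]; rw [hdiff] at h' ⊢
              exact max_le h'.le (min_le_left _ _)
            have hge : s ≤ τ (i + 1) := le_max_left _ _
            exact key _ _ _ _ _ hi0 h (by linarith) hs hge (by linarith) (by rw [hdiff] at h'; linarith)
              (by linarith)
      refine (Finset.abs_sum_le_sum_abs _ _).trans ((Finset.sum_le_sum hb).trans ?_)
      rw [Finset.sum_ite_eq']
      split_ifs
      · exact le_rfl
      · positivity
    have hm := hmax (n + 1) τ hτm (by rw [hτ0]; exact hs) (by rw [hτn]; exact ht)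
    rw [hτ0, hτn] at hm
    rw [hincr]
    have hsplit : ∑ i ∈ Finset.range (n + 1), g (i / N) * (x (τ (i + 1)) - x (τ i)) =
        ∑ i ∈ Finset.range (n + 1), g (τ i) * (x (τ (i + 1)) - x (τ i)) -
        ∑ i ∈ Finset.range (n + 1), (g (τ i) - g (i / N)) * (x (τ (i + 1)) - x (τ i)) := by
      rw [← Finset.sum_sub_distrib]; exact Finset.sum_congr rfl fun i _ => by ring
    rw [hsplit]
    set S := ∑ i ∈ Finset.range (n + 1), g (τ i) * (x (τ (i + 1)) - x (τ i))
    set T := ∑ i ∈ Finset.range (n + 1), (g (τ i) - g (i / N)) * (x (τ (i + 1)) - x (τ i))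
    calc |S - T - g s * (x t - x s)| = |(S - g s * (x t - x s)) - T| := by ring_nf
      _ ≤ |S - g s * (x t - x s)| + |T| := abs_sub _ _
      _ ≤ _ := add_le_add hm htag
  have hX0 : ∀ n, X n 0 = 0 := fun n => by
    simp only [hX]
    refine Finset.sum_eq_zero fun i _ => ?_
    rw [min_eq_right (by positivity), min_eq_right (by positivity)]; ring
  have hK0 : 0 ≤ K := div_nonneg (by linarith) (by
    have : (2 : ℝ) ^ (1 - θ) < 1 := Real.rpow_lt_one_of_one_lt_of_neg (by norm_num) (by linarith)
    linarith)
  have hpow1 : ∀ n : ℕ, (1 / ((n : ℝ) + 1)) ^ θ ≤ 1 := fun n =>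
    Real.rpow_le_one (by positivity) (by
      rw [div_le_one (by positivity)]; linarith [n.cast_nonneg (α := ℝ)]) (by linarith)
  -- Boundedness suffices here: limits are taken along a nonprincipal ultrafilter, so no Cauchy
  -- property is required, and the local estimate `hloc` passes to the limit.
  have hlim : ∀ t, ∃ y, 0 ≤ t → t ≤ 1 →
      Filter.Tendsto (fun n => X n t) (Filter.hyperfilter ℕ) (nhds y) := by
    intro t
    by_cases ht : 0 ≤ t ∧ t ≤ 1
    · have hbd : ∀ n, X n t ∈ Metric.closedBall (0 : ℝ) (|g 0 * (x t - x 0)| + K + C) := by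
        intro n
        have h1 := hloc n 0 t le_rfl ht.1 ht.2
        rw [hX0, sub_zero, sub_zero] at h1
        have h2 : t ^ θ ≤ 1 := Real.rpow_le_one ht.1 ht.2 (by linarith)
        rw [mem_closedBall_zero_iff, Real.norm_eq_abs]
        have h3 : |X n t| ≤ |X n t - g 0 * (x t - x 0)| + |g 0 * (x t - x 0)| := by
          simpa using abs_add_le (X n t - g 0 * (x t - x 0)) (g 0 * (x t - x 0))
        have h4 : K * t ^ θ ≤ K := by nlinarith
        have h5 : C * (1 / ((n : ℝ) + 1)) ^ θ ≤ C := by nlinarith [hpow1 n]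
        linarith
      obtain ⟨y, -, hy⟩ := (isCompact_closedBall (0 : ℝ) _).ultrafilter_le_nhds'
        ((Filter.hyperfilter ℕ).map (fun n => X n t)) (Filter.mem_map.mpr
          (Filter.Eventually.of_forall hbd))
      exact ⟨y, fun _ _ => hy⟩
    · exact ⟨0, fun h1 h2 => (ht ⟨h1, h2⟩).elim⟩
  choose Y hY using hlim
  refine ⟨Y, ?_⟩
  have hleft : Superlin (fun s _ t => Y t - Y s - g s * (x t - x s)) := by
    refine ⟨K, θ, hab, fun s r t hs hsr hrt ht => ?_⟩
    have hst := hsr.trans hrt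
    have h1 := ((hY t (hs.trans hst) ht).sub (hY s hs (hst.trans ht))).sub_const (g s * (x t - x s))
    have hz : Filter.Tendsto (fun n : ℕ => (1 / ((n : ℝ) + 1)) ^ θ) Filter.atTop (nhds 0) := by
      have := tendsto_one_div_add_atTop_nhds_zero_nat (𝕜 := ℝ)
      simpa [Real.zero_rpow (by linarith : θ ≠ 0)] using
        this.rpow_const (p := θ) (Or.inr (by linarith))
    have h2 := ((hz.mono_left (Nat.hyperfilter_le_atTop)).const_mul C).const_add (K * (t - s) ^ θ)
    rw [mul_zero, add_zero] at h2
    exact le_of_tendsto_of_tendsto' h1.abs h2 fun n => hloc n s t hs hst ht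
  -- The limit estimate has its tag at the left end; subtracting `(g r - g s)(x t - x s)` moves it
  -- to `r`.
  exact (hleft.sub hsl).congr fun s r t _ _ _ _ => by ring

/-! ### The algebra `C[0,1]`, primitives and the Dirichlet operator. -/

/-- The Banach algebra of continuous functions on `[0,1]`. -/
abbrev CI : Type := C(unitInterval, ℝ)

namespace CI

/-- Evaluation at a real time, extended by the end values outside `[0,1]`. -/
noncomputable def ev (W : CI) (t : ℝ) : ℝ := W (Set.projIcc 0 1 zero_le_one t)

theorem ev_coe (W : CI) (t : unitInterval) : ev W t = W t := by
  rw [ev, Set.projIcc_val]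

theorem ev_of_mem (W : CI) {t : ℝ} (ht : t ∈ Set.Icc (0 : ℝ) 1) : ev W t = W ⟨t, ht⟩ := by
  rw [ev, Set.projIcc_of_mem zero_le_one ht]

theorem continuous_ev (W : CI) : Continuous (ev W) := W.continuous.comp continuous_projIcc

theorem abs_ev_le (W : CI) (t : ℝ) : |ev W t| ≤ ‖W‖ := W.norm_coe_le_norm _

theorem norm_le_of_ev {W : CI} {C : ℝ} (hC : 0 ≤ C) (h : ∀ t, 0 ≤ t → t ≤ 1 → |ev W t| ≤ C) :
    ‖W‖ ≤ C :=
  (ContinuousMap.norm_le W hC).mpr fun t => by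
    rw [← ev_coe]; exact h t t.2.1 t.2.2

theorem ext_ev {U W : CI} (h : ∀ t, 0 ≤ t → t ≤ 1 → ev U t = ev W t) : U = W :=
  ContinuousMap.ext fun t => by rw [← ev_coe, ← ev_coe]; exact h t t.2.1 t.2.2

@[simp] theorem ev_add (U W : CI) (t : ℝ) : ev (U + W) t = ev U t + ev W t := rfl
@[simp] theorem ev_sub (U W : CI) (t : ℝ) : ev (U - W) t = ev U t - ev W t := rfl
@[simp] theorem ev_neg (U : CI) (t : ℝ) : ev (-U) t = -ev U t := rfl
@[simp] theorem ev_mul (U W : CI) (t : ℝ) : ev (U * W) t = ev U t * ev W t := rfl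
@[simp] theorem ev_smul (c : ℝ) (W : CI) (t : ℝ) : ev (c • W) t = c * ev W t := rfl
@[simp] theorem ev_one (t : ℝ) : ev 1 t = 1 := rfl
@[simp] theorem ev_zero (t : ℝ) : ev 0 t = 0 := rfl
@[simp] theorem ev_comp (f : C(ℝ, ℝ)) (W : CI) (t : ℝ) : ev (f.comp W) t = f (ev W t) := rfl

theorem intervalIntegrable_ev (W : CI) (a b : ℝ) :
    IntervalIntegrable (ev W) MeasureTheory.volume a b :=
  (continuous_ev W).intervalIntegrable a b

/-- The element of `C[0,1]` given by a function continuous on `[0,1]`. -/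
def ofContinuousOn (f : ℝ → ℝ) (hf : ContinuousOn f (Set.Icc 0 1)) : CI :=
  ⟨fun t => f t, continuousOn_iff_continuous_domRestrict.mp hf⟩

theorem ev_ofContinuousOn {f : ℝ → ℝ} (hf : ContinuousOn f (Set.Icc 0 1)) {t : ℝ} (ht : 0 ≤ t)
    (ht1 : t ≤ 1) : ev (ofContinuousOn f hf) t = f t := by
  rw [ev_of_mem _ ⟨ht, ht1⟩]; rfl

/-- Evaluation as a continuous linear functional. -/
noncomputable def evL (t : ℝ) : CI →L[ℝ] ℝ :=
  ContinuousMap.evalCLM ℝ (Set.projIcc 0 1 zero_le_one t)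

theorem abs_integral_ev_le (W : CI) {s t : ℝ} (hst : s ≤ t) :
    |∫ u in s..t, ev W u| ≤ ‖W‖ * (t - s) := by
  have := intervalIntegral.norm_integral_le_of_norm_le_const (f := ev W) (a := s) (b := t)
    (C := ‖W‖) fun u _ => abs_ev_le W u
  rwa [abs_of_nonneg (sub_nonneg.mpr hst)] at this

/-- The primitive vanishing at `0`. -/
noncomputable def J : CI →L[ℝ] CI :=
  LinearMap.mkContinuous
    { toFun := fun W => ⟨fun t => ∫ u in (0 : ℝ)..t, ev W u,
        (intervalIntegral.continuous_primitive (intervalIntegrable_ev W) 0).comp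
          continuous_subtype_val⟩
      map_add' := fun U W => by
        ext t
        exact intervalIntegral.integral_add (intervalIntegrable_ev U _ _)
          (intervalIntegrable_ev W _ _)
      map_smul' := fun c W => by
        ext t
        exact intervalIntegral.integral_const_mul c (ev W) }
    1 fun W => by
      rw [one_mul]
      refine (ContinuousMap.norm_le _ (norm_nonneg W)).mpr fun t => ?_
      refine (abs_integral_ev_le W t.2.1).trans ?_
      have := t.2.2
      nlinarith [norm_nonneg W]

theorem ev_J (W : CI) {t : ℝ} (ht : 0 ≤ t) (ht1 : t ≤ 1) :
    ev (J W) t = ∫ u in (0 : ℝ)..t, ev W u := by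
  rw [ev_of_mem _ ⟨ht, ht1⟩]; rfl

theorem ev_J_sub (W : CI) {s t : ℝ} (hs : 0 ≤ s) (hst : s ≤ t) (ht : t ≤ 1) :
    ev (J W) t - ev (J W) s = ∫ u in s..t, ev W u := by
  rw [ev_J W (hs.trans hst) ht, ev_J W hs (hst.trans ht),
    intervalIntegral.integral_interval_sub_left (intervalIntegrable_ev W _ _)
      (intervalIntegrable_ev W _ _)]

@[simp] theorem ev_J_zero (W : CI) : ev (J W) 0 = 0 := by
  rw [ev_J W le_rfl zero_le_one, intervalIntegral.integral_same]

theorem norm_J_le (W : CI) : ‖J W‖ ≤ ‖W‖ := by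
  have := J.le_of_opNorm_le (LinearMap.mkContinuous_norm_le _ zero_le_one _) W
  rwa [one_mul] at this

theorem ev_J_one {t : ℝ} (ht : 0 ≤ t) (ht1 : t ≤ 1) : ev (J 1) t = t := by
  rw [ev_J _ ht ht1]; simp

theorem abs_ev_J_sub_le (W : CI) {s t : ℝ} (hs : 0 ≤ s) (hst : s ≤ t) (ht : t ≤ 1) :
    |ev (J W) t - ev (J W) s| ≤ ‖W‖ * (t - s) := by
  rw [ev_J_sub W hs hst ht]; exact abs_integral_ev_le W hst

theorem hasDerivAt_integral_ev (W : CI) (t : ℝ) :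
    HasDerivAt (fun t => ∫ u in (0 : ℝ)..t, ev W u) (ev W t) t :=
  intervalIntegral.integral_hasDerivAt_right (intervalIntegrable_ev W _ _)
    ((continuous_ev W).stronglyMeasurableAtFilter _ _) (continuous_ev W).continuousAt

/-- The product rule, written for primitives. It serves to remove nested primitives in `S_byParts`.
-/
theorem J_mul_J (U W : CI) : J U * J W = J (U * J W + J U * W) := by
  refine ext_ev fun t ht ht1 => ?_
  rw [ev_mul, ev_J _ ht ht1, ev_J _ ht ht1, ev_J _ ht ht1]
  have h := intervalIntegral.integral_eq_sub_of_hasDerivAt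
    (f := fun t => (∫ u in (0 : ℝ)..t, ev U u) * ∫ u in (0 : ℝ)..t, ev W u)
    (f' := fun t => ev U t * (∫ u in (0 : ℝ)..t, ev W u) + (∫ u in (0 : ℝ)..t, ev U u) * ev W t)
    (a := 0) (b := t) (fun r _ => (hasDerivAt_integral_ev U r).mul (hasDerivAt_integral_ev W r))
    (Continuous.intervalIntegrable (by
      have := continuous_ev U
      have := continuous_ev W
      have := intervalIntegral.continuous_primitive (intervalIntegrable_ev U) 0
      have := intervalIntegral.continuous_primitive (intervalIntegrable_ev W) 0
      fun_prop) _ _)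
  simp only [intervalIntegral.integral_same, mul_zero, sub_zero] at h
  rw [← h]
  refine intervalIntegral.integral_congr fun r hr => ?_
  rw [Set.uIcc_of_le ht] at hr
  simp only [ev_add, ev_mul]
  rw [ev_J _ hr.1 (hr.2.trans ht1), ev_J _ hr.1 (hr.2.trans ht1)]

/-- The derivative of the solution `P W` of the Dirichlet problem: the mean of `W` minus `W`. -/
noncomputable def Q : CI →L[ℝ] CI :=
  ((evL 1).comp J).smulRight (1 : CI) - ContinuousLinearMap.id ℝ CI

@[simp] theorem ev_Q (W : CI) (t : ℝ) : ev (Q W) t = ev (J W) 1 - ev W t := by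
  change ev (ev (J W) 1 • (1 : CI)) t - ev W t = _
  simp

theorem norm_Q_le (W : CI) : ‖Q W‖ ≤ 2 * ‖W‖ := by
  refine norm_le_of_ev (by positivity) fun t _ _ => ?_
  rw [ev_Q]
  refine (abs_sub _ _).trans ?_
  linarith [abs_ev_le W t, abs_ev_le (J W) 1, norm_J_le W]

/-- `P W (t) = t ∫_0^1 W - ∫_0^t W`. -/
noncomputable def P : CI →L[ℝ] CI := J.comp Q

theorem P_apply (W : CI) : P W = J (Q W) := rfl

theorem Q_eq (W : CI) : Q W = ev (J W) 1 • 1 - W := rfl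

theorem ev_P (W : CI) {t : ℝ} (ht : 0 ≤ t) (ht1 : t ≤ 1) :
    ev (P W) t = t * ev (J W) 1 - ev (J W) t := by
  rw [P_apply, Q_eq, map_sub, map_smul, ev_sub, ev_smul, ev_J_one ht ht1]; ring

theorem norm_P_le (W : CI) : ‖P W‖ ≤ 2 * ‖W‖ := (norm_J_le _).trans (norm_Q_le W)

theorem ev_P_sub (W : CI) {s t : ℝ} (hs : 0 ≤ s) (hst : s ≤ t) (ht : t ≤ 1) :
    ev (P W) t - ev (P W) s = (t - s) * ev (J W) 1 - ∫ u in s..t, ev W u := by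
  rw [ev_P W (hs.trans hst) ht, ev_P W hs (hst.trans ht), ← ev_J_sub W hs hst ht]; ring

theorem P_zero_left (W : CI) : ev (P W) 0 = 0 := by rw [P_apply, ev_J_zero]

end CI

open CI

/-! ### Young integrals in `C[0,1]` and the Green kernel as integrator. -/

theorem IncrHolder.continuousOn {a : ℝ} {f : ℝ → ℝ} (h : IncrHolder a f) (ha : 0 < a) :
    ContinuousOn f (Set.Icc 0 1) := by
  obtain ⟨C, h⟩ := h
  have hsym : ∀ s ∈ Set.Icc (0 : ℝ) 1, ∀ t ∈ Set.Icc (0 : ℝ) 1, |f t - f s| ≤ C * |t - s| ^ a := by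
    intro s hs t ht
    rcases le_total s t with hst | hst
    · rw [abs_of_nonneg (sub_nonneg.mpr hst)]; exact h s t hs.1 hst ht.2
    · rw [abs_sub_comm, abs_sub_comm t, abs_of_nonneg (sub_nonneg.mpr hst)]
      exact h t s ht.1 hst hs.2
  intro s hs
  rw [ContinuousWithinAt, tendsto_iff_dist_tendsto_zero]
  have hz : Filter.Tendsto (fun t => C * |t - s| ^ a) (nhdsWithin s (Set.Icc 0 1)) (nhds 0) := by
    have hc : Continuous fun t : ℝ => C * |t - s| ^ a :=
      continuous_const.mul ((continuous_id.sub continuous_const).abs.rpow_const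
        fun _ => Or.inr ha.le)
    have := (hc.tendsto s).mono_left (nhdsWithin_le_nhds (s := Set.Icc (0 : ℝ) 1))
    simpa [Real.zero_rpow ha.ne'] using this
  refine squeeze_zero' (Filter.Eventually.of_forall fun _ => dist_nonneg) ?_ hz
  filter_upwards [self_mem_nhdsWithin] with t ht
  rw [Real.dist_eq]
  exact hsym s hs t ht

theorem IncrHolder.congr {a : ℝ} {f g : ℝ → ℝ} (h : IncrHolder a f)
    (hfg : ∀ t, 0 ≤ t → t ≤ 1 → g t = f t) : IncrHolder a g := by
  obtain ⟨C, h⟩ := h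
  refine ⟨C, fun s t hs hst ht => ?_⟩
  rw [hfg t (hs.trans hst) ht, hfg s hs (hst.trans ht)]
  exact h s t hs hst ht

theorem IncrHolder.comp {a L : ℝ} {f σ : ℝ → ℝ} (h : IncrHolder a f)
    (hσ : ∀ u v, |σ u - σ v| ≤ L * |u - v|) : IncrHolder a (fun t => σ (f t)) := by
  obtain ⟨C, h⟩ := h
  have hL : 0 ≤ L := by simpa using (abs_nonneg _).trans (hσ 1 0)
  refine ⟨L * C, fun s t hs hst ht => (hσ _ _).trans ?_⟩
  rw [mul_assoc]
  exact mul_le_mul_of_nonneg_left (h s t hs hst ht) hL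

/-- Young's theorem, with the indefinite integral as an element of `C[0,1]` vanishing at `0`. -/
theorem exists_isYoungPath_ev {g x : ℝ → ℝ} {a b : ℝ} (hg : IncrHolder a g) (hx : IncrHolder b x)
    (ha : 0 < a) (hb : 0 < b) (hb1 : b ≤ 1) (hab : 1 < a + b) :
    ∃ U : CI, IsYoungPath g x (ev U) ∧ ev U 0 = 0 ∧ IncrHolder b (ev U) := by
  obtain ⟨X, hX⟩ := exists_isYoungPath hg hx ha hb hab
  obtain ⟨B, hB⟩ := hg.bounded ha.le
  have hXh := hX.incrHolder hx hb.le hb1 hB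
  have hYh := hXh.add (IncrHolder.const b (-X 0))
  have hev : ∀ t, 0 ≤ t → t ≤ 1 → ev (ofContinuousOn _ (hYh.continuousOn hb)) t = X t + -X 0 :=
    fun t ht ht1 => ev_ofContinuousOn _ ht ht1
  refine ⟨ofContinuousOn _ (hYh.continuousOn hb), ?_, ?_, hYh.congr hev⟩
  · refine IsYoungPath.congr (X := fun t => X t + -X 0) ?_ (fun _ _ _ => rfl) (fun _ _ _ => rfl) hev
    exact Superlin.congr hX fun s r t _ _ _ _ => by ring
  · rw [hev 0 le_rfl zero_le_one]; ring

/-- On the window `[s,t]` the factor `U` differs from its value at the tag by at most `C (t - s)^a`.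
The domain `[u,v]` is kept separate from the window because the integrator `min τ ξ` moves on only
part of it. -/
theorem abs_integral_sub_mul_le {a C : ℝ} {U : CI} (ha : 0 < a)
    (hU : ∀ s t, 0 ≤ s → s ≤ t → t ≤ 1 → |ev U t - ev U s| ≤ C * (t - s) ^ a) (W : CI)
    {s r t u v : ℝ} (hs : 0 ≤ s) (hsr : s ≤ r) (hrt : r ≤ t) (ht : t ≤ 1)
    (hsu : s ≤ u) (huv : u ≤ v) (hvt : v ≤ t) :
    |(∫ y in u..v, ev (U * W) y) - ev U r * ∫ y in u..v, ev W y| ≤ C * ‖W‖ * (t - s) ^ (1 + a) := by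
  have hC := IncrHolder.const_nonneg hU
  have hts : 0 ≤ t - s := by linarith
  rw [← intervalIntegral.integral_const_mul, ← intervalIntegral.integral_sub
    (intervalIntegrable_ev _ _ _) ((intervalIntegrable_ev _ _ _).const_mul _)]
  have hb : ∀ y ∈ Set.uIoc u v, ‖ev (U * W) y - ev U r * ev W y‖ ≤ C * (t - s) ^ a * ‖W‖ := by
    intro y hy
    rw [Set.uIoc_of_le huv] at hy
    rw [ev_mul, ← sub_mul, norm_mul]
    refine mul_le_mul ?_ (abs_ev_le W y) (abs_nonneg _) (by positivity)
    have hmono : ∀ d, 0 ≤ d → d ≤ t - s → C * d ^ a ≤ C * (t - s) ^ a := fun d h0 h1 =>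
      mul_le_mul_of_nonneg_left (Real.rpow_le_rpow h0 h1 ha.le) hC
    rcases le_total r y with h | h
    · exact (hU r y (by linarith) h (by linarith [hy.2])).trans
        (hmono _ (by linarith) (by linarith [hy.2]))
    · rw [norm_sub_rev]
      exact (hU y r (by linarith [hy.1]) h (by linarith)).trans
        (hmono _ (by linarith) (by linarith [hy.1]))
  have := intervalIntegral.norm_integral_le_of_norm_le_const hb
  rw [abs_of_nonneg (sub_nonneg.mpr huv)] at this
  refine this.trans ?_
  rw [Real.rpow_add_of_nonneg hts zero_le_one ha.le, Real.rpow_one]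
  calc C * (t - s) ^ a * ‖W‖ * (v - u) ≤ C * (t - s) ^ a * ‖W‖ * (t - s) := by
        gcongr
    _ = _ := by ring

theorem isYoungPath_J {a : ℝ} {U : CI} (hU : IncrHolder a (ev U)) (ha : 0 < a) (W : CI) :
    IsYoungPath (ev U) (ev (J W)) (ev (J (U * W))) := by
  obtain ⟨C, hU⟩ := hU
  refine ⟨C * ‖W‖, 1 + a, by linarith, fun s r t hs hsr hrt ht => ?_⟩
  have hst := hsr.trans hrt
  simp only
  rw [ev_J_sub _ hs hst ht, ev_J_sub _ hs hst ht]
  exact abs_integral_sub_mul_le ha hU W hs hsr hrt ht le_rfl hst le_rfl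

/-- Where the window lies beyond `τ` the integrator is constant; otherwise it is the identity up to
`τ`, and the primitive is stopped at `τ`. -/
theorem isYoungPath_min {a : ℝ} {U : CI} (hU : IncrHolder a (ev U)) (ha : 0 < a) {τ : ℝ}
    (hτ : 0 ≤ τ) : IsYoungPath (ev U) (fun ξ => min τ ξ) (fun ξ => ev (J U) (min τ ξ)) := by
  obtain ⟨C, hU⟩ := hU
  refine ⟨C * ‖(1 : CI)‖, 1 + a, by linarith, fun s r t hs hsr hrt ht => ?_⟩
  have hst := hsr.trans hrt
  have hC := IncrHolder.const_nonneg hU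
  have hmm : min τ s ≤ min τ t := min_le_min_left _ hst
  have hm0 : 0 ≤ min τ s := le_min hτ hs
  have hmt : min τ t ≤ t := min_le_right _ _
  simp only
  rcases le_total s τ with h | h
  · rw [ev_J_sub _ hm0 hmm (hmt.trans ht)]
    have := abs_integral_sub_mul_le ha hU 1 hs hsr hrt ht (u := min τ s) (v := min τ t)
      (by rw [min_eq_right h]) hmm hmt
    simpa using this
  · rw [min_eq_left h, min_eq_left (h.trans hst)]
    have : 0 ≤ t - s := by linarith
    simp only [sub_self, mul_zero, abs_zero]
    positivity

theorem isYoungPath_greenK {a : ℝ} {U : CI} (hU : IncrHolder a (ev U)) (ha : 0 < a) {τ : ℝ}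
    (hτ : 0 ≤ τ) :
    IsYoungPath (ev U) (greenK τ) (fun ξ => ev (J U) (min τ ξ) - τ * ev (J U) ξ) := by
  have h1 := isYoungPath_J hU ha 1
  rw [mul_one] at h1
  have h2 := (isYoungPath_min hU ha hτ).add_right (h1.const_mul_right (-τ))
  exact h2.congr (fun _ _ _ => rfl)
    (fun t ht ht1 => by rw [ev_J_one ht ht1, greenK]; ring) (fun t _ _ => by ring)

theorem abs_greenK_le {τ : ℝ} (hτ : 0 ≤ τ) (hτ1 : τ ≤ 1) :
    ∀ t, 0 ≤ t → t ≤ 1 → |greenK τ t| ≤ 1 := by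
  intro t ht ht1
  rw [greenK, abs_le]
  have h1 : 0 ≤ τ * t := mul_nonneg hτ ht
  have h2 : τ * t ≤ 1 := mul_le_one₀ hτ1 ht ht1
  have h3 : 0 ≤ min τ t := le_min hτ ht
  have h4 : min τ t ≤ 1 := (min_le_left _ _).trans hτ1
  constructor <;> linarith

/-- The primitive of `K(τ,·) g dx` in terms of the primitive `U` of `g dx`. -/
theorem IsYoungPath.greenK_mul {a : ℝ} {g x : ℝ → ℝ} {U : CI} (h : IsYoungPath g x (ev U))
    (hU : IncrHolder a (ev U)) (ha : 0 < a) {τ : ℝ} (hτ : 0 ≤ τ) (hτ1 : τ ≤ 1) :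
    IsYoungPath (fun ξ => greenK τ ξ * g ξ) x
      (fun ξ => greenK τ ξ * ev U ξ - (ev (J U) (min τ ξ) - τ * ev (J U) ξ)) :=
  h.mul (isYoungPath_greenK hU ha hτ) (abs_greenK_le hτ hτ1)

/-! ### The Hölder space and its maps to and from `C[0,1]`. -/

theorem HolderC.incrHolder {α : ℝ≥0} (f : HolderC α) : IncrHolder α (ev f.toC) := by
  obtain ⟨C, hC⟩ := (f.2 : MemHolder α f.toC)
  refine ⟨C, fun s t hs hst ht => ?_⟩
  rw [ev_of_mem _ ⟨hs, hst.trans ht⟩, ev_of_mem _ ⟨hs.trans hst, ht⟩]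
  have := hC.dist_le ⟨t, hs.trans hst, ht⟩ ⟨s, hs, hst.trans ht⟩
  rw [Real.dist_eq, Subtype.dist_eq, Real.dist_eq] at this
  rwa [show |((⟨t, hs.trans hst, ht⟩ : unitInterval) : ℝ) - (⟨s, hs, hst.trans ht⟩ : unitInterval)| =
    t - s from abs_of_nonneg (sub_nonneg.mpr hst)] at this

theorem HolderC.abs_sub_le {α : ℝ≥0} (f : HolderC α) {s t : ℝ} (hs : s ∈ Set.Icc (0 : ℝ) 1)
    (ht : t ∈ Set.Icc (0 : ℝ) 1) : |ev f.toC t - ev f.toC s| ≤ ‖f‖ * |t - s| ^ (α : ℝ) := by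
  have hf : MemHolder α f.toC := f.2
  have := hf.holderWith.dist_le ⟨t, ht⟩ ⟨s, hs⟩
  rw [Real.dist_eq, Subtype.dist_eq, Real.dist_eq] at this
  rw [ev_of_mem _ hs, ev_of_mem _ ht]
  refine this.trans ?_
  gcongr
  change _ ≤ ‖f.toC‖ + (nnHolderNorm α f.toC : ℝ)
  linarith [norm_nonneg f.toC]

theorem HolderC.ext_ev {α : ℝ≥0} {f g : HolderC α}
    (h : ∀ t, 0 ≤ t → t ≤ 1 → ev f.toC t = ev g.toC t) : f = g :=
  Subtype.ext (CI.ext_ev h)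

/-- The inclusion of `C^α` into `C[0,1]`. -/
noncomputable def HolderC.toCL (α : ℝ≥0) : HolderC α →L[ℝ] CI :=
  LinearMap.mkContinuous
    { toFun := HolderC.toC, map_add' := fun _ _ => rfl, map_smul' := fun _ _ => rfl } 1 fun f => by
      rw [one_mul]
      change ‖f.toC‖ ≤ ‖f.toC‖ + (nnHolderNorm α f.toC : ℝ)
      linarith [NNReal.coe_nonneg (nnHolderNorm α f.toC)]

theorem holderWith_of_incr {α : ℝ≥0} {W : CI} {C : ℝ≥0}
    (h : ∀ s t, 0 ≤ s → s ≤ t → t ≤ 1 → |ev W t - ev W s| ≤ C * (t - s) ^ (α : ℝ)) :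
    HolderWith C α W := by
  intro s t
  have hreal : dist (W s) (W t) ≤ C * dist s t ^ (α : ℝ) := by
    rw [Real.dist_eq, Subtype.dist_eq, Real.dist_eq, ← ev_coe W s, ← ev_coe W t]
    rcases le_total (s : ℝ) t with hst | hst
    · rw [abs_sub_comm, abs_sub_comm (s : ℝ), abs_of_nonneg (sub_nonneg.mpr hst)]
      exact h s t s.2.1 hst t.2.2
    · rw [abs_of_nonneg (sub_nonneg.mpr hst)]
      exact h t s t.2.1 hst s.2.2
  rw [edist_dist, edist_dist, ENNReal.ofReal_rpow_of_nonneg dist_nonneg α.coe_nonneg,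
    ← ENNReal.ofReal_coe_nnreal, ← ENNReal.ofReal_mul C.coe_nonneg]
  exact ENNReal.ofReal_le_ofReal hreal

theorem memHolder_of_incrHolder {α : ℝ≥0} {W : CI} (h : IncrHolder α (ev W)) : MemHolder α W := by
  obtain ⟨C, h⟩ := h
  exact ⟨⟨C, IncrHolder.const_nonneg h⟩, holderWith_of_incr h⟩

/-- A primitive is Lipschitz, hence lies in every `C^α` with `α ≤ 1`. This smoothing transfers
differentiability of `W` in the sup norm to differentiability of `z` in `C^κ`. -/
theorem lipschitz_J {α : ℝ≥0} (hα : α ≤ 1) (W : CI) :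
    HolderWith ‖W‖₊ α (J W) := by
  refine holderWith_of_incr fun s t hs hst ht => (abs_ev_J_sub_le W hs hst ht).trans ?_
  refine mul_le_mul_of_nonneg_left ?_ (norm_nonneg _)
  nth_rewrite 1 [← Real.rpow_one (t - s)]
  exact Real.rpow_le_rpow_of_exponent_ge' (by linarith) (by linarith) α.2 (by exact_mod_cast hα)

/-- The primitive as a Hölder function. -/
noncomputable def JH {α : ℝ≥0} (hα : α ≤ 1) : CI →L[ℝ] HolderC α :=
  LinearMap.mkContinuous
    { toFun := fun W => ⟨J W, ⟨_, lipschitz_J hα W⟩⟩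
      map_add' := fun U W => Subtype.ext (map_add J U W)
      map_smul' := fun c W => Subtype.ext (map_smul J c W) } 2 fun W => by
      change ‖J W‖ + (nnHolderNorm α (J W) : ℝ) ≤ _
      have h1 : (nnHolderNorm α (J W) : ℝ) ≤ ‖W‖ := by
        have := (lipschitz_J hα W).nnholderNorm_le
        exact_mod_cast this
      linarith [norm_J_le W]

/-- The Dirichlet solution operator `P` with values in `C^α`. -/
noncomputable def PH {α : ℝ≥0} (hα : α ≤ 1) : CI →L[ℝ] HolderC α := (JH hα).comp Q

theorem toC_PH {α : ℝ≥0} (hα : α ≤ 1) (W : CI) : (PH hα W).toC = P W := rfl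

/-! ### Integration by parts, the fixed point map and its derivative. -/

namespace CI

/-- `x - x_0`. -/
noncomputable def pin : CI →L[ℝ] CI :=
  ContinuousLinearMap.id ℝ CI - (evL 0).smulRight (1 : CI)

theorem pin_apply (x : CI) : pin x = x - ev x 0 • 1 := rfl

@[simp] theorem ev_pin (x : CI) (t : ℝ) : ev (pin x) t = ev x t - ev x 0 := by
  rw [pin_apply]; simp

/-- The chain rule in integrated form. It exhibits `σ(P W)` as a constant plus a primitive, so that
it can serve as an integrator through `isYoungPath_J`. -/
theorem comp_J {s0 s1 : C(ℝ, ℝ)} (hs : ∀ y, HasDerivAt s0 (s1 y) y) (W : CI) :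
    s0.comp (J W) = s0 0 • 1 + J (s1.comp (J W) * W) := by
  refine ext_ev fun t ht ht1 => ?_
  have h := intervalIntegral.integral_eq_sub_of_hasDerivAt
    (f := fun t => s0 (∫ u in (0 : ℝ)..t, ev W u))
    (f' := fun t => s1 (∫ u in (0 : ℝ)..t, ev W u) * ev W t)
    (a := 0) (b := t) (fun r _ => (hs _).comp r (hasDerivAt_integral_ev W r))
    (Continuous.intervalIntegrable (by
      have := continuous_ev W
      have := intervalIntegral.continuous_primitive (intervalIntegrable_ev W) 0
      fun_prop) _ _)
  simp only [intervalIntegral.integral_same] at h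
  rw [ev_comp, ev_add, ev_smul, ev_one, mul_one, ev_J _ ht ht1, ev_J _ ht ht1, ← sub_eq_iff_eq_add',
    ← h]
  refine intervalIntegral.integral_congr fun r hr => ?_
  rw [Set.uIcc_of_le ht] at hr
  simp only [ev_mul, ev_comp]
  rw [ev_J _ hr.1 (hr.2.trans ht1)]

/-- `I_W x = σ(PW) (x - x_0) - ∫ (x - x_0) σ'(PW) (PW)'`, which is `∫ σ(PW) dx` by parts; here
`s0 = σ` and `s1 = σ'`. -/
noncomputable def byParts (s0 s1 : C(ℝ, ℝ)) (W : CI) : CI →L[ℝ] CI :=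
  (ContinuousLinearMap.mul ℝ CI (s0.comp (P W))).comp pin
    - J.comp ((ContinuousLinearMap.mul ℝ CI (s1.comp (P W) * Q W)).comp pin)

theorem byParts_apply (s0 s1 : C(ℝ, ℝ)) (W x : CI) :
    byParts s0 s1 W x = s0.comp (P W) * pin x - J (s1.comp (P W) * Q W * pin x) := rfl

theorem byParts_zero (s0 s1 : C(ℝ, ℝ)) (W x : CI) : ev (byParts s0 s1 W x) 0 = 0 := by
  rw [byParts_apply]; simp

theorem _root_.IsYoungPath.add_const_right {g x X : ℝ → ℝ} (h : IsYoungPath g x X) (c : ℝ) :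
    IsYoungPath g (fun t => x t + c) X :=
  Superlin.congr h fun s r t _ _ _ _ => by ring

/-- Integration by parts starting from `∫ 1 dx = x - x_0`, with the smooth factor `σ(P W)`. Only
some positive Hölder exponent of `x` is needed, since `P W` is differentiable. -/
theorem isYoungPath_byParts {s0 s1 : C(ℝ, ℝ)} (hs : ∀ y, HasDerivAt s0 (s1 y) y) (W : CI) {x : CI}
    {a : ℝ} (hx : IncrHolder a (ev x)) (ha : 0 < a) :
    IsYoungPath (fun t => s0 (ev (P W) t)) (ev x) (ev (byParts s0 s1 W x)) := by
  have hpin : IncrHolder a (ev (pin x)) :=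
    (hx.add (IncrHolder.const a (-ev x 0))).congr fun t _ _ => by rw [ev_pin]; ring
  have h1 : IsYoungPath (fun _ => 1) (ev x) (ev (pin x)) :=
    (IsYoungPath.one (ev x)).congr (fun _ _ _ => rfl) (fun _ _ _ => rfl) fun t _ _ => ev_pin x t
  have h2 := (isYoungPath_J hpin ha (s1.comp (P W) * Q W)).add_const_right (s0 0)
  have h3 := h1.mul (h2.congr (x' := ev (s0.comp (P W))) (fun _ _ _ => rfl) (fun t _ _ => by
    rw [P_apply, comp_J hs, ev_add, ev_smul, ev_one, mul_one, add_comm]) fun _ _ _ => rfl)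
    (fun t _ _ => abs_ev_le _ t)
  refine h3.congr (fun t _ _ => by simp) (fun _ _ _ => rfl) fun t _ _ => ?_
  rw [byParts_apply, ev_sub, ev_mul, mul_comm (pin x)]

/-- `S F V = F PV - ∫ F (PV)'`, the primitive of `f PV dx` in terms of that `F` of `f dx`. -/
noncomputable def S (F : CI) : CI →L[ℝ] CI :=
  (ContinuousLinearMap.mul ℝ CI F).comp P - J.comp ((ContinuousLinearMap.mul ℝ CI F).comp Q)

theorem S_apply (F V : CI) : S F V = F * P V - J (F * Q V) := rfl

theorem S_zero_left (F V : CI) : ev (S F V) 0 = 0 := by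
  rw [S_apply, ev_sub, ev_mul, P_zero_left, ev_J_zero]; ring

theorem _root_.IsYoungPath.S {f x : ℝ → ℝ} {F : CI} {a : ℝ} (h : IsYoungPath f x (ev F))
    (hF : IncrHolder a (ev F)) (ha : 0 < a) (V : CI) :
    IsYoungPath (fun t => f t * ev (P V) t) x (ev (S F V)) := by
  have h1 := h.mul (k := ev (P V)) (isYoungPath_J hF ha (Q V)) (fun t _ _ => abs_ev_le _ t)
  refine h1.congr (fun t _ _ => mul_comm _ _) (fun _ _ _ => rfl) fun t _ _ => ?_
  rw [S_apply, ev_sub, ev_mul, mul_comm (ev F t)]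

/-- The right side is what differentiating `byParts` (for `σ`) in `W` in direction `V` produces. The
product rule `J_mul_J` cancels the nested primitive that arises from `J` inside `byParts`. -/
theorem S_byParts (s1 s2 : C(ℝ, ℝ)) (W x V : CI) :
    S (byParts s1 s2 W x) V = s1.comp (P W) * P V * pin x
      - J ((s2.comp (P W) * P V * Q W + s1.comp (P W) * Q V) * pin x) := by
  rw [S_apply, byParts_apply]
  set b := s1.comp (P W) * pin x with hb
  set β := s2.comp (P W) * Q W * pin x with hβ
  have h := J_mul_J β (Q V)
  rw [← P_apply] at h
  have e1 : (s2.comp (P W) * P V * Q W + s1.comp (P W) * Q V) * pin x = β * P V + b * Q V := by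
    rw [hβ, hb]; ring
  have e2 : (b - J β) * Q V = b * Q V - J β * Q V := by ring
  have e3 : (b - J β) * P V = b * P V - J β * P V := by ring
  rw [e1, e2, e3, h]
  simp only [map_add, map_sub]
  rw [hb]; ring

theorem norm_comp_le {s : C(ℝ, ℝ)} {c : ℝ} (hs : ∀ y, |s y| ≤ c) (W : CI) : ‖s.comp W‖ ≤ c :=
  norm_le_of_ev ((abs_nonneg _).trans (hs 0)) fun _ _ _ => hs _

theorem norm_comp_sub_le {s : C(ℝ, ℝ)} {c : ℝ} (hs : ∀ u v, |s u - s v| ≤ c * |u - v|) (W W' : CI) :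
    ‖s.comp W - s.comp W'‖ ≤ c * ‖W - W'‖ := by
  have hc : 0 ≤ c := by simpa using (abs_nonneg _).trans (hs 1 0)
  refine norm_le_of_ev (by positivity) fun t _ _ => (hs _ _).trans ?_
  exact mul_le_mul_of_nonneg_left (abs_ev_le (W - W') t) hc

theorem norm_byParts_le {s0 s1 : C(ℝ, ℝ)} {c : ℝ} (h0 : ∀ y, |s0 y| ≤ c) (h1 : ∀ y, |s1 y| ≤ c)
    (W x : CI) : ‖byParts s0 s1 W x‖ ≤ c * ‖pin x‖ * (1 + 2 * ‖W‖) := by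
  have hc : 0 ≤ c := (abs_nonneg _).trans (h0 0)
  rw [byParts_apply]
  calc ‖s0.comp (P W) * pin x - J (s1.comp (P W) * Q W * pin x)‖
      ≤ ‖s0.comp (P W) * pin x‖ + ‖s1.comp (P W) * Q W * pin x‖ :=
        (norm_sub_le _ _).trans (add_le_add le_rfl (norm_J_le _))
    _ ≤ c * ‖pin x‖ + c * (2 * ‖W‖) * ‖pin x‖ := by
        refine add_le_add ((norm_mul_le _ _).trans ?_) ((norm_mul_le _ _).trans ?_)
        · exact mul_le_mul_of_nonneg_right (norm_comp_le h0 _) (norm_nonneg _)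
        · refine mul_le_mul_of_nonneg_right ((norm_mul_le _ _).trans ?_) (norm_nonneg _)
          exact mul_le_mul (norm_comp_le h1 _) (norm_Q_le W) (norm_nonneg _) hc
    _ = _ := by ring

/-- The term `σ'(P W) Q W` is split so that only `Q W'` appears without a difference. Hence just one
of the two arguments has to lie in the unit ball, which later gives uniqueness among all continuous
functions. -/
theorem norm_byParts_sub_le {s0 s1 : C(ℝ, ℝ)} {c : ℝ} (h1 : ∀ y, |s1 y| ≤ c)
    (h0' : ∀ u v, |s0 u - s0 v| ≤ c * |u - v|) (h1' : ∀ u v, |s1 u - s1 v| ≤ c * |u - v|)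
    (x W : CI) {W' : CI} (hW' : ‖W'‖ ≤ 1) :
    ‖byParts s0 s1 W x - byParts s0 s1 W' x‖ ≤ 8 * c * ‖pin x‖ * ‖W - W'‖ := by
  have hc : 0 ≤ c := (abs_nonneg _).trans (h1 0)
  have hP : ‖P W - P W'‖ ≤ 2 * ‖W - W'‖ := by rw [← map_sub]; exact norm_P_le _
  have hQ : ‖Q W - Q W'‖ ≤ 2 * ‖W - W'‖ := by rw [← map_sub]; exact norm_Q_le _
  have key : byParts s0 s1 W x - byParts s0 s1 W' x =
      (s0.comp (P W) - s0.comp (P W')) * pin x -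
        J ((s1.comp (P W) * (Q W - Q W') + (s1.comp (P W) - s1.comp (P W')) * Q W') * pin x) := by
    have e : (s1.comp (P W) * (Q W - Q W') + (s1.comp (P W) - s1.comp (P W')) * Q W') * pin x =
      s1.comp (P W) * Q W * pin x - s1.comp (P W') * Q W' * pin x := by ring
    rw [byParts_apply, byParts_apply, e, map_sub]; ring
  have n0 : ‖s0.comp (P W) - s0.comp (P W')‖ ≤ c * (2 * ‖W - W'‖) :=
    (norm_comp_sub_le h0' _ _).trans (mul_le_mul_of_nonneg_left hP hc)
  have n1 : ‖s1.comp (P W) - s1.comp (P W')‖ ≤ c * (2 * ‖W - W'‖) :=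
    (norm_comp_sub_le h1' _ _).trans (mul_le_mul_of_nonneg_left hP hc)
  have n2 : ‖s1.comp (P W) * (Q W - Q W')‖ ≤ c * (2 * ‖W - W'‖) :=
    (norm_mul_le _ _).trans (mul_le_mul (norm_comp_le h1 _) hQ (norm_nonneg _) hc)
  have n3 : ‖(s1.comp (P W) - s1.comp (P W')) * Q W'‖ ≤ c * (2 * ‖W - W'‖) * 2 := by
    refine (norm_mul_le _ _).trans (mul_le_mul n1 ?_ (norm_nonneg _) (by positivity))
    linarith [norm_Q_le W']
  rw [key]
  refine (norm_sub_le _ _).trans ((add_le_add (norm_mul_le _ _) ((norm_J_le _).trans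
    (norm_mul_le _ _))).trans ?_)
  have n4 := (norm_add_le (s1.comp (P W) * (Q W - Q W'))
    ((s1.comp (P W) - s1.comp (P W')) * Q W')).trans (add_le_add n2 n3)
  nlinarith [mul_le_mul_of_nonneg_right n0 (norm_nonneg (pin x)),
    mul_le_mul_of_nonneg_right n4 (norm_nonneg (pin x))]

theorem norm_S_byParts_le {s1 s2 : C(ℝ, ℝ)} {c : ℝ} (h1 : ∀ y, |s1 y| ≤ c) (h2 : ∀ y, |s2 y| ≤ c)
    (x : CI) {W : CI} (hW : ‖W‖ ≤ 1) : ‖S (byParts s1 s2 W x)‖ ≤ 8 * c * ‖pin x‖ := by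
  have hc : 0 ≤ c := (abs_nonneg _).trans (h1 0)
  refine ContinuousLinearMap.opNorm_le_bound _ (by positivity) fun V => ?_
  rw [S_byParts]
  have n1 : ‖s1.comp (P W) * P V‖ ≤ c * (2 * ‖V‖) :=
    (norm_mul_le _ _).trans (mul_le_mul (norm_comp_le h1 _) (norm_P_le V) (norm_nonneg _) hc)
  have n2 : ‖s1.comp (P W) * Q V‖ ≤ c * (2 * ‖V‖) :=
    (norm_mul_le _ _).trans (mul_le_mul (norm_comp_le h1 _) (norm_Q_le V) (norm_nonneg _) hc)
  have n3 : ‖s2.comp (P W) * P V‖ ≤ c * (2 * ‖V‖) :=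
    (norm_mul_le _ _).trans (mul_le_mul (norm_comp_le h2 _) (norm_P_le V) (norm_nonneg _) hc)
  have n4 : ‖s2.comp (P W) * P V * Q W‖ ≤ c * (2 * ‖V‖) * 2 := by
    refine (norm_mul_le _ _).trans (mul_le_mul n3 ?_ (norm_nonneg _) (by positivity))
    linarith [norm_Q_le W]
  have n5 := (norm_add_le (s2.comp (P W) * P V * Q W) (s1.comp (P W) * Q V)).trans
    (add_le_add n4 n2)
  refine (norm_sub_le _ _).trans ((add_le_add (norm_mul_le _ _) ((norm_J_le _).trans
    (norm_mul_le _ _))).trans ?_)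
  nlinarith [mul_le_mul_of_nonneg_right n1 (norm_nonneg (pin x)),
    mul_le_mul_of_nonneg_right n5 (norm_nonneg (pin x))]

/-- The Nemytskii operator of a function with Lipschitz derivative is Fréchet differentiable. -/
theorem hasFDerivAt_comp {s0 s1 : C(ℝ, ℝ)} {L : ℝ} (hs : ∀ y, HasDerivAt s0 (s1 y) y)
    (hL : ∀ u v, |s1 u - s1 v| ≤ L * |u - v|) (W : CI) :
    HasFDerivAt (fun W : CI => s0.comp W) (ContinuousLinearMap.mul ℝ CI (s1.comp W)) W := by
  have hL0 : 0 ≤ L := by simpa using (abs_nonneg _).trans (hL 1 0)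
  -- First order Taylor estimate with quadratic remainder, from the mean value inequality applied to
  -- `s0 y - s1 u * y`; it is uniform in the base point, hence passes to the sup norm.
  have htaylor : ∀ u v, |s0 v - s0 u - s1 u * (v - u)| ≤ L * |v - u| * |v - u| := by
    intro u v
    have hd : ∀ y ∈ Set.uIcc u v, HasDerivWithinAt (fun y => s0 y - s1 u * y) (s1 y - s1 u)
        (Set.uIcc u v) y := fun y _ => by
      simpa using ((hs y).fun_sub ((hasDerivAt_id y).const_mul (s1 u))).hasDerivWithinAt
    have hb : ∀ y ∈ Set.uIcc u v, ‖s1 y - s1 u‖ ≤ L * |v - u| := fun y hy =>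
      (hL y u).trans (mul_le_mul_of_nonneg_left (Set.abs_sub_left_of_mem_uIcc hy) hL0)
    have := (convex_uIcc u v).norm_image_sub_le_of_norm_hasDerivWithin_le hd hb
      Set.left_mem_uIcc Set.right_mem_uIcc
    rw [Real.norm_eq_abs, Real.norm_eq_abs] at this
    calc _ = |s0 v - s1 u * v - (s0 u - s1 u * u)| := by ring_nf
      _ ≤ _ := this
  refine HasFDerivAt.of_isLittleO (Asymptotics.IsBigO.trans_isLittleO (g := fun W' => ‖W' - W‖ ^ 2)
    (Asymptotics.IsBigO.of_bound L (Filter.Eventually.of_forall fun W' => ?_)) ?_)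
  · rw [norm_pow, norm_norm]
    refine norm_le_of_ev (by positivity) fun t _ _ => ?_
    have h1 := htaylor (ev W t) (ev W' t)
    have h2 : |ev W' t - ev W t| ≤ ‖W' - W‖ := abs_ev_le (W' - W) t
    refine h1.trans ?_
    nlinarith [abs_nonneg (ev W' t - ev W t), mul_le_mul h2 h2 (abs_nonneg _) (norm_nonneg _)]
  · have := (Asymptotics.isLittleO_pow_sub_sub W (m := 2) (by norm_num))
    simpa using this

theorem hasFDerivAt_byParts {s0 s1 s2 : C(ℝ, ℝ)} {L : ℝ} (hs : ∀ y, HasDerivAt s0 (s1 y) y)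
    (hs1 : ∀ y, HasDerivAt s1 (s2 y) y) (hL : ∀ u v, |s1 u - s1 v| ≤ L * |u - v|)
    (hL1 : ∀ u v, |s2 u - s2 v| ≤ L * |u - v|) (x W : CI) :
    HasFDerivAt (fun q : CI × CI => byParts s0 s1 q.2 q.1)
      ((byParts s0 s1 W).comp (ContinuousLinearMap.fst ℝ CI CI)
        + (S (byParts s1 s2 W x)).comp (ContinuousLinearMap.snd ℝ CI CI)) (x, W) := by
  have hP : HasFDerivAt (fun q : CI × CI => P q.2) (P.comp (ContinuousLinearMap.snd ℝ CI CI))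
      (x, W) := (P.comp (ContinuousLinearMap.snd ℝ CI CI)).hasFDerivAt
  have hQ : HasFDerivAt (fun q : CI × CI => Q q.2) (Q.comp (ContinuousLinearMap.snd ℝ CI CI))
      (x, W) := (Q.comp (ContinuousLinearMap.snd ℝ CI CI)).hasFDerivAt
  have hx : HasFDerivAt (fun q : CI × CI => pin q.1) (pin.comp (ContinuousLinearMap.fst ℝ CI CI))
      (x, W) := (pin.comp (ContinuousLinearMap.fst ℝ CI CI)).hasFDerivAt
  have h0 := (hasFDerivAt_comp hs hL (P W)).comp (x, W) hP
  have h1 := (hasFDerivAt_comp hs1 hL1 (P W)).comp (x, W) hP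
  have h := (h0.mul hx).sub (J.hasFDerivAt.comp (x, W) ((h1.mul hQ).mul hx))
  refine h.congr_fderiv ?_
  refine ContinuousLinearMap.ext fun q => ?_
  change s0.comp (P W) * pin q.1 + pin x * (s1.comp (P W) * P q.2) -
      J (s1.comp (P W) * Q W * pin q.1 +
        pin x * (s1.comp (P W) * Q q.2 + Q W * (s2.comp (P W) * P q.2))) =
    s0.comp (P W) * pin q.1 - J (s1.comp (P W) * Q W * pin q.1) + S (byParts s1 s2 W x) q.2
  have e : pin x * (s1.comp (P W) * Q q.2 + Q W * (s2.comp (P W) * P q.2)) =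
      (s2.comp (P W) * P q.2 * Q W + s1.comp (P W) * Q q.2) * pin x := by ring
  rw [S_byParts, map_add, e]
  ring

/-- Existence, uniqueness and size of the fixed point of `W ↦ G I_W x`. -/
theorem existsUnique_fixedPoint {s0 s1 : C(ℝ, ℝ)} {c G : ℝ} (h0 : ∀ y, |s0 y| ≤ c)
    (h1 : ∀ y, |s1 y| ≤ c) (h0' : ∀ u v, |s0 u - s0 v| ≤ c * |u - v|)
    (h1' : ∀ u v, |s1 u - s1 v| ≤ c * |u - v|) (x : CI) (hG : c * (|G| * ‖pin x‖) ≤ 1 / 16) :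
    ∃ W : CI, ‖W‖ ≤ 1 ∧ G • byParts s0 s1 W x = W ∧
      ∀ W' : CI, G • byParts s0 s1 W' x = W' → W' = W := by
  have hc : 0 ≤ c := (abs_nonneg _).trans (h1 0)
  have hbd : ∀ W : CI, ‖G • byParts s0 s1 W x‖ ≤ (1 + 2 * ‖W‖) / 16 := by
    intro W
    rw [norm_smul, Real.norm_eq_abs]
    calc |G| * ‖byParts s0 s1 W x‖ ≤ |G| * (c * ‖pin x‖ * (1 + 2 * ‖W‖)) :=
          mul_le_mul_of_nonneg_left (norm_byParts_le h0 h1 W x) (abs_nonneg _)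
      _ = c * (|G| * ‖pin x‖) * (1 + 2 * ‖W‖) := by ring
      _ ≤ 1 / 16 * (1 + 2 * ‖W‖) := by gcongr
      _ = _ := by ring
  have hlip : ∀ W W' : CI, ‖W'‖ ≤ 1 →
      ‖G • byParts s0 s1 W x - G • byParts s0 s1 W' x‖ ≤ 1 / 2 * ‖W - W'‖ := by
    intro W W' hW'
    rw [← smul_sub, norm_smul, Real.norm_eq_abs]
    calc |G| * ‖byParts s0 s1 W x - byParts s0 s1 W' x‖
        ≤ |G| * (8 * c * ‖pin x‖ * ‖W - W'‖) :=
          mul_le_mul_of_nonneg_left (norm_byParts_sub_le h1 h0' h1' x W hW') (abs_nonneg _)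
      _ = 8 * (c * (|G| * ‖pin x‖)) * ‖W - W'‖ := by ring
      _ ≤ 8 * (1 / 16) * ‖W - W'‖ := by gcongr
      _ = _ := by ring
  -- On the unit ball the growth bound gives at most `(1 + 2) / 16 < 1`.
  have hmaps : Set.MapsTo (fun W => G • byParts s0 s1 W x) (Metric.closedBall (0 : CI) 1)
      (Metric.closedBall (0 : CI) 1) := by
    intro W hW
    rw [mem_closedBall_zero_iff] at hW ⊢
    linarith [hbd W]
  have hcontr : ContractingWith (1 / 2) (hmaps.restrict _ _ _) := by
    refine ⟨by
      rw [← NNReal.coe_lt_coe]; norm_num, LipschitzWith.of_dist_le_mul fun W W' => ?_⟩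
    have := hlip W W' (mem_closedBall_zero_iff.mp W'.2)
    rw [Subtype.dist_eq, Subtype.dist_eq, dist_eq_norm, dist_eq_norm]
    simpa using this
  obtain ⟨W, hWb, hW, -⟩ := hcontr.exists_fixedPoint' Metric.isClosed_closedBall.isComplete hmaps
    (Metric.mem_closedBall_self zero_le_one) (edist_ne_top _ _)
  refine ⟨W, mem_closedBall_zero_iff.mp hWb, hW, fun W' hW' => ?_⟩
  -- `W` lies in the unit ball while `W'` is arbitrary; the Lipschitz bound allows this asymmetry.
  have h := hlip W' W (mem_closedBall_zero_iff.mp hWb)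
  have hW1 : G • byParts s0 s1 W x = W := hW
  rw [hW', hW1] at h
  have : ‖W' - W‖ = 0 := le_antisymm (by linarith [norm_nonneg (W' - W)]) (norm_nonneg _)
  exact sub_eq_zero.mp (norm_eq_zero.mp this)

end CI

/-! ### An implicit function principle for fixed points. -/

/-- Differentiability of a solution of `W = f(x, W)` when `1 - ∂_W f` has a left inverse. -/
theorem hasFDerivAt_of_fixedPoint {X E : Type*} [NormedAddCommGroup X] [NormedSpace ℝ X]
    [NormedAddCommGroup E] [NormedSpace ℝ E] {f : X × E → E} {W : X → E} {x : X} {K : ℝ}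
    {D : X →L[ℝ] E} {A R : E →L[ℝ] E}
    (hf : HasFDerivAt f (D.comp (ContinuousLinearMap.fst ℝ X E)
      + A.comp (ContinuousLinearMap.snd ℝ X E)) (x, W x))
    (hW : ∀ y, W y = f (y, W y)) (hR : ∀ V, R (V - A V) = V)
    (hK : ∀ᶠ y in nhds x, ‖W y - W x‖ ≤ K * ‖y - x‖) : HasFDerivAt W (R.comp D) x := by
  have hbig : (fun y => W y - W x) =O[nhds x] fun y => y - x := Asymptotics.IsBigO.of_bound K hK
  have hcont : Filter.Tendsto W (nhds x) (nhds (W x)) := by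
    have h1 : Filter.Tendsto (fun y : X => y - x) (nhds x) (nhds 0) :=
      tendsto_sub_nhds_zero_iff.mpr Filter.tendsto_id
    exact tendsto_sub_nhds_zero_iff.mp (hbig.trans_tendsto h1)
  have htend : Filter.Tendsto (fun y => (y, W y)) (nhds x) (nhds (x, W x)) :=
    Filter.tendsto_id.prodMk_nhds hcont
  have h1 := hf.isLittleO.comp_tendsto htend
  have h2 : (fun y => (y, W y) - (x, W x)) =O[nhds x] fun y => y - x := by
    simp only [Prod.mk_sub_mk]
    exact (Asymptotics.isBigO_refl _ _).prod_left hbig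
  -- With `V = W y - W x`, the expansion of `f` reads `V - A V - D (y - x) = o(y - x)`; applying `R`
  -- turns it into `V - R D (y - x) = o(y - x)`.
  have h3 := (R.isBigO_comp _ _).trans_isLittleO (h1.trans_isBigO h2)
  refine HasFDerivAt.of_isLittleO (h3.congr_left fun y => ?_)
  simp only [Function.comp_apply, Prod.mk_sub_mk, add_apply,
    ContinuousLinearMap.comp_apply, ContinuousLinearMap.coe_fst', ContinuousLinearMap.coe_snd']
  rw [← hW, ← hW]
  conv_rhs => rw [← hR (W y - W x)]
  rw [← map_sub]
  congr 1
  abel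

/-! ### Young integrals over the whole interval; Green's representation. -/

/-- `∫_0^1 g dx` exists as the increment of an indefinite Young integral. -/
def YoungValue (g x : ℝ → ℝ) (I : ℝ) : Prop := ∃ X, IsYoungPath g x X ∧ X 1 - X 0 = I

namespace YoungValue

variable {g g' x : ℝ → ℝ} {I I' : ℝ}

theorem hasYoungIntegral (h : YoungValue g x I) : HasYoungIntegral g x 0 1 I := by
  obtain ⟨X, hX, rfl⟩ := h
  exact hX.hasYoungIntegral le_rfl le_rfl

theorem add (h : YoungValue g x I) (h' : YoungValue g' x I') :
    YoungValue (fun t => g t + g' t) x (I + I') := by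
  obtain ⟨X, hX, rfl⟩ := h
  obtain ⟨X', hX', rfl⟩ := h'
  exact ⟨_, hX.add hX', by ring⟩

theorem const_mul (h : YoungValue g x I) (c : ℝ) : YoungValue (fun t => c * g t) x (c * I) := by
  obtain ⟨X, hX, rfl⟩ := h
  exact ⟨_, hX.const_mul c, by ring⟩

theorem congr (h : YoungValue g x I) (hg : ∀ t, 0 ≤ t → t ≤ 1 → g' t = g t) (hI : I' = I) :
    YoungValue g' x I' := by
  obtain ⟨X, hX, rfl⟩ := h
  exact ⟨X, hX.congr hg (fun _ _ _ => rfl) (fun _ _ _ => rfl), hI.symm⟩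

end YoungValue

theorem greenK_comm (s t : ℝ) : greenK s t = greenK t s := by
  rw [greenK, greenK, min_comm, mul_comm]

theorem greenK_one_right {t : ℝ} (ht : t ≤ 1) : greenK t 1 = 0 := by
  rw [greenK, min_eq_left ht]; ring

theorem greenK_zero_right {t : ℝ} (ht : 0 ≤ t) : greenK t 0 = 0 := by
  rw [greenK, min_eq_right ht]; ring

/-- The boundary terms vanish because `K(τ,0) = K(τ,1) = 0`, and `-∫ U dK(τ,·)` is `τ ∫_0^1 U -
∫_0^τ U`. Thus `P` applied to a primitive is integration against the Green kernel. -/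
theorem IsYoungPath.youngValue_greenK {a : ℝ} {g x : ℝ → ℝ} {U : CI}
    (h : IsYoungPath g x (ev U)) (hU : IncrHolder a (ev U)) (ha : 0 < a) {τ : ℝ} (hτ : 0 ≤ τ)
    (hτ1 : τ ≤ 1) : YoungValue (fun ξ => greenK τ ξ * g ξ) x (ev (P U) τ) := by
  refine ⟨_, h.greenK_mul hU ha hτ hτ1, ?_⟩
  simp only [ev_P U hτ hτ1, min_eq_left hτ1, min_eq_right hτ, greenK_one_right hτ1, ev_J_zero]
  rw [greenK_zero_right hτ]
  ring

theorem IncrHolder.greenK (τ : ℝ) : IncrHolder 1 (greenK τ) := by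
  refine ⟨1 + |τ|, fun s t hs hst ht => ?_⟩
  rw [Real.rpow_one, add_mul, one_mul]
  have h1 : |min τ t - min τ s| ≤ t - s := by
    have := abs_min_sub_min_le_max τ t τ s
    rw [sub_self, abs_zero, max_eq_right (abs_nonneg _)] at this
    rwa [abs_of_nonneg (show 0 ≤ t - s by linarith)] at this
  calc |min τ t - τ * t - (min τ s - τ * s)| = |(min τ t - min τ s) - τ * (t - s)| := by ring_nf
    _ ≤ |min τ t - min τ s| + |τ * (t - s)| := abs_sub _ _
    _ ≤ _ := by rw [abs_mul, abs_of_nonneg (show 0 ≤ t - s by linarith)]; linarith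

/-! ### A Fubini theorem for the Green kernel. -/

namespace CI

/-- The derivative in `s` of `greenPath F s`. -/
noncomputable def greenDeriv (F : CI) : C(unitInterval, CI) :=
  ContinuousMap.curry ⟨fun q : unitInterval × unitInterval =>
    ev F (max q.2 q.1) - ev F q.1 - q.2 * ev F q.2 + ev (J F) q.2, by
      have := continuous_ev F
      have := continuous_ev (J F)
      fun_prop⟩

theorem ev_greenDeriv (F : CI) (u : unitInterval) {t : ℝ} (ht : 0 ≤ t) (ht1 : t ≤ 1) :
    ev (greenDeriv F u) t = ev F (max t u) - ev F u - t * ev F t + ev (J F) t := by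
  rw [ev_of_mem _ ⟨ht, ht1⟩]; rfl

/-- The `C[0,1]`-valued derivative extended to real times. -/
noncomputable def greenDerivExt (F : CI) (u : ℝ) : CI :=
  greenDeriv F (Set.projIcc 0 1 zero_le_one u)

theorem continuous_greenDerivExt (F : CI) : Continuous (greenDerivExt F) :=
  (greenDeriv F).continuous.comp continuous_projIcc

theorem ev_greenDerivExt (F : CI) {u t : ℝ} (hu : 0 ≤ u) (hu1 : u ≤ 1) (ht : 0 ≤ t) (ht1 : t ≤ 1) :
    ev (greenDerivExt F u) t = ev F (max t u) - ev F u - t * ev F t + ev (J F) t := by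
  rw [greenDerivExt, Set.projIcc_of_mem zero_le_one ⟨hu, hu1⟩, ev_greenDeriv F _ ht ht1]

/-- If `F` is the primitive of `f dx` then `greenPath F s` is that of `K(s,·) f dx`. -/
noncomputable def greenPath (F : CI) (s : ℝ) : CI := ∫ u in (0 : ℝ)..s, greenDerivExt F u

theorem integral_ev_max_sub (F : CI) {s t : ℝ} (hs : 0 ≤ s) (hs1 : s ≤ 1) (ht : 0 ≤ t) :
    ∫ u in (0 : ℝ)..s, (ev F (max t u) - ev F u) = min s t * ev F t - ev (J F) (min s t) := by
  have hc : Continuous fun u => ev F (max t u) - ev F u := by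
    have := continuous_ev F
    fun_prop
  have hle : ∀ r, 0 ≤ r → r ≤ 1 → r ≤ t →
      ∫ u in (0 : ℝ)..r, (ev F (max t u) - ev F u) = r * ev F t - ev (J F) r := by
    intro r hr hr1 hrt
    rw [ev_J F hr hr1]
    have : ∫ u in (0 : ℝ)..r, (ev F (max t u) - ev F u) = ∫ u in (0 : ℝ)..r, (ev F t - ev F u) :=
      intervalIntegral.integral_congr fun u hu => by
        rw [Set.uIcc_of_le hr] at hu
        simp only [max_eq_left (hu.2.trans hrt)]
    rw [this, intervalIntegral.integral_sub (by simp) (intervalIntegrable_ev F _ _)]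
    simp
  rcases le_total s t with h | h
  · rw [min_eq_left h]; exact hle s hs hs1 h
  · rw [min_eq_right h, ← intervalIntegral.integral_add_adjacent_intervals (b := t)
      (hc.intervalIntegrable _ _) (hc.intervalIntegrable _ _), hle t ht (h.trans hs1) le_rfl]
    have : ∫ u in t..s, (ev F (max t u) - ev F u) = ∫ u in t..s, (0 : ℝ) :=
      intervalIntegral.integral_congr fun u hu => by
        rw [Set.uIcc_of_le h] at hu
        simp only [max_eq_right hu.1, sub_self]
    rw [this]; simp

theorem evL_integral {f : ℝ → CI} (hf : Continuous f) (a b t : ℝ) :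
    ev (∫ u in a..b, f u) t = ∫ u in a..b, ev (f u) t :=
  ((evL t).intervalIntegral_comp_comm (hf.intervalIntegrable a b)).symm

/-- The right side is the primitive given by `IsYoungPath.greenK_mul`. Defining `greenPath` as an
integral in `s` instead makes it differentiable in `s` with values in `C[0,1]`. -/
theorem ev_greenPath (F : CI) {s t : ℝ} (hs : 0 ≤ s) (hs1 : s ≤ 1) (ht : 0 ≤ t) (ht1 : t ≤ 1) :
    ev (greenPath F s) t =
      greenK s t * ev F t - (ev (J F) (min s t) - s * ev (J F) t) := by
  rw [greenPath, evL_integral (continuous_greenDerivExt F)]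
  have hc : Continuous fun u => ev F (max t u) - ev F u := by
    have := continuous_ev F
    fun_prop
  have : ∫ u in (0 : ℝ)..s, ev (greenDerivExt F u) t =
      ∫ u in (0 : ℝ)..s, ((ev F (max t u) - ev F u) + (ev (J F) t - t * ev F t)) :=
    intervalIntegral.integral_congr fun u hu => by
      rw [Set.uIcc_of_le hs] at hu
      simp only [ev_greenDerivExt F hu.1 (hu.2.trans hs1) ht ht1]
      ring
  rw [this, intervalIntegral.integral_add (hc.intervalIntegrable _ _) (by simp),
    integral_ev_max_sub F hs hs1 ht, greenK]
  simp
  ring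

theorem greenPath_one (F : CI) : greenPath F 1 = 0 := by
  refine ext_ev fun t ht ht1 => ?_
  rw [ev_greenPath F zero_le_one le_rfl ht ht1, min_eq_right ht1, greenK, min_eq_right ht1, ev_zero]
  ring

theorem _root_.IsYoungPath.greenPath {a : ℝ} {f x : ℝ → ℝ} {F : CI} (h : IsYoungPath f x (ev F))
    (hF : IncrHolder a (ev F)) (ha : 0 < a) {s : ℝ} (hs : 0 ≤ s) (hs1 : s ≤ 1) :
    IsYoungPath (fun ξ => greenK s ξ * f ξ) x (ev (greenPath F s)) :=
  (h.greenK_mul hF ha hs hs1).congr (fun _ _ _ => rfl) (fun _ _ _ => rfl)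
    fun _ ht ht1 => ev_greenPath F hs hs1 ht ht1

/-- This is `∫ greenPath F dH = -∫ H (greenPath F)' ds`: integration by parts in `s`, without
boundary terms since `greenPath F` vanishes at `0` and `1`. -/
theorem S_eq_integral (F H : CI) :
    S F H = -∫ u in (0 : ℝ)..1, ev H u • greenDerivExt F u := by
  have hcH := continuous_ev H
  have hcF := continuous_ev F
  have hcD := continuous_greenDerivExt F
  refine ext_ev fun t ht ht1 => ?_
  rw [ev_neg, evL_integral (by fun_prop)]
  have hc1 : Continuous fun u => ev H u * (ev F (max t u) - ev F u) := by fun_prop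
  have e1 : ∫ u in (0 : ℝ)..1, ev (ev H u • greenDerivExt F u) t =
      ∫ u in (0 : ℝ)..1, (ev H u * (ev F (max t u) - ev F u)
        + (ev (J F) t - t * ev F t) * ev H u) :=
    intervalIntegral.integral_congr fun u hu => by
      rw [Set.uIcc_of_le zero_le_one] at hu
      simp only [ev_smul, ev_greenDerivExt F hu.1 hu.2 ht ht1]
      ring
  have e2 : ∫ u in (0 : ℝ)..1, ev H u * (ev F (max t u) - ev F u) =
      ev F t * ev (J H) t - ev (J (F * H)) t := by
    rw [← intervalIntegral.integral_add_adjacent_intervals (b := t)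
      (hc1.intervalIntegrable _ _) (hc1.intervalIntegrable _ _)]
    have i1 : ∫ u in (0 : ℝ)..t, ev H u * (ev F (max t u) - ev F u) =
        ∫ u in (0 : ℝ)..t, (ev F t * ev H u - ev (F * H) u) :=
      intervalIntegral.integral_congr fun u hu => by
        rw [Set.uIcc_of_le ht] at hu
        simp only [max_eq_left hu.2, ev_mul]
        ring
    have i2 : ∫ u in t..1, ev H u * (ev F (max t u) - ev F u) = ∫ u in t..1, (0 : ℝ) :=
      intervalIntegral.integral_congr fun u hu => by
        rw [Set.uIcc_of_le ht1] at hu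
        simp only [max_eq_right hu.1, sub_self, mul_zero]
    rw [i1, i2, intervalIntegral.integral_sub ((intervalIntegrable_ev H _ _).const_mul _)
      (intervalIntegrable_ev _ _ _), intervalIntegral.integral_const_mul, ← ev_J H ht ht1,
      ← ev_J (F * H) ht ht1]
    simp
  rw [e1, intervalIntegral.integral_add (hc1.intervalIntegrable _ _)
    ((intervalIntegrable_ev H _ _).const_mul _), e2, intervalIntegral.integral_const_mul,
    ← ev_J H zero_le_one le_rfl, S_apply, Q_eq, mul_sub, map_sub, mul_smul_comm, mul_one, map_smul,
    ev_sub, ev_sub, ev_mul, ev_P H ht ht1, ev_smul]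
  ring

/-- `∫ ℓ(∫ K(s,ξ) f dx_ξ) g_s dh_s = ℓ(∫∫ K(s,ξ) g_s dh_s f dx_ξ)`: the Fubini theorem for the
Green kernel. -/
theorem _root_.IsYoungPath.youngValue_greenPath {a : ℝ} {g h : ℝ → ℝ} {H : CI}
    (hg : IsYoungPath g h (ev H)) (hH : IncrHolder a (ev H)) (ha : 0 < a) (F : CI)
    (ℓ : CI →L[ℝ] ℝ) : YoungValue (fun s => ℓ (greenPath F s) * g s) h (ℓ (S F H)) := by
  set w : CI := ⟨fun u => ℓ (greenDeriv F u), by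
    have := (greenDeriv F).continuous
    fun_prop⟩ with hw
  have hwev : ∀ u, ev w u = ℓ (greenDerivExt F u) := fun u => rfl
  have hJ : ∀ s, 0 ≤ s → s ≤ 1 → ℓ (greenPath F s) = ev (J w) s := by
    intro s hs hs1
    rw [ev_J w hs hs1, greenPath,
      ← ℓ.intervalIntegral_comp_comm ((continuous_greenDerivExt F).intervalIntegrable _ _)]
    rfl
  -- Since `s ↦ ℓ (greenPath F s)` is the primitive of the continuous function `w`, the integral
  -- against `g dh` is evaluated by parts; both boundary terms vanish.
  have hp := (hg.mul (isYoungPath_J hH ha w) (fun t _ _ => abs_ev_le _ t))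
  refine ⟨_, hp.congr (fun t ht ht1 => by rw [hJ t ht ht1]) (fun _ _ _ => rfl)
    (fun _ _ _ => rfl), ?_⟩
  have h1 : ev (J w) 1 = 0 := by
    rw [← hJ 1 zero_le_one le_rfl, greenPath_one, map_zero]
  simp only [h1, ev_J_zero]
  have hcH := continuous_ev H
  have hcD := continuous_greenDerivExt F
  rw [S_eq_integral, map_neg, ← ℓ.intervalIntegral_comp_comm
    ((by fun_prop : Continuous fun u => ev H u • greenDerivExt F u).intervalIntegrable _ _),
    ev_J _ zero_le_one le_rfl]
  simp [hwev]

/-- Uniqueness of Young paths vanishing at `0`. -/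
theorem _root_.IsYoungPath.eq_of_zero {g x : ℝ → ℝ} {U U' : CI} (h : IsYoungPath g x (ev U))
    (h' : IsYoungPath g x (ev U')) (h0 : ev U 0 = 0) (h0' : ev U' 0 = 0) : U = U' :=
  ext_ev fun t ht ht1 => by
    have := h.unique h' ht ht1
    rwa [h0, h0', sub_zero, sub_zero] at this

end CI

/-! ### Uniqueness for the linear equation. -/

/-- The linear equation `y = b + G ∫ K(·,ξ) f y dx` has at most one solution in `C^κ`. -/
theorem linearEquation_unique {κ : ℝ≥0} {a G : ℝ} (hκ : 0 < κ) (ha : 0 < a) (ha1 : a ≤ 1)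
    (hκa : 1 < κ + a) {f x b : ℝ → ℝ} {F : CI} (hf : IncrHolder κ f) (hx : IncrHolder a x)
    (hF : IsYoungPath f x (ev F)) (hFa : IncrHolder a (ev F)) {R : CI →L[ℝ] CI}
    (hR : ∀ V, R (V - G • S F V) = V) {y y' : HolderC κ}
    (hy : ∀ t, 0 ≤ t → t ≤ 1 →
      ev y.toC t = b t + G * youngIntegral (fun ξ => greenK t ξ * (f ξ * ev y.toC ξ)) x 0 1)
    (hy' : ∀ t, 0 ≤ t → t ≤ 1 →
      ev y'.toC t = b t + G * youngIntegral (fun ξ => greenK t ξ * (f ξ * ev y'.toC ξ)) x 0 1) :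
    y = y' := by
  have hκ' : (0 : ℝ) < κ := hκ
  obtain ⟨U, hU, hU0, hUa⟩ :=
    exists_isYoungPath_ev (hf.mul y.incrHolder hκ'.le) hx hκ' ha ha1 hκa
  obtain ⟨U', hU', hU0', hUa'⟩ :=
    exists_isYoungPath_ev (hf.mul y'.incrHolder hκ'.le) hx hκ' ha ha1 hκa
  -- The difference of two solutions is `P D`, hence `D = G S F D`, and the left inverse `R` of `1 -
  -- G S F` forces `D = 0`.
  set D : CI := G • (U - U') with hD
  have hd : y.toC - y'.toC = P D := by
    refine CI.ext_ev fun t ht ht1 => ?_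
    rw [ev_sub, hy t ht ht1, hy' t ht ht1,
      (hU.youngValue_greenK hUa ha ht ht1).hasYoungIntegral.youngIntegral_eq zero_le_one,
      (hU'.youngValue_greenK hUa' ha ht ht1).hasYoungIntegral.youngIntegral_eq zero_le_one, hD,
      map_smul, map_sub, ev_smul, ev_sub]
    ring
  have h1 : IsYoungPath (fun t => f t * ev (P D) t) x (ev (U - U')) := by
    refine (hU.add (hU'.const_mul (-1))).congr (fun t _ _ => ?_) (fun _ _ _ => rfl)
      (fun t _ _ => ?_)
    · rw [← hd, ev_sub]; ring
    · rw [ev_sub]; ring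
  have h2 : U - U' = S F D :=
    h1.eq_of_zero (hF.S hFa ha D) (by rw [ev_sub, hU0, hU0', sub_zero]) (S_zero_left F D)
  have h3 : D - G • S F D = 0 := by rw [← h2, hD, sub_self]
  have h4 : D = 0 := by rw [← hR D, h3, map_zero]
  have h5 : y.toC - y'.toC = 0 := by rw [hd, h4, map_zero]
  exact Subtype.ext (sub_eq_zero.mp h5)

/-! ### The Sobolev functional and its Fréchet derivative. -/

open MeasureTheory

/-- Lebesgue measure on the unit square. -/
noncomputable def unitSq : Measure (ℝ × ℝ) :=
  (volume.restrict (Set.Ioc (0 : ℝ) 1)).prod (volume.restrict (Set.Ioc (0 : ℝ) 1))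

theorem ae_unitSq : ∀ᵐ z ∂unitSq, z.1 ∈ Set.Ioc (0 : ℝ) 1 ∧ z.2 ∈ Set.Ioc (0 : ℝ) 1 := by
  rw [unitSq, Measure.prod_restrict, ae_restrict_iff' (measurableSet_Ioc.prod measurableSet_Ioc)]
  exact Filter.Eventually.of_forall fun z hz => hz

theorem integrableOn_rpow_right {d u v : ℝ} (hd : 0 < d) (huv : u ≤ v) :
    IntegrableOn (fun y => |y - u| ^ (d - 1)) (Set.Ioc u v) ∧
      ∫ y in Set.Ioc u v, |y - u| ^ (d - 1) = (v - u) ^ d / d := by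
  have h1 : IntervalIntegrable (fun y : ℝ => y ^ (d - 1)) volume (u - u) (v - u) :=
    intervalIntegral.intervalIntegrable_rpow' (by linarith)
  have h2 : IntervalIntegrable (fun y : ℝ => (y - u) ^ (d - 1)) volume u v := by
    simpa using h1.comp_sub_right u
  have heq : ∀ y ∈ Set.Ioc u v, |y - u| ^ (d - 1) = (y - u) ^ (d - 1) := fun y hy => by
    rw [abs_of_pos (sub_pos.mpr hy.1)]
  rw [intervalIntegrable_iff_integrableOn_Ioc_of_le huv] at h2
  refine ⟨h2.congr_fun (fun y hy => (heq y hy).symm) measurableSet_Ioc, ?_⟩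
  rw [setIntegral_congr_fun measurableSet_Ioc heq, ← intervalIntegral.integral_of_le huv,
    intervalIntegral.integral_comp_sub_right (fun y => y ^ (d - 1)) u,
    integral_rpow (Or.inl (by linarith))]
  simp [Real.zero_rpow hd.ne']

theorem integrableOn_rpow_left {d u v : ℝ} (hd : 0 < d) (huv : u ≤ v) :
    IntegrableOn (fun y => |y - v| ^ (d - 1)) (Set.Ioc u v) ∧
      ∫ y in Set.Ioc u v, |y - v| ^ (d - 1) = (v - u) ^ d / d := by
  have h1 : IntervalIntegrable (fun y : ℝ => y ^ (d - 1)) volume (v - v) (v - u) :=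
    intervalIntegral.intervalIntegrable_rpow' (by linarith)
  have h2 : IntervalIntegrable (fun y : ℝ => (v - y) ^ (d - 1)) volume u v := by
    simpa using (h1.comp_sub_left v).symm
  have heq : ∀ y ∈ Set.Ioc u v, |y - v| ^ (d - 1) = (v - y) ^ (d - 1) := fun y hy => by
    rw [abs_sub_comm, abs_of_nonneg (sub_nonneg.mpr hy.2)]
  rw [intervalIntegrable_iff_integrableOn_Ioc_of_le huv] at h2
  refine ⟨h2.congr_fun (fun y hy => (heq y hy).symm) measurableSet_Ioc, ?_⟩
  rw [setIntegral_congr_fun measurableSet_Ioc heq, ← intervalIntegral.integral_of_le huv,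
    intervalIntegral.integral_comp_sub_left (fun y => y ^ (d - 1)) v,
    integral_rpow (Or.inl (by linarith))]
  simp [Real.zero_rpow hd.ne']

theorem integrableOn_rpow_abs {e r : ℝ} (he : 0 < e) (hr : 0 ≤ r) (hr1 : r ≤ 1) :
    IntegrableOn (fun y => |y - r| ^ (e - 1)) (Set.Ioc 0 1) ∧
      ∫ y in Set.Ioc (0 : ℝ) 1, |y - r| ^ (e - 1) ≤ 2 / e := by
  obtain ⟨i1, v1⟩ := integrableOn_rpow_left he hr
  obtain ⟨i2, v2⟩ := integrableOn_rpow_right he hr1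
  rw [← Set.Ioc_union_Ioc_eq_Ioc hr hr1]
  refine ⟨i1.union i2, ?_⟩
  rw [setIntegral_union (Set.Ioc_disjoint_Ioc_of_le le_rfl) measurableSet_Ioc i1 i2, v1, v2,
    ← add_div]
  gcongr
  have h1 : (r - 0) ^ e ≤ 1 := Real.rpow_le_one (by linarith) (by linarith) he.le
  have h2 : (1 - r) ^ e ≤ 1 := Real.rpow_le_one (by linarith) (by linarith) he.le
  linarith

theorem measurable_rpow_abs_sub (e : ℝ) : Measurable fun z : ℝ × ℝ => |z.2 - z.1| ^ e := by
  fun_prop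

theorem integrable_unitSq_rpow {e : ℝ} (he : 0 < e) :
    Integrable (fun z : ℝ × ℝ => |z.2 - z.1| ^ (e - 1)) unitSq := by
  rw [unitSq, integrable_prod_iff (measurable_rpow_abs_sub _).aestronglyMeasurable]
  constructor
  · rw [ae_restrict_iff' measurableSet_Ioc]
    exact Filter.Eventually.of_forall fun r hr => (integrableOn_rpow_abs he hr.1.le hr.2).1
  · refine Integrable.of_bound (C := 2 / e) ?_ ?_
    · exact (measurable_rpow_abs_sub (e - 1)).norm.stronglyMeasurable.integral_prod_right'.aestronglyMeasurable
    · rw [ae_restrict_iff' measurableSet_Ioc]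
      refine Filter.Eventually.of_forall fun r hr => ?_
      have hnn : ∀ y, ‖|y - r| ^ (e - 1)‖ = |y - r| ^ (e - 1) := fun y =>
        Real.norm_of_nonneg (Real.rpow_nonneg (abs_nonneg _) _)
      simp only [hnn]
      rw [Real.norm_of_nonneg (integral_nonneg fun y => Real.rpow_nonneg (abs_nonneg _) _)]
      exact (integrableOn_rpow_abs he hr.1.le hr.2).2

/-- An elementary bound for difference quotients. -/
theorem rpow_div_rpow_le {a K D α m w : ℝ} (hD : 0 ≤ D) (hK : 0 ≤ K) (ha : |a| ≤ K * D ^ α)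
    (hα : 0 < α) (hm : 0 < m) : |a| ^ m / D ^ w ≤ K ^ m * D ^ (α * m - w) := by
  rcases hD.eq_or_lt with rfl | hD
  · have : |a| = 0 := le_antisymm (by simpa [Real.zero_rpow hα.ne'] using ha) (abs_nonneg _)
    rw [this, Real.zero_rpow hm.ne', zero_div]
    positivity
  · rw [Real.rpow_sub hD, Real.rpow_mul hD.le, ← mul_div_assoc,
      ← Real.mul_rpow hK (by positivity)]
    gcongr

/-- The integrand of `sobolevPow` is integrable and `sobolevPow` is its integral over the square. -/
theorem sobolevPow_eq {γ p : ℝ} {x : ℝ → ℝ}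
    (hint : Integrable (fun z : ℝ × ℝ => |x z.2 - x z.1| ^ (2 * p) / |z.2 - z.1| ^ (2 * p * γ + 2))
      unitSq) :
    sobolevPow γ p x =
      ∫ z, |x z.2 - x z.1| ^ (2 * p) / |z.2 - z.1| ^ (2 * p * γ + 2) ∂unitSq := by
  rw [unitSq] at hint ⊢
  rw [integral_prod _ hint, sobolevPow, intervalIntegral.integral_of_le zero_le_one]
  refine integral_congr_ae (Filter.Eventually.of_forall fun η => ?_)
  simp only
  rw [intervalIntegral.integral_of_le zero_le_one]

theorem measurable_sobolev_integrand {x : ℝ → ℝ} (hx : Measurable x) (a b : ℝ) :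
    Measurable fun z : ℝ × ℝ => |x z.2 - x z.1| ^ a / |z.2 - z.1| ^ b := by
  fun_prop

/-- The integrand is at most a multiple of `|ζ - η|^(2p(α - γ) - 2)`, and the exponent exceeds `-1`
exactly when `2p(α - γ) > 1`. With `α = γ + ε` this is the condition `ε > 1/(2p)`. -/
theorem integrable_sobolev {α γ p K : ℝ} (hα : 0 < α) (hp : 1 ≤ p) (hε : 1 < 2 * p * (α - γ))
    (hK : 0 ≤ K) {x : ℝ → ℝ} (hxc : Measurable x)
    (hx : ∀ s ∈ Set.Icc (0 : ℝ) 1, ∀ t ∈ Set.Icc (0 : ℝ) 1, |x t - x s| ≤ K * |t - s| ^ α) :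
    Integrable (fun z : ℝ × ℝ => |x z.2 - x z.1| ^ (2 * p) / |z.2 - z.1| ^ (2 * p * γ + 2)) unitSq := by
  have hb := (integrable_unitSq_rpow (e := 2 * p * (α - γ) - 1) (by linarith)).const_mul (K ^ (2 * p))
  refine hb.mono' (measurable_sobolev_integrand hxc _ _).aestronglyMeasurable ?_
  filter_upwards [ae_unitSq] with z hz
  rw [Real.norm_of_nonneg (by positivity)]
  have := rpow_div_rpow_le (m := 2 * p) (w := 2 * p * γ + 2) (abs_nonneg (z.2 - z.1)) hK
    (hx z.1 (Set.Ioc_subset_Icc_self hz.1) z.2 (Set.Ioc_subset_Icc_self hz.2)) hα (by linarith)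
  convert this using 3
  ring

theorem abs_rhoKernel_le {α γ p K : ℝ} (hα : 0 < α) (hp : 1 ≤ p) (hK : 0 ≤ K) {x : ℝ → ℝ}
    {s t : ℝ} (hx : |x t - x s| ≤ K * |t - s| ^ α) :
    |rhoKernel γ p x t s| ≤
      2 * p * K ^ (2 * p - 1) * |t - s| ^ (α * (2 * p - 1) - (2 * γ * p + 2)) := by
  have h := rpow_div_rpow_le (m := 2 * p - 1) (w := 2 * γ * p + 2) (abs_nonneg (t - s)) hK
    hx hα (by linarith)
  have habs : |x t - x s| ^ (2 * p - 2) * |x t - x s| = |x t - x s| ^ (2 * p - 1) := by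
    rcases (abs_nonneg (x t - x s)).eq_or_lt with h0 | h0
    · rw [← h0, Real.zero_rpow (by linarith : 2 * p - 1 ≠ 0), mul_zero]
    · nth_rewrite 2 [← Real.rpow_one |x t - x s|]
      rw [← Real.rpow_add h0]; ring_nf
  rw [rhoKernel, abs_div, abs_mul (2 * p), abs_mul (_ ^ _), abs_of_nonneg (show 0 ≤ 2 * p by linarith),
    abs_of_nonneg (Real.rpow_nonneg (abs_nonneg (x t - x s)) _),
    abs_of_nonneg (Real.rpow_nonneg (abs_nonneg (t - s)) _), habs]
  have h' := mul_le_mul_of_nonneg_left h (show 0 ≤ 2 * p by linarith)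
  rwa [← mul_div_assoc, ← mul_assoc] at h'

/-- Evaluation at a real time as a functional on `C^α`. -/
noncomputable def evH (α : ℝ≥0) (t : ℝ) : HolderC α →L[ℝ] ℝ := (evL t).comp (HolderC.toCL α)

theorem evH_apply {α : ℝ≥0} (t : ℝ) (h : HolderC α) : evH α t h = ev h.toC t := rfl

theorem norm_evH_sub_le {α : ℝ≥0} {s t : ℝ} (hs : s ∈ Set.Icc (0 : ℝ) 1)
    (ht : t ∈ Set.Icc (0 : ℝ) 1) : ‖evH α t - evH α s‖ ≤ |t - s| ^ (α : ℝ) :=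
  ContinuousLinearMap.opNorm_le_bound _ (by positivity) fun h => by
    rw [mul_comm]; exact h.abs_sub_le hs ht

/-- Continuity in operator norm, not just pointwise: it gives strong measurability of the
functional-valued integrand of `sobolevDeriv`. -/
theorem continuous_evH {α : ℝ≥0} (hα : 0 < α) : Continuous (evH α) := by
  have hα' : (0 : ℝ) < α := hα
  have hproj : ∀ t, evH α t = evH α (Set.projIcc (0 : ℝ) 1 zero_le_one t) := fun t => by
    ext h
    rw [evH_apply, evH_apply, ev, ev, Set.projIcc_val]
  rw [continuous_iff_continuousAt]
  intro s
  rw [ContinuousAt, tendsto_iff_dist_tendsto_zero]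
  have hz : Filter.Tendsto (fun t : ℝ => |((Set.projIcc (0 : ℝ) 1 zero_le_one t : ℝ)) -
      (Set.projIcc (0 : ℝ) 1 zero_le_one s : ℝ)| ^ (α : ℝ)) (nhds s) (nhds 0) := by
    have hc : Continuous fun t : ℝ => |((Set.projIcc (0 : ℝ) 1 zero_le_one t : ℝ)) -
      (Set.projIcc (0 : ℝ) 1 zero_le_one s : ℝ)| ^ (α : ℝ) :=
      (((continuous_subtype_val.comp continuous_projIcc).sub continuous_const).abs).rpow_const
        fun _ => Or.inr hα'.le
    have := hc.tendsto s
    simpa [Real.zero_rpow hα'.ne'] using this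
  refine squeeze_zero (fun _ => dist_nonneg) (fun t => ?_) hz
  rw [dist_eq_norm, hproj t, hproj s]
  exact norm_evH_sub_le (Set.projIcc _ _ _ s).2 (Set.projIcc _ _ _ t).2

/-- The integrand of the derivative of `sobolevPow`. -/
noncomputable def sobolevDerivKernel (γ p : ℝ) {α : ℝ≥0} (x : HolderC α) (z : ℝ × ℝ) :
    HolderC α →L[ℝ] ℝ :=
  rhoKernel γ p (ev x.toC) z.2 z.1 • (evH α z.2 - evH α z.1)

theorem measurable_rhoKernel (γ p : ℝ) {x : ℝ → ℝ} (hx : Measurable x) :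
    Measurable fun z : ℝ × ℝ => rhoKernel γ p x z.2 z.1 := by
  unfold rhoKernel
  fun_prop

/-- The increment functional on `C^α` has norm at most `|ζ - η|^α`, which restores the power lost
from `|x_ζ - x_η|^(2p)` to `|x_ζ - x_η|^(2p-1)`. -/
theorem norm_sobolevDerivKernel_le {γ p K : ℝ} {α : ℝ≥0} (hα : 0 < α) (hp : 1 ≤ p) {x : HolderC α}
    (hx : ‖x‖ ≤ K) : ∀ z : ℝ × ℝ, z.1 ∈ Set.Ioc (0 : ℝ) 1 ∧ z.2 ∈ Set.Ioc (0 : ℝ) 1 →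
      ‖sobolevDerivKernel γ p x z‖ ≤
        2 * p * K ^ (2 * p - 1) * |z.2 - z.1| ^ (2 * p * (α - γ) - 1 - 1) := by
  intro z hz
  have hα' : (0 : ℝ) < α := hα
  have hK : 0 ≤ K := (norm_nonneg x).trans hx
  have h1 := Set.Ioc_subset_Icc_self hz.1
  have h2 := Set.Ioc_subset_Icc_self hz.2
  have hb : |ev x.toC z.2 - ev x.toC z.1| ≤ K * |z.2 - z.1| ^ (α : ℝ) :=
    (x.abs_sub_le h1 h2).trans (mul_le_mul_of_nonneg_right hx (by positivity))
  rw [sobolevDerivKernel, norm_smul, Real.norm_eq_abs]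
  refine (mul_le_mul (abs_rhoKernel_le (γ := γ) hα' hp hK hb) (norm_evH_sub_le h1 h2)
    (norm_nonneg _) (by positivity)).trans ?_
  rcases (abs_nonneg (z.2 - z.1)).eq_or_lt with h0 | h0
  · rw [← h0, Real.zero_rpow hα'.ne', mul_zero]; positivity
  · rw [mul_assoc _ (_ ^ _) (_ ^ _), ← Real.rpow_add h0]
    refine le_of_eq ?_
    congr 2
    ring

theorem aestronglyMeasurable_sobolevDerivKernel (γ p : ℝ) {α : ℝ≥0} (hα : 0 < α) (x : HolderC α) :
    AEStronglyMeasurable (sobolevDerivKernel γ p x) unitSq := by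
  have h1 := (measurable_rhoKernel γ p (continuous_ev x.toC).measurable).aestronglyMeasurable
    (μ := unitSq)
  have h2 : AEStronglyMeasurable (fun z : ℝ × ℝ => evH α z.2 - evH α z.1) unitSq := by
    have := continuous_evH hα
    exact (by fun_prop : Continuous fun z : ℝ × ℝ => evH α z.2 - evH α z.1).aestronglyMeasurable
  exact h1.smul h2

theorem integrable_sobolevDerivKernel {γ p : ℝ} {α : ℝ≥0} (hα : 0 < α) (hp : 1 ≤ p)
    (hε : 1 < 2 * p * (α - γ)) (x : HolderC α) : Integrable (sobolevDerivKernel γ p x) unitSq := by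
  refine ((integrable_unitSq_rpow (e := 2 * p * (α - γ) - 1) (by linarith)).const_mul
    (2 * p * ‖x‖ ^ (2 * p - 1))).mono' (aestronglyMeasurable_sobolevDerivKernel γ p hα x) ?_
  filter_upwards [ae_unitSq] with z hz
  exact norm_sobolevDerivKernel_le hα hp le_rfl z hz

/-- The derivative of `x ↦ ‖x‖_{γ,p}^{2p}`. -/
noncomputable def sobolevDeriv (γ p : ℝ) {α : ℝ≥0} (x : HolderC α) : HolderC α →L[ℝ] ℝ :=
  ∫ z, sobolevDerivKernel γ p x z ∂unitSq

theorem sobolevDeriv_apply {γ p : ℝ} {α : ℝ≥0} (hα : 0 < α) (hp : 1 ≤ p)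
    (hε : 1 < 2 * p * (α - γ)) (x h : HolderC α) :
    sobolevDeriv γ p x h =
      ∫ z, rhoKernel γ p (ev x.toC) z.2 z.1 * (ev h.toC z.2 - ev h.toC z.1) ∂unitSq := by
  rw [sobolevDeriv, ContinuousLinearMap.integral_apply (integrable_sobolevDerivKernel hα hp hε x)]
  rfl

/-- Differentiation under the integral sign; on the unit ball around `x` the derivative is dominated
with `‖x‖ + 1` as bound for the Hölder norm. -/
theorem hasFDerivAt_sobolevPow {γ p : ℝ} {α : ℝ≥0} (hα : 0 < α) (hp : 1 ≤ p)
    (hε : 1 < 2 * p * (α - γ)) (x : HolderC α) :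
    HasFDerivAt (fun x : HolderC α => sobolevPow γ p (ev x.toC)) (sobolevDeriv γ p x) x := by
  have hα' : (0 : ℝ) < α := hα
  have hint : ∀ x : HolderC α, Integrable (fun z : ℝ × ℝ => |ev x.toC z.2 - ev x.toC z.1| ^ (2 * p)
      / |z.2 - z.1| ^ (2 * p * γ + 2)) unitSq := fun x =>
    integrable_sobolev hα' hp hε (norm_nonneg x) (continuous_ev x.toC).measurable
      fun s hs t ht => x.abs_sub_le hs ht
  have heq : (fun x : HolderC α => sobolevPow γ p (ev x.toC)) = fun x : HolderC α =>
      ∫ z, |ev x.toC z.2 - ev x.toC z.1| ^ (2 * p) / |z.2 - z.1| ^ (2 * p * γ + 2) ∂unitSq :=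
    funext fun x => sobolevPow_eq (hint x)
  rw [heq]
  refine hasFDerivAt_integral_of_dominated_of_fderiv_le
    (F' := fun x z => sobolevDerivKernel γ p x z) (s := Metric.ball x 1)
    (bound := fun z => 2 * p * (‖x‖ + 1) ^ (2 * p - 1) * |z.2 - z.1| ^ (2 * p * (α - γ) - 1 - 1))
    (Metric.ball_mem_nhds x one_pos)
    (Filter.Eventually.of_forall fun x => (hint x).aestronglyMeasurable) (hint x)
    (aestronglyMeasurable_sobolevDerivKernel γ p hα x) ?_
    ((integrable_unitSq_rpow (e := 2 * p * (α - γ) - 1) (by linarith)).const_mul _) ?_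
  · filter_upwards [ae_unitSq] with z hz y hy
    refine norm_sobolevDerivKernel_le hα hp ?_ z hz
    rw [mem_ball_iff_norm] at hy
    linarith [norm_le_norm_add_norm_sub' y x]
  · refine Filter.Eventually.of_forall fun z y _ => ?_
    have h1 : HasFDerivAt (fun y : HolderC α => ev y.toC z.2 - ev y.toC z.1)
        (evH α z.2 - evH α z.1) y := (evH α z.2 - evH α z.1).hasFDerivAt
    have h2 := (hasDerivAt_abs_rpow (ev y.toC z.2 - ev y.toC z.1)
      (p := 2 * p) (by linarith)).comp_hasFDerivAt y h1
    have h3 := h2.mul_const ((|z.2 - z.1| ^ (2 * p * γ + 2))⁻¹)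
    refine h3.congr_fderiv ?_
    ext h
    simp only [sobolevDerivKernel, rhoKernel, smul_apply, smul_eq_mul]
    rw [show 2 * γ * p = 2 * p * γ by ring]
    ring

/-! ### Singular kernels and the primitive of `μ dh`. -/

/-- `X(t) = ∬_{η < ζ} ρ (h_{ζ ∧ t} - h_{η ∧ t})`, the primitive of `μ dh`. -/
noncomputable def muPath (ρ : ℝ → ℝ → ℝ) (h : ℝ → ℝ) (t : ℝ) : ℝ :=
  ∫ z : ℝ × ℝ, Set.indicator {z : ℝ × ℝ | z.1 < z.2} (fun z => ρ z.2 z.1) z *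
    (h (min z.2 t) - h (min z.1 t)) ∂unitSq

theorem integral_unitSq_prod_mul {f g : ℝ → ℝ} :
    ∫ z : ℝ × ℝ, f z.1 * g z.2 ∂unitSq =
      (∫ y in Set.Ioc (0 : ℝ) 1, f y) * ∫ y in Set.Ioc (0 : ℝ) 1, g y :=
  integral_prod_mul f g

theorem integrable_unitSq_prod_mul {f g : ℝ → ℝ} (hf : IntegrableOn f (Set.Ioc 0 1))
    (hg : IntegrableOn g (Set.Ioc 0 1)) : Integrable (fun z : ℝ × ℝ => f z.1 * g z.2) unitSq :=
  hf.mul_prod hg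

theorem integral_unitSq_swap (f : ℝ × ℝ → ℝ) : ∫ z, f z.swap ∂unitSq = ∫ z, f z ∂unitSq :=
  integral_prod_swap f

/-- The four weights dominating the remainder of `muPath`. -/
theorem integrable_indicator_right {d u v : ℝ} (hd : 0 < d) (hu : 0 ≤ u) (huv : u ≤ v)
    (hv : v ≤ 1) :
    IntegrableOn ((Set.Ioc u v).indicator fun y => |y - u| ^ (d - 1)) (Set.Ioc 0 1) ∧
      ∫ y in Set.Ioc (0 : ℝ) 1, (Set.Ioc u v).indicator (fun y => |y - u| ^ (d - 1)) y
        = (v - u) ^ d / d := by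
  obtain ⟨h1, h2⟩ := integrableOn_rpow_right hd huv
  have hsub : Set.Ioc 0 1 ∩ Set.Ioc u v = Set.Ioc u v :=
    Set.inter_eq_right.mpr (Set.Ioc_subset_Ioc hu hv)
  refine ⟨((integrable_indicator_iff measurableSet_Ioc).mpr h1).integrableOn, ?_⟩
  rw [setIntegral_indicator measurableSet_Ioc, hsub, h2]

theorem integrable_indicator_left {d u v : ℝ} (hd : 0 < d) (hu : 0 ≤ u) (huv : u ≤ v)
    (hv : v ≤ 1) :
    IntegrableOn ((Set.Ioc u v).indicator fun y => |y - v| ^ (d - 1)) (Set.Ioc 0 1) ∧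
      ∫ y in Set.Ioc (0 : ℝ) 1, (Set.Ioc u v).indicator (fun y => |y - v| ^ (d - 1)) y
        = (v - u) ^ d / d := by
  obtain ⟨h1, h2⟩ := integrableOn_rpow_left hd huv
  have hsub : Set.Ioc 0 1 ∩ Set.Ioc u v = Set.Ioc u v :=
    Set.inter_eq_right.mpr (Set.Ioc_subset_Ioc hu hv)
  refine ⟨((integrable_indicator_iff measurableSet_Ioc).mpr h1).integrableOn, ?_⟩
  rw [setIntegral_indicator measurableSet_Ioc, hsub, h2]

/-- Integrating the singularity in one variable costs a constant, and the other variable runs over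
an interval of length `t - s`. -/
theorem integral_strip_le {e s t : ℝ} (he : 0 < e) (hst : s ≤ t) :
    Integrable (fun z : ℝ × ℝ => (Set.Icc s t).indicator 1 z.1 * |z.2 - z.1| ^ (e - 1)) unitSq ∧
    ∫ z : ℝ × ℝ, (Set.Icc s t).indicator 1 z.1 * |z.2 - z.1| ^ (e - 1) ∂unitSq ≤
      (t - s) * (2 / e) := by
  have hm : Measurable fun z : ℝ × ℝ =>
      (Set.Icc s t).indicator (1 : ℝ → ℝ) z.1 * |z.2 - z.1| ^ (e - 1) :=
    (((measurable_const (a := (1 : ℝ))).indicator measurableSet_Icc).comp measurable_fst).mul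
      (measurable_rpow_abs_sub _)
  have hint : Integrable (fun z : ℝ × ℝ => (Set.Icc s t).indicator (1 : ℝ → ℝ) z.1 *
      |z.2 - z.1| ^ (e - 1)) unitSq := by
    refine (integrable_unitSq_rpow he).mono' hm.aestronglyMeasurable
      (Filter.Eventually.of_forall fun z => ?_)
    have h0 : 0 ≤ |z.2 - z.1| ^ (e - 1) := by positivity
    by_cases hz : z.1 ∈ Set.Icc s t
    · simp only [Set.indicator_of_mem hz, Pi.one_apply, one_mul]
      rw [Real.norm_of_nonneg h0]
    · simp only [Set.indicator_of_notMem hz, zero_mul, norm_zero]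
      exact h0
  refine ⟨hint, ?_⟩
  rw [unitSq] at hint ⊢
  rw [integral_prod _ hint]
  have hle : ∀ η ∈ Set.Ioc (0 : ℝ) 1,
      ∫ ζ in Set.Ioc (0 : ℝ) 1, (Set.Icc s t).indicator (1 : ℝ → ℝ) η * |ζ - η| ^ (e - 1) ≤
        (Set.Icc s t).indicator (fun _ => 2 / e) η := by
    intro η hη
    rw [integral_const_mul]
    by_cases hz : η ∈ Set.Icc s t
    · simp only [Set.indicator_of_mem hz, Pi.one_apply, one_mul]
      exact (integrableOn_rpow_abs he hη.1.le hη.2).2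
    · simp only [Set.indicator_of_notMem hz, zero_mul, le_refl]
  have hi2 : IntegrableOn ((Set.Icc s t).indicator fun _ : ℝ => 2 / e) (Set.Ioc 0 1) :=
    ((integrable_const (2 / e)).indicator measurableSet_Icc)
  refine (setIntegral_mono_on hint.integral_prod_left hi2 measurableSet_Ioc hle).trans ?_
  rw [setIntegral_indicator measurableSet_Icc, setIntegral_const, smul_eq_mul]
  refine mul_le_mul_of_nonneg_right ?_ (by positivity)
  have : volume.real (Set.Ioc 0 1 ∩ Set.Icc s t) ≤ volume.real (Set.Icc s t) :=
    measureReal_mono Set.inter_subset_right (by simp)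
  refine this.trans ?_
  rw [Real.volume_real_Icc_of_le hst]

/-- Both exponents are nonpositive, so a distance may be replaced by a shorter one. For `η < r < ζ`
this separates the variables: `ζ - η` is replaced by `ζ - r` in one factor and by `r - η` in the
other. -/
theorem rpow_abs_mul_le {d e u v w : ℝ} (hd : d ≤ 1) (he : e ≤ 1) (hu : 0 < u) (hv : 0 < v)
    (huw : u ≤ w) (hvw : v ≤ w) : w ^ (d - 1) * w ^ (e - 1) ≤ u ^ (d - 1) * v ^ (e - 1) := by
  have := hu.trans_le huw
  exact mul_le_mul (Real.rpow_le_rpow_of_nonpos hu huw (by linarith))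
    (Real.rpow_le_rpow_of_nonpos hv hvw (by linarith)) (by positivity) (by positivity)

/-- A kernel with a singularity of order `d + e - 2` on the diagonal. -/
structure IsSingularKernel (ρ : ℝ → ℝ → ℝ) (C d e : ℝ) : Prop where
  meas : Measurable fun z : ℝ × ℝ => ρ z.2 z.1
  C_nonneg : 0 ≤ C
  d_pos : 0 < d
  d_le : d ≤ 1
  e_pos : 0 < e
  e_le : e ≤ 1
  bound : ∀ η ζ, 0 ≤ η → η < ζ → ζ ≤ 1 → |ρ ζ η| ≤ C * ((ζ - η) ^ (d - 1) * (ζ - η) ^ (e - 1))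

theorem IsSingularKernel.integrable_quadrant {ρ : ℝ → ℝ → ℝ} {C d e : ℝ}
    (hρ : IsSingularKernel ρ C d e) {r : ℝ} (hr : 0 ≤ r) (hr1 : r ≤ 1) :
    Integrable ({z : ℝ × ℝ | z.1 < r ∧ r < z.2}.indicator fun z => ρ z.2 z.1) unitSq := by
  obtain ⟨i1, -⟩ := integrableOn_rpow_abs hρ.d_pos hr hr1
  obtain ⟨i2, -⟩ := integrableOn_rpow_abs hρ.e_pos hr hr1
  have hS : MeasurableSet {z : ℝ × ℝ | z.1 < r ∧ r < z.2} :=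
    (measurableSet_lt measurable_fst measurable_const).inter
      (measurableSet_lt measurable_const measurable_snd)
  refine ((integrable_unitSq_prod_mul i1 i2).const_mul C).mono'
    (hρ.meas.indicator hS).aestronglyMeasurable ?_
  filter_upwards [ae_unitSq] with z hz
  by_cases hzr : z.1 < r ∧ r < z.2
  · rw [Set.indicator_of_mem (show z ∈ {z : ℝ × ℝ | z.1 < r ∧ r < z.2} from hzr), Real.norm_eq_abs]
    refine (hρ.bound _ _ hz.1.1.le (hzr.1.trans hzr.2) hz.2.2).trans ?_
    refine mul_le_mul_of_nonneg_left ?_ hρ.C_nonneg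
    rw [abs_sub_comm, abs_of_pos (sub_pos.mpr hzr.1), abs_of_pos (sub_pos.mpr hzr.2)]
    exact rpow_abs_mul_le hρ.d_le hρ.e_le (sub_pos.mpr hzr.1) (sub_pos.mpr hzr.2)
      (by linarith [hzr.2]) (by linarith [hzr.1])
  · rw [Set.indicator_of_notMem (show z ∉ {z : ℝ × ℝ | z.1 < r ∧ r < z.2} from hzr), norm_zero]
    have := hρ.C_nonneg
    positivity

theorem muTerm_eq {γ p : ℝ} {x : ℝ → ℝ} {C d e : ℝ}
    (hρ : IsSingularKernel (rhoKernel γ p x) C d e) {r : ℝ} (hr : 0 ≤ r) (hr1 : r ≤ 1) :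
    muTerm γ p x r = ∫ z : ℝ × ℝ,
      {z : ℝ × ℝ | z.1 < r ∧ r < z.2}.indicator (fun z => rhoKernel γ p x z.2 z.1) z ∂unitSq := by
  have hint := hρ.integrable_quadrant hr hr1
  rw [unitSq] at hint ⊢
  rw [integral_prod _ hint, muTerm, intervalIntegral.integral_of_le hr, integral_Ioc_eq_integral_Ioo]
  have h1 : ∀ η, ∫ ζ in Set.Ioc (0 : ℝ) 1, {z : ℝ × ℝ | z.1 < r ∧ r < z.2}.indicator
      (fun z => rhoKernel γ p x z.2 z.1) (η, ζ) =
      (Set.Iio r).indicator (fun η => ∫ ζ in Set.Ioc r 1, rhoKernel γ p x ζ η) η := by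
    intro η
    by_cases hη : η < r
    · rw [Set.indicator_of_mem (show η ∈ Set.Iio r from hη)]
      have : ∀ ζ, {z : ℝ × ℝ | z.1 < r ∧ r < z.2}.indicator
          (fun z => rhoKernel γ p x z.2 z.1) (η, ζ) =
          (Set.Ioi r).indicator (fun ζ => rhoKernel γ p x ζ η) ζ := fun ζ => by
        simp [Set.indicator, hη]
      simp only [this]
      rw [setIntegral_indicator measurableSet_Ioi]
      congr 2
      ext ζ
      simp only [Set.mem_inter_iff, Set.mem_Ioc, Set.mem_Ioi]
      constructor
      · rintro ⟨⟨-, h⟩, h'⟩; exact ⟨h', h⟩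
      · rintro ⟨h, h'⟩; exact ⟨⟨hr.trans_lt h, h'⟩, h⟩
    · simp [Set.indicator, hη]
  simp only [h1]
  rw [setIntegral_indicator measurableSet_Iio]
  have h2 : Set.Ioc 0 1 ∩ Set.Iio r = Set.Ioo 0 r := by
    ext η
    simp only [Set.mem_inter_iff, Set.mem_Ioc, Set.mem_Iio, Set.mem_Ioo]
    constructor
    · rintro ⟨⟨h, -⟩, h'⟩; exact ⟨h, h'⟩
    · rintro ⟨h, h'⟩; exact ⟨⟨h, (h'.le.trans hr1)⟩, h'⟩
  rw [h2]
  refine integral_congr_ae (Filter.Eventually.of_forall fun η => ?_)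
  simp only
  rw [intervalIntegral.integral_of_le hr1]

/-- Monotone truncation does not increase Hölder increments. -/
theorem abs_incr_min_le {K α : ℝ} {h : ℝ → ℝ} (hα : 0 ≤ α) (hK : 0 ≤ K)
    (hh : ∀ s t, 0 ≤ s → s ≤ t → t ≤ 1 → |h t - h s| ≤ K * (t - s) ^ α) {η ζ t : ℝ} (hη : 0 ≤ η)
    (hηζ : η ≤ ζ) (hζ : ζ ≤ 1) (ht : 0 ≤ t) :
    |h (min ζ t) - h (min η t)| ≤ K * (ζ - η) ^ α := by
  have hle : min η t ≤ min ζ t := min_le_min_right _ hηζ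
  refine (hh _ _ (le_min hη ht) hle ((min_le_left _ _).trans hζ)).trans
    (mul_le_mul_of_nonneg_left (Real.rpow_le_rpow (sub_nonneg.mpr hle) ?_ hα) hK)
  rcases le_total ζ t with h1 | h1
  · rw [min_eq_left h1, min_eq_left (hηζ.trans h1)]
  · rw [min_eq_right h1]
    rcases le_total η t with h2 | h2
    · rw [min_eq_left h2]; linarith
    · rw [min_eq_right h2]; linarith

section muPath

variable {ρ : ℝ → ℝ → ℝ} {C d e K α : ℝ} {h : ℝ → ℝ}

theorem measurable_muPath_integrand (hρ : IsSingularKernel ρ C d e) (hm : Measurable h) (t : ℝ) :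
    Measurable fun z : ℝ × ℝ => Set.indicator {z : ℝ × ℝ | z.1 < z.2} (fun z => ρ z.2 z.1) z *
      (h (min z.2 t) - h (min z.1 t)) := by
  refine (hρ.meas.indicator (measurableSet_lt measurable_fst measurable_snd)).mul ?_
  fun_prop

theorem integrable_muPath_integrand (hρ : IsSingularKernel ρ C d e) (hm : Measurable h)
    (hα : 0 ≤ α) (hdα : 1 ≤ d + α) (hK : 0 ≤ K)
    (hh : ∀ s t, 0 ≤ s → s ≤ t → t ≤ 1 → |h t - h s| ≤ K * (t - s) ^ α) {t : ℝ} (ht : 0 ≤ t) :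
    Integrable (fun z : ℝ × ℝ => Set.indicator {z : ℝ × ℝ | z.1 < z.2} (fun z => ρ z.2 z.1) z *
      (h (min z.2 t) - h (min z.1 t))) unitSq := by
  have hC := hρ.C_nonneg
  refine ((integrable_unitSq_rpow hρ.e_pos).const_mul (C * K)).mono'
    (measurable_muPath_integrand hρ hm t).aestronglyMeasurable ?_
  filter_upwards [ae_unitSq] with z hz
  by_cases hlt : z.1 < z.2
  · have hD : 0 < z.2 - z.1 := sub_pos.mpr hlt
    have hD1 : z.2 - z.1 ≤ 1 := by linarith [hz.1.1, hz.2.2]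
    rw [Set.indicator_of_mem (show z ∈ {z : ℝ × ℝ | z.1 < z.2} from hlt), norm_mul,
      Real.norm_eq_abs, Real.norm_eq_abs, abs_of_pos hD]
    have h1 := hρ.bound _ _ hz.1.1.le hlt hz.2.2
    have h2 := abs_incr_min_le hα hK hh hz.1.1.le hlt.le hz.2.2 ht
    have h3 : (z.2 - z.1) ^ (d - 1) * (z.2 - z.1) ^ α ≤ 1 := by
      rw [← Real.rpow_add hD]
      exact Real.rpow_le_one hD.le hD1 (by linarith)
    calc |ρ z.2 z.1| * |h (min z.2 t) - h (min z.1 t)|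
        ≤ (C * ((z.2 - z.1) ^ (d - 1) * (z.2 - z.1) ^ (e - 1))) * (K * (z.2 - z.1) ^ α) :=
          mul_le_mul h1 h2 (abs_nonneg _) (by positivity)
      _ = C * K * (z.2 - z.1) ^ (e - 1) * ((z.2 - z.1) ^ (d - 1) * (z.2 - z.1) ^ α) := by ring
      _ ≤ C * K * (z.2 - z.1) ^ (e - 1) * 1 :=
          mul_le_mul_of_nonneg_left h3 (by positivity)
      _ = _ := mul_one _
  · rw [Set.indicator_of_notMem (show z ∉ {z : ℝ × ℝ | z.1 < z.2} from hlt), zero_mul, norm_zero]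
    positivity

/-- The pointwise bound for the remainder of `muPath` at `η < ζ`. -/
theorem abs_muPath_remainder_le (hρ : IsSingularKernel ρ C d e) (hα : 0 ≤ α) (hdα : 1 ≤ d + α)
    (hK : 0 ≤ K) (hh : ∀ s t, 0 ≤ s → s ≤ t → t ≤ 1 → |h t - h s| ≤ K * (t - s) ^ α)
    {s r t η ζ : ℝ} (hs : 0 ≤ s) (hsr : s ≤ r) (hrt : r ≤ t) (ht : t ≤ 1) (hη : 0 ≤ η)
    (hηζ : η < ζ) (hζ : ζ ≤ 1) :
    |ρ ζ η * ((h (min ζ t) - h (min η t)) - (h (min ζ s) - h (min η s))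
        - if η < r ∧ r < ζ then h t - h s else 0)| ≤
      C * K * ((t - s) ^ α * (|η - r| ^ (e - 1) * (Set.Ioc r t).indicator (fun y => |y - r| ^ (d - 1)) ζ
          + (Set.Ioc s r).indicator (fun y => |y - r| ^ (d - 1)) η * |ζ - r| ^ (e - 1))
        + (t - s) ^ (α + d - 1) * ((Set.Icc s t).indicator 1 η * |ζ - η| ^ (e - 1)
          + (Set.Icc s t).indicator 1 ζ * |η - ζ| ^ (e - 1))) := by
  have hC := hρ.C_nonneg
  have hD : 0 < ζ - η := sub_pos.mpr hηζ
  have hts : 0 ≤ t - s := by linarith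
  have hb := hρ.bound η ζ hη hηζ hζ
  have hi1 : ∀ (u v : ℝ), 0 ≤ (Set.Ioc u v).indicator (fun y => |y - r| ^ (d - 1)) ζ := fun u v =>
    Set.indicator_nonneg (fun y _ => by positivity) _
  have hi2 : ∀ (u v : ℝ), 0 ≤ (Set.Ioc u v).indicator (fun y => |y - r| ^ (d - 1)) η := fun u v =>
    Set.indicator_nonneg (fun y _ => by positivity) _
  have hj1 : 0 ≤ (Set.Icc s t).indicator (1 : ℝ → ℝ) η := Set.indicator_nonneg (by simp) _
  have hj2 : 0 ≤ (Set.Icc s t).indicator (1 : ℝ → ℝ) ζ := Set.indicator_nonneg (by simp) _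
  have hincr : ∀ u v, s ≤ u → u ≤ v → v ≤ t → |h v - h u| ≤ K * (t - s) ^ α := fun u v h1 h2 h3 =>
    (hh u v (hs.trans h1) h2 (h3.trans ht)).trans (mul_le_mul_of_nonneg_left
      (Real.rpow_le_rpow (by linarith) (by linarith) hα) hK)
  have hfirst : 0 ≤ (t - s) ^ (α + d - 1) * ((Set.Icc s t).indicator 1 η * |ζ - η| ^ (e - 1)
          + (Set.Icc s t).indicator 1 ζ * |η - ζ| ^ (e - 1)) := by positivity
  have hsecond : 0 ≤ (t - s) ^ α *
      (|η - r| ^ (e - 1) * (Set.Ioc r t).indicator (fun y => |y - r| ^ (d - 1)) ζ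
        + (Set.Ioc s r).indicator (fun y => |y - r| ^ (d - 1)) η * |ζ - r| ^ (e - 1)) := by
    have := hi1 r t
    have := hi2 s r
    positivity
  rw [abs_mul]
  -- If `η < r < ζ`, the truncated increment over `[s,t]` would be `h t - h s` except for the ends:
  -- an error arises only from `ζ` in `(r,t]` or `η` in `(s,r]`. Otherwise both points lie on one
  -- side of `r`, and a nonzero contribution forces one of them into `[s,t]`.
  by_cases hcase : η < r ∧ r < ζ
  · obtain ⟨hηr, hrζ⟩ := hcase
    rw [if_pos ⟨hηr, hrζ⟩]
    have hηt : η ≤ t := hηr.le.trans hrt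
    have hsζ : s ≤ ζ := hsr.trans hrζ.le
    have hEa : |h t - h (min ζ t)| * |ρ ζ η| ≤
        C * K * (t - s) ^ α * (|η - r| ^ (e - 1) *
          (Set.Ioc r t).indicator (fun y => |y - r| ^ (d - 1)) ζ) := by
      rcases le_total t ζ with h1 | h1
      · rw [min_eq_right h1, sub_self, abs_zero, zero_mul]
        have := hi1 r t
        positivity
      · rw [min_eq_left h1, Set.indicator_of_mem (show ζ ∈ Set.Ioc r t from ⟨hrζ, h1⟩)]
        have e1 := hincr ζ t hsζ h1 le_rfl
        have e2 := rpow_abs_mul_le hρ.d_le hρ.e_le (sub_pos.mpr hrζ) (sub_pos.mpr hηr)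
          (show ζ - r ≤ ζ - η by linarith) (show r - η ≤ ζ - η by linarith)
        rw [abs_of_pos (sub_pos.mpr hrζ), abs_sub_comm η, abs_of_pos (sub_pos.mpr hηr)]
        calc _ ≤ (K * (t - s) ^ α) * (C * ((ζ - r) ^ (d - 1) * (r - η) ^ (e - 1))) :=
              mul_le_mul e1 (hb.trans (mul_le_mul_of_nonneg_left e2 hC)) (abs_nonneg _)
                (by positivity)
          _ = _ := by ring
    have hEb : |h (min η t) - h s - (h (min η s) - h s)| * |ρ ζ η| ≤
        C * K * (t - s) ^ α * ((Set.Ioc s r).indicator (fun y => |y - r| ^ (d - 1)) η *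
          |ζ - r| ^ (e - 1)) := by
      rcases le_or_gt η s with h1 | h1
      · rw [min_eq_left hηt, min_eq_left h1, sub_self, abs_zero, zero_mul]
        have := hi2 s r
        positivity
      · rw [min_eq_left hηt, min_eq_right h1.le,
          Set.indicator_of_mem (show η ∈ Set.Ioc s r from ⟨h1, hηr.le⟩), sub_self, sub_zero]
        have e1 := hincr s η le_rfl h1.le hηt
        have e2 := rpow_abs_mul_le hρ.d_le hρ.e_le (sub_pos.mpr hηr) (sub_pos.mpr hrζ)
          (show r - η ≤ ζ - η by linarith) (show ζ - r ≤ ζ - η by linarith)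
        rw [abs_of_pos (sub_pos.mpr hrζ), abs_sub_comm η r, abs_of_pos (sub_pos.mpr hηr)]
        calc _ ≤ (K * (t - s) ^ α) * (C * ((r - η) ^ (d - 1) * (ζ - r) ^ (e - 1))) :=
              mul_le_mul e1 (hb.trans (mul_le_mul_of_nonneg_left e2 hC)) (abs_nonneg _)
                (by positivity)
          _ = _ := by ring
    have hE : |(h (min ζ t) - h (min η t)) - (h (min ζ s) - h (min η s)) - (h t - h s)| ≤
        |h t - h (min ζ t)| + |h (min η t) - h s - (h (min η s) - h s)| := by
      rw [min_eq_right hsζ]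
      calc _ = |-(h t - h (min ζ t)) - (h (min η t) - h s - (h (min η s) - h s))| := by ring_nf
        _ ≤ _ := (abs_sub _ _).trans (by rw [abs_neg])
    calc _ ≤ |ρ ζ η| * (|h t - h (min ζ t)| + |h (min η t) - h s - (h (min η s) - h s)|) :=
          mul_le_mul_of_nonneg_left hE (abs_nonneg _)
      _ ≤ _ := by
          have := mul_nonneg (mul_nonneg hC hK) hfirst
          linarith
  · rw [if_neg hcase, sub_zero]
    have hsum : (h (min ζ t) - h (min η t)) - (h (min ζ s) - h (min η s)) =
        h (max s (min ζ t)) - h (max s (min η t)) := by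
      have hcl : ∀ u, h (min u t) - h (min u s) = h (max s (min u t)) - h s := by
        intro u
        rcases le_total u s with h1 | h1
        · rw [min_eq_left h1, min_eq_left (h1.trans (hsr.trans hrt)), max_eq_left h1]; ring
        · rw [min_eq_right h1, max_eq_right (le_min h1 (hsr.trans hrt))]
      have e1 := hcl ζ
      have e2 := hcl η
      linarith
    rw [hsum]
    set a := max s (min η t) with ha
    set b := max s (min ζ t) with hb'
    have hab : a ≤ b := max_le_max_left _ (min_le_min_right _ hηζ.le)
    have hsa : s ≤ a := le_max_left _ _
    have hbt : b ≤ t := max_le (hsr.trans hrt) (min_le_right _ _)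
    rcases hab.eq_or_lt with heq | hlt
    · rw [heq, sub_self, abs_zero, mul_zero]
      exact mul_nonneg (mul_nonneg hC hK) (add_nonneg hsecond hfirst)
    · have hηt : η < t := by
        by_contra hge
        push Not at hge
        rw [ha, hb', min_eq_right hge, min_eq_right (hge.trans hηζ.le)] at hlt
        exact lt_irrefl _ hlt
      have hsζ : s < ζ := by
        by_contra hge
        push Not at hge
        rw [ha, hb', max_eq_left ((min_le_left _ _).trans hge),
          max_eq_left ((min_le_left _ _).trans (hηζ.le.trans hge))] at hlt
        exact lt_irrefl _ hlt
      have hone : (1 : ℝ) * |ζ - η| ^ (e - 1) ≤ (Set.Icc s t).indicator 1 η * |ζ - η| ^ (e - 1)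
          + (Set.Icc s t).indicator 1 ζ * |η - ζ| ^ (e - 1) := by
        rw [abs_sub_comm η ζ, ← add_mul]
        refine mul_le_mul_of_nonneg_right ?_ (by positivity)
        by_cases hηr : η < r
        · have hζr : ζ ≤ r := not_lt.mp fun hh => hcase ⟨hηr, hh⟩
          rw [Set.indicator_of_mem (show ζ ∈ Set.Icc s t from ⟨hsζ.le, hζr.trans hrt⟩), Pi.one_apply]
          linarith
        · rw [Set.indicator_of_mem (show η ∈ Set.Icc s t from
            ⟨hsr.trans (not_lt.mp hηr), hηt.le⟩), Pi.one_apply]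
          linarith
      have hba : b - a ≤ ζ - η := by
        have e1 : b - a ≤ min ζ t - min η t := by
          have := abs_max_sub_max_le_max s (min ζ t) s (min η t)
          rw [sub_self, abs_zero, max_eq_right (abs_nonneg (min ζ t - min η t))] at this
          rw [abs_of_nonneg (sub_nonneg.mpr hab),
            abs_of_nonneg (sub_nonneg.mpr (min_le_min_right _ hηζ.le))] at this
          exact this
        have e2 : min ζ t - min η t ≤ ζ - η := by
          rw [min_eq_left hηt.le]
          linarith [min_le_left ζ t]
        linarith
      -- The length `b - a` is at most `t - s` and at most `ζ - η`. Splitting `α = (α + d - 1) + (1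
      -- - d)` uses the second bound to cancel the factor `(ζ - η)^(d - 1)` of the kernel.
      have hE : |h b - h a| ≤ K * ((t - s) ^ (α + d - 1) * (ζ - η) ^ (1 - d)) := by
        refine (hh a b (hs.trans hsa) hab (hbt.trans ht)).trans (mul_le_mul_of_nonneg_left ?_ hK)
        have hpos : 0 < b - a := sub_pos.mpr hlt
        rw [show α = (α + d - 1) + (1 - d) by ring, Real.rpow_add hpos]
        -- The preceding rewrite also replaced `α` in the exponent of `t - s`; this restores it.
        rw [show α + d - 1 + (1 - d) + d - 1 = α + d - 1 by ring]
        exact mul_le_mul (Real.rpow_le_rpow hpos.le (by linarith) (by linarith))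
          (Real.rpow_le_rpow hpos.le hba (by linarith [hρ.d_le])) (by positivity) (by positivity)
      have hcancel : (ζ - η) ^ (d - 1) * (ζ - η) ^ (1 - d) = 1 := by
        rw [← Real.rpow_add hD]; simp
      calc |ρ ζ η| * |h b - h a|
          ≤ (C * ((ζ - η) ^ (d - 1) * (ζ - η) ^ (e - 1))) *
            (K * ((t - s) ^ (α + d - 1) * (ζ - η) ^ (1 - d))) :=
            mul_le_mul hb hE (abs_nonneg _) (by positivity)
        _ = C * K * (t - s) ^ (α + d - 1) * (ζ - η) ^ (e - 1) *
            ((ζ - η) ^ (d - 1) * (ζ - η) ^ (1 - d)) := by ring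
        _ = C * K * ((t - s) ^ (α + d - 1) * (1 * |ζ - η| ^ (e - 1))) := by
            rw [hcancel, abs_of_pos hD]; ring
        _ ≤ C * K * ((t - s) ^ (α + d - 1) * ((Set.Icc s t).indicator 1 η * |ζ - η| ^ (e - 1)
          + (Set.Icc s t).indicator 1 ζ * |η - ζ| ^ (e - 1))) := by gcongr
        _ ≤ _ := by
            refine mul_le_mul_of_nonneg_left ?_ (mul_nonneg hC hK)
            linarith

/-- Integrating the pointwise bound gives `(t - s)^α (t - s)^d` from the points near `r` and `(t -
s)^(α+d-1) (t - s)` from the two strips. Both are of order `d + α > 1`. -/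
theorem isYoungPath_muPath (hρ : IsSingularKernel ρ C d e) (hm : Measurable h) (hα : 0 < α)
    (hdα : 1 < d + α) (hK : 0 ≤ K)
    (hh : ∀ s t, 0 ≤ s → s ≤ t → t ≤ 1 → |h t - h s| ≤ K * (t - s) ^ α) :
    IsYoungPath (fun r => ∫ z : ℝ × ℝ,
      {z : ℝ × ℝ | z.1 < r ∧ r < z.2}.indicator (fun z => ρ z.2 z.1) z ∂unitSq) h (muPath ρ h) := by
  have hC := hρ.C_nonneg
  have hd := hρ.d_pos
  have he := hρ.e_pos
  refine ⟨C * K * (2 / e * (1 / d) + 1 / d * (2 / e) + (2 / e + 2 / e)), d + α, hdα,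
    fun s r t hs hsr hrt ht => ?_⟩
  have hst := hsr.trans hrt
  have hr := hs.trans hsr
  have hr1 := hrt.trans ht
  have hts : 0 ≤ t - s := by linarith
  have i1 := integrable_muPath_integrand hρ hm hα.le hdα.le hK hh (hs.trans hst)
  have i2 := integrable_muPath_integrand hρ hm hα.le hdα.le hK hh hs
  have i3 := (hρ.integrable_quadrant hr hr1).mul_const (h t - h s)
  simp only [muPath]
  have i12 : Integrable (fun z : ℝ × ℝ =>
    Set.indicator {z : ℝ × ℝ | z.1 < z.2} (fun z => ρ z.2 z.1) z * (h (min z.2 t) - h (min z.1 t)) -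
    Set.indicator {z : ℝ × ℝ | z.1 < z.2} (fun z => ρ z.2 z.1) z * (h (min z.2 s) - h (min z.1 s)))
    unitSq := i1.sub i2
  rw [← integral_sub i1 i2, ← integral_mul_const, ← integral_sub i12 i3]
  obtain ⟨a1, -⟩ := integrableOn_rpow_abs he hr hr1
  have a1v := (integrableOn_rpow_abs he hr hr1).2
  obtain ⟨a2, a2v⟩ := integrable_indicator_right hd hr hrt ht
  obtain ⟨a3, a3v⟩ := integrable_indicator_left hd hs hsr hr1
  obtain ⟨b1, b1v⟩ := integral_strip_le he hst
  have b2 : Integrable (fun z : ℝ × ℝ => (Set.Icc s t).indicator 1 z.2 * |z.1 - z.2| ^ (e - 1))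
      unitSq := b1.swap
  have b2v : ∫ z : ℝ × ℝ, (Set.Icc s t).indicator 1 z.2 * |z.1 - z.2| ^ (e - 1) ∂unitSq ≤
      (t - s) * (2 / e) := by
    rw [← integral_unitSq_swap (fun z => (Set.Icc s t).indicator 1 z.1 * |z.2 - z.1| ^ (e - 1))]
      at b1v
    exact b1v
  have c1 := integrable_unitSq_prod_mul a1 a2
  have c2 := integrable_unitSq_prod_mul a3 a1
  have c1v := integral_unitSq_prod_mul (f := fun y => |y - r| ^ (e - 1))
    (g := (Set.Ioc r t).indicator fun y => |y - r| ^ (d - 1))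
  have c2v := integral_unitSq_prod_mul (f := (Set.Ioc s r).indicator fun y => |y - r| ^ (d - 1))
    (g := fun y => |y - r| ^ (e - 1))
  have c12 := (c1.fun_add c2).const_mul ((t - s) ^ α)
  have b12 := (b1.fun_add b2).const_mul ((t - s) ^ (α + d - 1))
  have hdom := (c12.fun_add b12).const_mul (C * K)
  have hle := norm_integral_le_of_norm_le hdom (f := fun z : ℝ × ℝ =>
    Set.indicator {z : ℝ × ℝ | z.1 < z.2} (fun z => ρ z.2 z.1) z * (h (min z.2 t) - h (min z.1 t)) -
    Set.indicator {z : ℝ × ℝ | z.1 < z.2} (fun z => ρ z.2 z.1) z * (h (min z.2 s) - h (min z.1 s)) -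
    {z : ℝ × ℝ | z.1 < r ∧ r < z.2}.indicator (fun z => ρ z.2 z.1) z * (h t - h s)) ?_
  · refine hle.trans ?_
    rw [integral_const_mul, integral_add c12 b12,
      integral_const_mul, integral_const_mul, integral_add c1 c2, integral_add b1 b2,
      c1v, c2v, a2v, a3v, mul_assoc (C * K)]
    refine mul_le_mul_of_nonneg_left ?_ (mul_nonneg hC hK)
    have p1 : (t - r) ^ d ≤ (t - s) ^ d := Real.rpow_le_rpow (by linarith) (by linarith) hd.le
    have p2 : (r - s) ^ d ≤ (t - s) ^ d := Real.rpow_le_rpow (by linarith) (by linarith) hd.le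
    have p3 : (t - s) ^ (α + d - 1) * (t - s) = (t - s) ^ (d + α) := by
      nth_rewrite 2 [← Real.rpow_one (t - s)]
      rw [← Real.rpow_add_of_nonneg hts (by linarith) zero_le_one]
      ring_nf
    have p4 : (t - s) ^ α * (t - s) ^ d = (t - s) ^ (d + α) := by
      rw [← Real.rpow_add_of_nonneg hts hα.le hd.le, add_comm]
    set A := ∫ y in Set.Ioc (0 : ℝ) 1, |y - r| ^ (e - 1)
    calc _ ≤ (t - s) ^ α * (2 / e * ((t - s) ^ d / d) + (t - s) ^ d / d * (2 / e)) +
          (t - s) ^ (α + d - 1) * ((t - s) * (2 / e) + (t - s) * (2 / e)) := by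
          have : 0 ≤ t - r := by linarith
          have : 0 ≤ r - s := by linarith
          gcongr
      _ = (t - s) ^ α * (t - s) ^ d * (2 / e * (1 / d) + 1 / d * (2 / e)) +
          (t - s) ^ (α + d - 1) * (t - s) * (2 / e + 2 / e) := by ring
      _ = _ := by rw [p3, p4]; ring
  · filter_upwards [ae_unitSq] with z hz
    by_cases hlt : z.1 < z.2
    · have hmain := abs_muPath_remainder_le hρ hα.le hdα.le hK hh hs hsr hrt ht hz.1.1.le hlt hz.2.2
      refine le_trans (le_of_eq ?_) hmain
      rw [Set.indicator_of_mem (show z ∈ {z : ℝ × ℝ | z.1 < z.2} from hlt), Real.norm_eq_abs]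
      congr 1
      by_cases hc : z.1 < r ∧ r < z.2
      · rw [Set.indicator_of_mem (show z ∈ {z : ℝ × ℝ | z.1 < r ∧ r < z.2} from hc), if_pos hc]
        ring
      · rw [Set.indicator_of_notMem (show z ∉ {z : ℝ × ℝ | z.1 < r ∧ r < z.2} from hc), if_neg hc]
        ring
    · rw [Set.indicator_of_notMem (show z ∉ {z : ℝ × ℝ | z.1 < z.2} from hlt),
        Set.indicator_of_notMem (show z ∉ {z : ℝ × ℝ | z.1 < r ∧ r < z.2} from
          fun hc => hlt (hc.1.trans hc.2))]
      simp only [zero_mul, sub_zero, norm_zero]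
      have n1 : 0 ≤ (Set.Ioc r t).indicator (fun y => |y - r| ^ (d - 1)) z.2 :=
        Set.indicator_nonneg (fun y _ => by positivity) _
      have n2 : 0 ≤ (Set.Ioc s r).indicator (fun y => |y - r| ^ (d - 1)) z.1 :=
        Set.indicator_nonneg (fun y _ => by positivity) _
      have n3 : 0 ≤ (Set.Icc s t).indicator (1 : ℝ → ℝ) z.1 := Set.indicator_nonneg (by simp) _
      have n4 : 0 ≤ (Set.Icc s t).indicator (1 : ℝ → ℝ) z.2 := Set.indicator_nonneg (by simp) _
      positivity

theorem muPath_zero : muPath ρ h 0 = 0 := by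
  rw [muPath]
  refine integral_eq_zero_of_ae ?_
  filter_upwards [ae_unitSq] with z hz
  rw [min_eq_right hz.1.1.le, min_eq_right hz.2.1.le, sub_self, mul_zero, Pi.zero_apply]

/-- For antisymmetric `ρ` the integrand on the right is symmetric, so the square is twice the
triangle `η < ζ`. -/
theorem muPath_one (hρ : IsSingularKernel ρ C d e) (hm : Measurable h) (hα : 0 ≤ α)
    (hdα : 1 ≤ d + α) (hK : 0 ≤ K)
    (hh : ∀ s t, 0 ≤ s → s ≤ t → t ≤ 1 → |h t - h s| ≤ K * (t - s) ^ α)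
    (hanti : ∀ s t, ρ s t = -ρ t s) :
    2 * muPath ρ h 1 = ∫ z : ℝ × ℝ, ρ z.2 z.1 * (h z.2 - h z.1) ∂unitSq := by
  have i1 := integrable_muPath_integrand hρ hm hα hdα hK hh zero_le_one
  set f : ℝ × ℝ → ℝ := fun z => Set.indicator {z : ℝ × ℝ | z.1 < z.2} (fun z => ρ z.2 z.1) z *
      (h (min z.2 1) - h (min z.1 1)) with hf
  have i2 : Integrable (fun z => f z.swap) unitSq := i1.swap
  have hX : muPath ρ h 1 = ∫ z, f z ∂unitSq := rfl
  rw [two_mul, hX]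
  nth_rewrite 2 [← integral_unitSq_swap f]
  rw [← integral_add i1 i2]
  refine integral_congr_ae ?_
  filter_upwards [ae_unitSq] with z hz
  simp only [hf, Prod.fst_swap, Prod.snd_swap, min_eq_left hz.1.2, min_eq_left hz.2.2]
  rcases lt_trichotomy z.1 z.2 with hlt | heq | hlt
  · rw [Set.indicator_of_mem (show z ∈ {z : ℝ × ℝ | z.1 < z.2} from hlt),
      Set.indicator_of_notMem (show z.swap ∉ {z : ℝ × ℝ | z.1 < z.2} from hlt.le.not_gt)]
    ring
  · rw [heq]; ring
  · rw [Set.indicator_of_mem (show z.swap ∈ {z : ℝ × ℝ | z.1 < z.2} from hlt),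
      Set.indicator_of_notMem (show z ∉ {z : ℝ × ℝ | z.1 < z.2} from hlt.le.not_gt)]
    simp only [Prod.fst_swap, Prod.snd_swap]
    rw [hanti z.1 z.2]
    ring

end muPath

/-! ### The sup norm bound by the Sobolev functional. -/

/-- A linear quantity is traded for a `q`-th power at a free scale `lam`; this replaces Hölder's
inequality in the chaining argument below. -/
theorem abs_le_add_rpow_mul {r lam q : ℝ} (hlam : 0 < lam) (hq : 1 ≤ q) :
    |r| ≤ lam + |r| ^ q * lam ^ (1 - q) := by
  rcases le_or_gt |r| lam with h | h
  · have : 0 ≤ |r| ^ q * lam ^ (1 - q) := by positivity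
    linarith
  · have hr : 0 < |r| := hlam.trans h
    have h1 : |r| ^ (1 - q) ≤ lam ^ (1 - q) :=
      Real.rpow_le_rpow_of_nonpos hlam h.le (by linarith)
    have h2 : |r| ^ q * |r| ^ (1 - q) = |r| := by
      rw [← Real.rpow_add hr]; simp
    have h3 : |r| ^ q * |r| ^ (1 - q) ≤ |r| ^ q * lam ^ (1 - q) :=
      mul_le_mul_of_nonneg_left h1 (by positivity)
    linarith

/-- A Garsia–Rodemich–Rumsey type bound: the deviation of a path from its mean is controlled by
its Sobolev norm. -/
theorem abs_sub_mean_le {α γ p K : ℝ} (hα : 0 < α) (hγ : 0 < γ) (hp : 1 ≤ p) (hK : 0 ≤ K)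
    {x : ℝ → ℝ} (hxc : Continuous x)
    (hx : ∀ s ∈ Set.Icc (0 : ℝ) 1, ∀ t ∈ Set.Icc (0 : ℝ) 1, |x t - x s| ≤ K * |t - s| ^ α)
    (hint : Integrable (fun z : ℝ × ℝ => |x z.2 - x z.1| ^ (2 * p) / |z.2 - z.1| ^ (2 * p * γ + 2))
      unitSq) {t : ℝ} (ht : 0 ≤ t) (ht1 : t ≤ 1) :
    |(∫ u in Set.Ioc (0 : ℝ) 1, x u) - x t| ≤
      (1 + 2 * sobolevPow γ p x) / (1 - (1 / 2 : ℝ) ^ γ) := by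
  set F : ℝ × ℝ → ℝ := fun z => |x z.2 - x z.1| ^ (2 * p) / |z.2 - z.1| ^ (2 * p * γ + 2) with hF
  have hF0 : ∀ z, 0 ≤ F z := fun z => by simp only [hF]; positivity
  have hN : sobolevPow γ p x = ∫ z, F z ∂unitSq := sobolevPow_eq hint
  set ℓ : ℕ → ℝ := fun n => (1 / 2 : ℝ) ^ n with hℓ
  -- The nested intervals `(a n, a n + ℓ n]` start from `(0,1]`, halve in length and shrink to `t`;
  -- their closures contain `t`, and none leaves `[0,1]`.
  set a : ℕ → ℝ := fun n => t * (1 - ℓ n) with ha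
  set I : ℕ → Set ℝ := fun n => Set.Ioc (a n) (a n + ℓ n) with hI
  set A : ℕ → ℝ := fun n => (∫ u in I n, x u) / ℓ n with hA
  have hℓ0 : ∀ n, 0 < ℓ n := fun n => by positivity
  have hℓ1 : ∀ n, ℓ n ≤ 1 := fun n => pow_le_one₀ (by norm_num) (by norm_num)
  have hℓs : ∀ n, ℓ (n + 1) = ℓ n / 2 := fun n => by simp only [hℓ, pow_succ]; ring
  have hmI : ∀ n, MeasurableSet (I n) := fun n => measurableSet_Ioc
  have hsub : ∀ n, I (n + 1) ⊆ I n := fun n =>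
    Set.Ioc_subset_Ioc (by simp only [ha, hℓs]; nlinarith [hℓ0 n])
      (by simp only [ha, hℓs]; nlinarith [hℓ0 n])
  have h01 : ∀ n, I n ⊆ Set.Ioc 0 1 := fun n =>
    Set.Ioc_subset_Ioc (by simp only [ha]; nlinarith [hℓ1 n])
      (by simp only [ha]; nlinarith [hℓ0 n, hℓ1 n])
  have hvol : ∀ n, (volume.restrict (I n)).real Set.univ = ℓ n := fun n => by
    rw [measureReal_restrict_apply MeasurableSet.univ, Set.univ_inter,
      Real.volume_real_Ioc_of_le (by linarith [hℓ0 n])]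
    ring
  have hxi : ∀ n, IntegrableOn x (I n) := fun n =>
    (hxc.integrableOn_Icc (a := a n) (b := a n + ℓ n)).mono_set Set.Ioc_subset_Icc_self
  have hstep : ∀ n, dist (A n) (A (n + 1)) ≤ (1 + 2 * sobolevPow γ p x) * ((1 / 2 : ℝ) ^ γ) ^ n := by
    intro n
    have hpow : ((1 / 2 : ℝ) ^ γ) ^ n = ℓ n ^ γ := by
      simp only [hℓ]
      rw [← Real.rpow_natCast, ← Real.rpow_natCast, ← Real.rpow_mul (by norm_num),
        ← Real.rpow_mul (by norm_num), mul_comm]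
    set ν : Measure (ℝ × ℝ) := (volume.restrict (I (n + 1))).prod (volume.restrict (I n)) with hν
    have hνs : ν = unitSq.restrict (I (n + 1) ×ˢ I n) := by
      rw [hν, unitSq, ← Measure.prod_restrict, Measure.restrict_restrict (hmI _),
        Measure.restrict_restrict (hmI _), Set.inter_eq_left.mpr (h01 _),
        Set.inter_eq_left.mpr (h01 _)]
    have hνreal : ν.real Set.univ = ℓ (n + 1) * ℓ n := by
      rw [hν, ← Set.univ_prod_univ, measureReal_prod_prod, hvol, hvol]
    have i1 : Integrable (fun z : ℝ × ℝ => x z.2) ν := (hxi n).comp_snd _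
    have i2 : Integrable (fun z : ℝ × ℝ => x z.1) ν := (hxi (n + 1)).comp_fst _
    have hprod : ∫ z, (x z.2 - x z.1) ∂ν = ℓ (n + 1) * ℓ n * (A n - A (n + 1)) := by
      rw [integral_sub i1 i2, hν, integral_fun_snd x, integral_fun_fst x, hvol, hvol]
      simp only [hA, smul_eq_mul]
      field_simp [(hℓ0 n).ne', (hℓ0 (n + 1)).ne']
    -- At this scale the weight `w` in front of `F` becomes `ℓ n ^ 2 * lam`. Divided by the area `ℓ
    -- n ^ 2 / 2` of the rectangle, this gives `lam * (1 + 2 * sobolevPow)`, a geometric bound in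
    -- `n`.
    set lam := ℓ n ^ γ with hlam
    have hlam0 : 0 < lam := Real.rpow_pos_of_pos (hℓ0 n) _
    set w := ℓ n ^ (2 * p * γ + 2) * lam ^ (1 - 2 * p) with hw
    have hw0 : 0 ≤ w := by have := hℓ0 n; positivity
    have hwv : w = ℓ n ^ 2 * lam := by
      rw [hw, hlam, ← Real.rpow_mul (hℓ0 n).le, ← Real.rpow_natCast, ← Real.rpow_add (hℓ0 n),
        ← Real.rpow_add (hℓ0 n)]
      congr 1
      push_cast
      ring
    have hFν : Integrable F ν := by rw [hνs]; exact hint.restrict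
    have hFle : ∫ z, F z ∂ν ≤ sobolevPow γ p x := by
      rw [hN, hνs]
      exact setIntegral_le_integral hint (Filter.Eventually.of_forall hF0)
    have hbd : ∀ᵐ z ∂ν, ‖x z.2 - x z.1‖ ≤ lam + w * F z := by
      rw [hνs, ae_restrict_iff' ((hmI _).prod (hmI _))]
      refine Filter.Eventually.of_forall fun z hz => ?_
      have hz1 := hsub n hz.1
      have hz2 := hz.2
      have hD : |z.2 - z.1| ≤ ℓ n := by
        rw [abs_le]; constructor <;> linarith [hz1.1, hz1.2, hz2.1, hz2.2]
      rw [Real.norm_eq_abs]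
      refine (abs_le_add_rpow_mul hlam0 (by linarith : (1 : ℝ) ≤ 2 * p)).trans ?_
      have hFD : |x z.2 - x z.1| ^ (2 * p) ≤ F z * ℓ n ^ (2 * p * γ + 2) := by
        rcases (abs_nonneg (z.2 - z.1)).eq_or_lt with h0 | h0
        · have : z.2 = z.1 := by
            have := abs_eq_zero.mp h0.symm
            linarith
          rw [this, sub_self, abs_zero, Real.zero_rpow (by linarith : 2 * p ≠ 0)]
          have := hF0 z
          have := hℓ0 n
          positivity
        · calc |x z.2 - x z.1| ^ (2 * p) = F z * |z.2 - z.1| ^ (2 * p * γ + 2) := by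
                simp only [hF]; field_simp
            _ ≤ _ := mul_le_mul_of_nonneg_left
                (Real.rpow_le_rpow h0.le hD (by positivity)) (hF0 z)
      have := mul_le_mul_of_nonneg_right hFD (Real.rpow_nonneg hlam0.le (1 - 2 * p))
      rw [hw]
      linarith
    have hdomi : Integrable (fun z => lam + w * F z) ν :=
      (integrable_const lam).add (hFν.const_mul w)
    have hle := norm_integral_le_of_norm_le hdomi hbd
    rw [hprod, integral_add (integrable_const lam) (hFν.const_mul w), integral_const_mul,
      integral_const, hνreal, smul_eq_mul, norm_mul, Real.norm_of_nonneg
        (mul_nonneg (hℓ0 _).le (hℓ0 _).le)] at hle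
    rw [hpow, Real.dist_eq, ← Real.norm_eq_abs]
    have hpos : 0 < ℓ (n + 1) * ℓ n := mul_pos (hℓ0 _) (hℓ0 _)
    refine le_of_mul_le_mul_left (hle.trans ?_) hpos
    have h2 : w * ∫ z, F z ∂ν ≤ ℓ n ^ 2 * lam * sobolevPow γ p x := by
      rw [← hwv]; exact mul_le_mul_of_nonneg_left hFle hw0
    rw [hℓs]
    nlinarith
  have hlim : Filter.Tendsto A Filter.atTop (nhds (x t)) := by
    have hz : Filter.Tendsto (fun n => K * ℓ n ^ α) Filter.atTop (nhds 0) := by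
      have h1 : Filter.Tendsto ℓ Filter.atTop (nhds 0) :=
        tendsto_pow_atTop_nhds_zero_of_lt_one (by norm_num) (by norm_num)
      have h2 := (h1.rpow_const (p := α) (Or.inr hα.le)).const_mul K
      simpa [Real.zero_rpow hα.ne'] using h2
    rw [tendsto_iff_dist_tendsto_zero]
    refine squeeze_zero (fun _ => dist_nonneg) (fun n => ?_) hz
    have hdiff : A n - x t = (∫ u in I n, (x u - x t)) / ℓ n := by
      rw [integral_sub (hxi n) (integrable_const _), integral_const, hvol]
      simp only [hA, smul_eq_mul]
      field_simp [(hℓ0 n).ne']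
    have hb := norm_setIntegral_le_of_norm_le_const (μ := volume) (s := I n)
      (f := fun u => x u - x t) (C := K * ℓ n ^ α) (by simp [hI]) (fun u hu => by
        rw [Real.norm_eq_abs]
        have hu1 := h01 n hu
        refine (hx t ⟨ht, ht1⟩ u (Set.Ioc_subset_Icc_self hu1)).trans ?_
        refine mul_le_mul_of_nonneg_left (Real.rpow_le_rpow (abs_nonneg _) ?_ hα.le) hK
        have h1 := hu.1
        have h2 := hu.2
        simp only [ha] at h1 h2
        have h3 := hℓ0 n
        rw [abs_le]; constructor <;> nlinarith)
    have hvr : volume.real (I n) = ℓ n := by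
      rw [Real.volume_real_Ioc_of_le (by linarith [hℓ0 n])]; ring
    rw [Real.dist_eq, hdiff, abs_div, abs_of_pos (hℓ0 n), div_le_iff₀ (hℓ0 n), ← hvr]
    rw [hvr] at hb ⊢
    exact hb
  have hr1 : (1 / 2 : ℝ) ^ γ < 1 := Real.rpow_lt_one (by norm_num) (by norm_num) hγ
  have h := dist_le_of_le_geometric_of_tendsto₀ _ _ hr1 hstep hlim
  have hA0 : A 0 = ∫ u in Set.Ioc (0 : ℝ) 1, x u := by
    simp [hA, hI, ha, hℓ]
  rwa [hA0, Real.dist_eq] at h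

/-- Both `x_t` and `x_0` are close to the mean of `x`. The Hölder norm of `x` enters only
qualitatively, to ensure integrability and convergence of the local means. -/
theorem norm_pin_le {γ p : ℝ} (hγ : 0 < γ) (hp : 1 ≤ p) {α : ℝ≥0} (hα : 0 < α)
    (hε : 1 < 2 * p * (α - γ)) (x : HolderC α) :
    ‖pin x.toC‖ ≤ 2 * ((1 + 2 * sobolevPow γ p (ev x.toC)) / (1 - (1 / 2 : ℝ) ^ γ)) := by
  have hα0 : (0 : ℝ) < α := hα
  have hx : ∀ s ∈ Set.Icc (0 : ℝ) 1, ∀ t ∈ Set.Icc (0 : ℝ) 1,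
      |ev x.toC t - ev x.toC s| ≤ ‖x‖ * |t - s| ^ (α : ℝ) := fun s hs t ht => x.abs_sub_le hs ht
  have hint := integrable_sobolev hα0 hp hε (norm_nonneg x) (continuous_ev x.toC).measurable hx
  have key := fun t (ht : 0 ≤ t) (ht1 : t ≤ 1) =>
    abs_sub_mean_le hα0 hγ hp (norm_nonneg x) (continuous_ev x.toC) hx hint ht ht1
  refine norm_le_of_ev ?_ fun t ht ht1 => ?_
  · have := (abs_nonneg _).trans (key 0 le_rfl zero_le_one)
    linarith
  · rw [ev_pin]
    have h0 := abs_le.mp (key 0 le_rfl zero_le_one)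
    have h1 := abs_le.mp (key t ht ht1)
    rw [abs_le]
    constructor <;> linarith [h0.1, h0.2, h1.1, h1.2]

/-! ### The Young integral of `μ`. -/

/-- A Hölder function of exponent greater than `1` is constant. -/
theorem IncrHolder.eq_const {a : ℝ} {f : ℝ → ℝ} (h : IncrHolder a f) (ha : 1 < a) {t : ℝ}
    (ht : 0 ≤ t) (ht1 : t ≤ 1) : f t = f 0 := by
  obtain ⟨C, hC⟩ := h
  have h1 : IsYoungPath (fun _ => 0) (fun _ => 0) f :=
    ⟨C, a, ha, fun s r t hs hsr hrt ht => by simpa using hC s t hs (hsr.trans hrt) ht⟩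
  have h2 : IsYoungPath (fun _ => 0) (fun _ => 0) (fun _ => 0) :=
    ⟨0, a, ha, fun s r t _ _ _ _ => by simp⟩
  have := h1.unique h2 ht ht1
  linarith

theorem rhoKernel_antisymm (γ p : ℝ) (x : ℝ → ℝ) (s t : ℝ) :
    rhoKernel γ p x s t = -rhoKernel γ p x t s := by
  rw [rhoKernel, rhoKernel, abs_sub_comm (x s), abs_sub_comm s]
  ring

theorem exists_isSingularKernel {γ p : ℝ} {α : ℝ≥0} (hα : 0 < α) (hp : 1 ≤ p)
    (hε : 1 < 2 * p * (α - γ)) (x : HolderC α) :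
    ∃ C d e, IsSingularKernel (rhoKernel γ p (ev x.toC)) C d e ∧ 1 < d + α := by
  have hα' : (0 : ℝ) < α := hα
  have hmeas := measurable_rhoKernel γ p (continuous_ev x.toC).measurable
  rcases le_or_gt (α : ℝ) 1 with h1 | h1
  · set m := min (2 * p * (α - γ) - 1) (α : ℝ) with hm
    have hm0 : 0 < m := lt_min (by linarith) hα'
    have hm1 : m ≤ 2 * p * (α - γ) - 1 := min_le_left _ _
    have hm2 : m ≤ α := min_le_right _ _
    -- The kernel has order `2p(α - γ) - α - 2 ≥ m - 1 - α = d + e - 2`, while `d + α = 1 + m / 2 >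
    -- 1`; taking `m ≤ α` keeps `d ≤ 1`.
    refine ⟨2 * p * ‖x‖ ^ (2 * p - 1), 1 - α + m / 2, m / 2, ⟨hmeas, by positivity, by linarith,
      by linarith, by linarith, by linarith, fun η ζ hη hηζ hζ => ?_⟩, by linarith⟩
    have hD : 0 < ζ - η := sub_pos.mpr hηζ
    have hb := abs_rhoKernel_le (γ := γ) hα' hp (norm_nonneg x)
      (x.abs_sub_le ⟨hη, hηζ.le.trans hζ⟩ ⟨hη.trans hηζ.le, hζ⟩)
    refine hb.trans (mul_le_mul_of_nonneg_left ?_ (by positivity))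
    rw [abs_of_pos hD, ← Real.rpow_add hD]
    refine Real.rpow_le_rpow_of_exponent_ge hD (by linarith) ?_
    linarith
  -- For exponent above `1` the path is constant and the kernel is zero.
  · refine ⟨0, 1 / 2, 1 / 2, ⟨hmeas, le_rfl, by norm_num, by norm_num, by norm_num, by norm_num,
      fun η ζ hη hηζ hζ => ?_⟩, by linarith⟩
    rw [rhoKernel, x.incrHolder.eq_const h1 hη (hηζ.le.trans hζ),
      x.incrHolder.eq_const h1 (hη.trans hηζ.le) hζ]
    simp

/-- `D‖x‖^{2p} · h = 2 ∫ μ dh`. -/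
theorem youngValue_muTerm {γ p : ℝ} {α : ℝ≥0} (hα : 0 < α) (hp : 1 ≤ p)
    (hε : 1 < 2 * p * (α - γ)) (x h : HolderC α) :
    YoungValue (muTerm γ p (ev x.toC)) (ev h.toC) (sobolevDeriv γ p x h / 2) := by
  obtain ⟨C, d, e, hρ, hd⟩ := exists_isSingularKernel hα hp hε x
  have hα' : (0 : ℝ) < α := hα
  obtain ⟨K, hK⟩ := h.incrHolder
  have hK0 := IncrHolder.const_nonneg hK
  have hm := (continuous_ev h.toC).measurable
  have hpath := isYoungPath_muPath hρ hm hα' hd hK0 hK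
  refine ⟨_, hpath.congr (fun r hr hr1 => muTerm_eq hρ hr hr1) (fun _ _ _ => rfl)
    (fun _ _ _ => rfl), ?_⟩
  rw [muPath_zero, sub_zero, sobolevDeriv_apply hα hp hε,
    ← muPath_one hρ hm hα'.le hd.le hK0 hK (rhoKernel_antisymm γ p _)]
  ring

/-! ### The resolvent and the kernel `Φ`. -/

/-- The function `K(s,·)` in `C^κ`. -/
noncomputable def greenH {κ : ℝ≥0} (hκ : κ ≤ 1) (s : ℝ) : HolderC κ :=
  ⟨ofContinuousOn (greenK s) ((IncrHolder.greenK s).continuousOn one_pos),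
    memHolder_of_incrHolder (((IncrHolder.greenK s).weaken κ.2 (by exact_mod_cast hκ)).congr
      fun _ ht ht1 => ev_ofContinuousOn _ ht ht1)⟩

theorem ev_greenH {κ : ℝ≥0} (hκ : κ ≤ 1) (s : ℝ) {t : ℝ} (ht : 0 ≤ t) (ht1 : t ≤ 1) :
    ev (greenH hκ s).toC t = greenK s t :=
  ev_ofContinuousOn ((IncrHolder.greenK s).continuousOn one_pos) ht ht1

section Linear

variable {a G : ℝ} {f x : ℝ → ℝ} {F : CI} {R : CI →L[ℝ] CI}

/-- The resolvent family solves the linear equation. -/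
theorem linearEquation_solution (ha : 0 < a) (ha1 : a ≤ 1) (hx : IncrHolder a x) {b : ℝ}
    (hb : ∀ t, 0 ≤ t → t ≤ 1 → |f t| ≤ b) (hF : IsYoungPath f x (ev F))
    (hFa : IncrHolder a (ev F)) (hR : ∀ V, R V = V + G • S F (R V)) (m n : ℝ) (B : CI) {s : ℝ}
    (hs : 0 ≤ s) (hs1 : s ≤ 1) {y : CI}
    (hy : ∀ t, 0 ≤ t → t ≤ 1 → ev y t =
      m * (greenK s t + ev (P (R (G • greenPath F s))) t) + n * ev (P (R B)) t) {t : ℝ}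
    (ht : 0 ≤ t) (ht1 : t ≤ 1) :
    ev y t = (m * greenK t s + n * ev (P B) t)
      + G * youngIntegral (fun ξ => greenK t ξ * (f ξ * ev y ξ)) x 0 1 := by
  set V := R (G • greenPath F s) with hV
  -- The primitive of `f y dx`, assembled term by term from the formula for `y`; `P U` then gives
  -- the Green integral.
  set U : CI := m • (greenPath F s + S F V) + n • S F (R B) with hU
  have hpath : IsYoungPath (fun ξ => f ξ * ev y ξ) x (ev U) := by
    have h1 := (((hF.greenPath hFa ha hs hs1).add (hF.S hFa ha V)).const_mul m).add
      ((hF.S hFa ha (R B)).const_mul n)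
    refine h1.congr (fun ξ hξ hξ1 => ?_) (fun _ _ _ => rfl) (fun _ _ _ => rfl)
    rw [hy ξ hξ hξ1]; ring
  have hUa : IncrHolder a (ev U) := hpath.incrHolder (B := b * ‖y‖) hx ha.le ha1 fun t ht ht1 => by
    rw [abs_mul]
    exact mul_le_mul (hb t ht ht1) (abs_ev_le y t) (abs_nonneg _)
      ((abs_nonneg _).trans (hb t ht ht1))
  rw [(hpath.youngValue_greenK hUa ha ht ht1).hasYoungIntegral.youngIntegral_eq zero_le_one,
    hy t ht ht1, hR B, hU]
  have hV' : V = G • greenPath F s + G • S F V := hR _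
  have e1 : ev (P V) t = G * ev (P (greenPath F s)) t + G * ev (P (S F V)) t := by
    conv_lhs => rw [hV']
    rw [map_add, map_smul, map_smul, ev_add, ev_smul, ev_smul]
  rw [e1]
  simp only [map_add, map_smul, ev_add, ev_smul, greenK_comm s t]
  ring

/-- Integrating the resolvent family against `h` gives the resolvent of the integral. -/
theorem youngValue_resolvent (ha : 0 < a) (hR : ∀ V, R (V - G • S F V) = V) {g μ h : ℝ → ℝ} {H : CI}
    (hH : IsYoungPath g h (ev H)) (hHa : IncrHolder a (ev H)) {N : ℝ} (hμ : YoungValue μ h (N / 2))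
    (φ' : ℝ) (B : CI) {t : ℝ} (ht : 0 ≤ t) (ht1 : t ≤ 1) :
    YoungValue (fun s => G * g s * (greenK s t + ev (P (R (G • greenPath F s))) t)
        + 2 * φ' * μ s * ev (P (R B)) t) h
      (ev (P (R ((φ' * N) • B + G • H))) t) := by
  set ℓ : CI →L[ℝ] ℝ := (evL t).comp (P.comp R) with hℓ
  have hℓv : ∀ V, ev (P (R V)) t = ℓ V := fun _ => rfl
  have v1 := (hH.youngValue_greenK hHa ha ht ht1).const_mul G
  have v2 := (hH.youngValue_greenPath hHa ha F ℓ).const_mul (G * G)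
  have v3 := hμ.const_mul (2 * φ' * ℓ B)
  refine ((v1.add v2).add v3).congr (fun s _ _ => ?_) ?_
  · rw [hℓv, hℓv, map_smul, smul_eq_mul, greenK_comm s t]
    ring
  -- The two contributions of `G g_s dh_s`, the bare kernel and its resolvent correction, combine by
  -- this identity into the single term `G R H`.
  · have e : R H = H + G • R (S F H) := by
      have := hR H
      rw [map_sub, map_smul] at this
      rw [sub_eq_iff_eq_add] at this
      exact this
    have e2 : ℓ H = ev (P H) t + G * ℓ (S F H) := by
      rw [← hℓv, ← hℓv, e, map_add, map_smul, ev_add, ev_smul]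
    rw [hℓv, map_add, map_smul, map_smul, smul_eq_mul, smul_eq_mul, e2]
    ring

end Linear

theorem exists_resolvent {E : Type*} [NormedAddCommGroup E] [NormedSpace ℝ E] [CompleteSpace E]
    {A : E →L[ℝ] E} (hA : ‖A‖ < 1) :
    ∃ R : E →L[ℝ] E, (∀ V, R (V - A V) = V) ∧ ∀ V, R V = V + A (R V) := by
  have h1 := (Units.oneSub A hA).inv_mul
  have h2 := (Units.oneSub A hA).mul_inv
  rw [Units.val_oneSub] at h1 h2
  refine ⟨((Units.oneSub A hA)⁻¹ : (E →L[ℝ] E)ˣ), fun V => DFunLike.congr_fun h1 V, fun V => ?_⟩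
  have h3 := DFunLike.congr_fun h2 V
  exact sub_eq_iff_eq_add.mp h3

theorem abs_sub_le_of_hasDerivAt {f f' : ℝ → ℝ} {c : ℝ} (h : ∀ y, HasDerivAt f (f' y) y)
    (hc : ∀ y, |f' y| ≤ c) (u v : ℝ) : |f u - f v| ≤ c * |u - v| :=
  convex_univ.norm_image_sub_le_of_norm_hasDerivWithin_le
    (fun y _ => (h y).hasDerivWithinAt) (fun y _ => hc y) (Set.mem_univ v) (Set.mem_univ u)

/-! ### The nonlinear equation, its solution map and the main theorem. -/

/-- The elliptic equation in terms of the primitive of `σ(y) dx`. -/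
theorem isEllipticSolution_iff {φ σ : ℝ → ℝ} {γ p : ℝ} {a : ℝ} (ha : 0 < a) {x : ℝ → ℝ}
    {Y U : CI} (hU : IsYoungPath (fun t => σ (ev Y t)) x (ev U)) (hUa : IncrHolder a (ev U)) :
    IsEllipticSolution φ γ p σ x (ev Y) ↔ Y = P (cutoffG φ γ p x • U) := by
  set G := cutoffG φ γ p x with hG
  have hGU := hU.const_mul G
  -- The weight `ξ` is `J 1` on `[0,1]`, so `∫ ξ G σ(Y) dx` is computed by parts.
  have hid := hGU.mul (k := ev (J 1)) (D := fun t => G * ev (J U) t) (by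
    have := (isYoungPath_J hUa ha 1).const_mul G
    rw [mul_one] at this
    exact this) (fun t _ _ => abs_ev_le _ t)
  have hid' : youngIntegral (fun ξ => ξ * (G * σ (ev Y ξ))) x 0 1 = G * ev U 1 - G * ev (J U) 1 := by
    have h1 := hid.congr (g' := fun ξ => ξ * (G * σ (ev Y ξ))) (fun t ht ht1 => by
      simp only [ev_J_one ht ht1]) (fun _ _ _ => rfl) (fun _ _ _ => rfl)
    rw [h1.youngIntegral_eq le_rfl zero_le_one le_rfl, ev_J_one zero_le_one le_rfl]
    simp
  have hrhs : ∀ s t, 0 ≤ s → s ≤ t → t ≤ 1 →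
      (∫ u in s..t, youngIntegral (fun ξ => G * σ (ev Y ξ)) x u 1)
        - (t - s) * youngIntegral (fun ξ => ξ * (G * σ (ev Y ξ))) x 0 1 =
      ev (P (G • U)) t - ev (P (G • U)) s := by
    intro s t hs hst ht
    have h1 : ∫ u in s..t, youngIntegral (fun ξ => G * σ (ev Y ξ)) x u 1 =
        ∫ u in s..t, (G * ev U 1 - ev (G • U) u) :=
      intervalIntegral.integral_congr fun u hu => by
        rw [Set.uIcc_of_le hst] at hu
        exact hGU.youngIntegral_eq (hs.trans hu.1) (hu.2.trans ht) le_rfl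
    rw [h1, hid', ev_P_sub _ hs hst ht, intervalIntegral.integral_sub (by simp)
      (intervalIntegrable_ev _ _ _), intervalIntegral.integral_const, map_smul, ev_smul]
    simp only [smul_eq_mul]
    ring
  constructor
  · rintro ⟨h0, h⟩
    refine CI.ext_ev fun t ht ht1 => ?_
    have := (h 0 t le_rfl ht ht1).trans (hrhs 0 t le_rfl ht ht1)
    rwa [h0, P_zero_left, sub_zero, sub_zero] at this
  · intro h
    refine ⟨by rw [h, P_zero_left], fun s t hs hst ht => ?_⟩
    refine Eq.trans ?_ (hrhs s t hs hst ht).symm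
    rw [← h]

/-- Either the cutoff vanishes or the Sobolev functional is at most `M + 1`. The bound `Λ` is chosen
before the Hölder exponent, as required for `c` to be independent of `ε`. -/
theorem IsCutoff.exists_cutoffG_mul_norm_pin_le {M γ p : ℝ} {φ : ℝ → ℝ} (hφ : IsCutoff M φ)
    (hM : 0 < M) (hγ : 0 < γ) (hp : 1 ≤ p) :
    ∃ Λ, 0 ≤ Λ ∧ ∀ {α : ℝ≥0}, 0 < α → 1 < 2 * p * (α - γ) → ∀ x : HolderC α,
      |cutoffG φ γ p (ev x.toC)| * ‖pin x.toC‖ ≤ Λ := by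
  obtain ⟨C, hC⟩ := hφ.bounded 0
  simp only [iteratedDeriv_zero] at hC
  have hC0 : 0 ≤ C := (abs_nonneg _).trans (hC 0)
  have hd : 0 < 1 - (1 / 2 : ℝ) ^ γ :=
    sub_pos.mpr (Real.rpow_lt_one (by norm_num) (by norm_num) hγ)
  refine ⟨C * (2 * ((1 + 2 * (M + 1)) / (1 - (1 / 2) ^ γ))), by positivity, fun hα hε x => ?_⟩
  rcases lt_or_ge (M + 1) (sobolevPow γ p (ev x.toC)) with h | h
  · rw [cutoffG, hφ.eq_zero _ h, abs_zero, zero_mul]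
    positivity
  · refine mul_le_mul (hC _) ((norm_pin_le hγ hp hα hε x).trans ?_) (norm_nonneg _) hC0
    gcongr

section FixedPoint

variable {s0 s1 s2 : C(ℝ, ℝ)} {c : ℝ} {α : ℝ≥0}

/-- The contraction constant `1/2` first gives a Lipschitz estimate of `W` at `x`, and then the
implicit function principle applies. The constant `L` is separate from `c` because the Lipschitz
bound of `σ''` need not be small. -/
theorem hasFDerivAt_cutoff_fixedPoint {L : ℝ} (hs : ∀ y, HasDerivAt s0 (s1 y) y)
    (hs1 : ∀ y, HasDerivAt s1 (s2 y) y) (h1 : ∀ y, |s1 y| ≤ c)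
    (h0' : ∀ u v, |s0 u - s0 v| ≤ c * |u - v|) (h1' : ∀ u v, |s1 u - s1 v| ≤ c * |u - v|)
    (hL : ∀ u v, |s1 u - s1 v| ≤ L * |u - v|) (hL1 : ∀ u v, |s2 u - s2 v| ≤ L * |u - v|)
    {g : HolderC α → ℝ} {g' : HolderC α →L[ℝ] ℝ} {x : HolderC α} (hg : HasFDerivAt g g' x)
    (hc : ∀ y : HolderC α, c * (|g y| * ‖pin y.toC‖) ≤ 1 / 16)
    {W : HolderC α → CI} (hW1 : ∀ y, ‖W y‖ ≤ 1)
    (hW : ∀ y, W y = g y • byParts s0 s1 (W y) y.toC) {R : CI →L[ℝ] CI}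
    (hR : ∀ V, R (V - g x • S (byParts s1 s2 (W x) x.toC) V) = V) :
    HasFDerivAt W (R.comp (g'.smulRight (byParts s0 s1 (W x) x.toC)
      + g x • (byParts s0 s1 (W x)).comp (HolderC.toCL α))) x := by
  have hb : HasFDerivAt (fun q : HolderC α × CI => byParts s0 s1 q.2 q.1.toC)
      (((byParts s0 s1 (W x)).comp (HolderC.toCL α)).comp (ContinuousLinearMap.fst ℝ _ CI)
        + (S (byParts s1 s2 (W x) x.toC)).comp (ContinuousLinearMap.snd ℝ _ CI)) (x, W x) := by
    have h2 : HasFDerivAt (fun q : HolderC α × CI => (HolderC.toCL α q.1, q.2))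
        (((HolderC.toCL α).comp (ContinuousLinearMap.fst ℝ _ CI)).prod
          (ContinuousLinearMap.snd ℝ _ CI)) (x, W x) :=
      ((HolderC.toCL α).hasFDerivAt.comp (x, W x) hasFDerivAt_fst).prodMk hasFDerivAt_snd
    have h3 : HasFDerivAt (fun q : CI × CI => byParts s0 s1 q.2 q.1) _
        (HolderC.toCL α x, W x) := hasFDerivAt_byParts hs hs1 hL hL1 x.toC (W x)
    exact HasFDerivAt.comp (x, W x) h3 h2
  have hg1 : HasFDerivAt (fun q : HolderC α × CI => g q.1)
      (g'.comp (ContinuousLinearMap.fst ℝ _ CI)) (x, W x) :=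
    HasFDerivAt.comp (x, W x) (g := g) hg hasFDerivAt_fst
  have hf : HasFDerivAt (fun q : HolderC α × CI => g q.1 • byParts s0 s1 q.2 q.1.toC) _ (x, W x) :=
    hg1.smul hb
  have hpair : HasFDerivAt (fun y : HolderC α => (y, W x))
      ((ContinuousLinearMap.id ℝ (HolderC α)).prod 0) x :=
    (hasFDerivAt_id x).prodMk (hasFDerivAt_const (W x) x)
  obtain ⟨K, hK⟩ := (HasFDerivAt.comp x hf hpair).isBigO_sub.bound
  refine hasFDerivAt_of_fixedPoint (K := 2 * K)
    (f := fun q : HolderC α × CI => g q.1 • byParts s0 s1 q.2 q.1.toC)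
    (A := g x • S (byParts s1 s2 (W x) x.toC)) (hf.congr_fderiv ?_) hW hR ?_
  · refine ContinuousLinearMap.ext fun q => ?_
    simp
    abel
  -- `‖W y - W x‖` is at most half of itself plus `K ‖y - x‖`, the latter from the differentiability
  -- of the map at frozen `W x`.
  · filter_upwards [hK] with y hy
    have e1 : ‖g y • byParts s0 s1 (W y) y.toC - g y • byParts s0 s1 (W x) y.toC‖
        ≤ 1 / 2 * ‖W y - W x‖ := by
      rw [← smul_sub, norm_smul, Real.norm_eq_abs]
      calc _ ≤ |g y| * (8 * c * ‖pin y.toC‖ * ‖W y - W x‖) :=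
            mul_le_mul_of_nonneg_left (norm_byParts_sub_le h1 h0' h1' _ _ (hW1 x)) (abs_nonneg _)
        _ = 8 * (c * (|g y| * ‖pin y.toC‖)) * ‖W y - W x‖ := by ring
        _ ≤ 8 * (1 / 16) * ‖W y - W x‖ := by gcongr; exact hc y
        _ = _ := by ring
    have e2 : ‖g y • byParts s0 s1 (W x) y.toC - W x‖ ≤ K * ‖y - x‖ := by
      have e4 : ‖g y • byParts s0 s1 (W x) y.toC - g x • byParts s0 s1 (W x) x.toC‖
        ≤ K * ‖y - x‖ := hy
      rwa [← hW x] at e4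
    have e3 := norm_sub_le_norm_sub_add_norm_sub (W y) (g y • byParts s0 s1 (W x) y.toC) (W x)
    rw [← hW y] at e1
    linarith

/-- A solution that is a priori only in `C^κ` has the form `P (G U)` and is thus differentiable. Its
primitive `U` then equals the expression by parts, so `G U` is the unique fixed point. -/
theorem isEllipticSolution_iff_eq_PH {κ : ℝ≥0} (hκ0 : 0 < κ) (hκ1 : κ ≤ 1) {a : ℝ} (ha : 0 < a)
    (ha1 : a ≤ 1) (hκa : 1 < κ + a) (hs : ∀ y, HasDerivAt s0 (s1 y) y)
    (h0' : ∀ u v, |s0 u - s0 v| ≤ c * |u - v|) {φ : ℝ → ℝ} {γ p : ℝ} {x W : CI}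
    (hx : IncrHolder a (ev x)) (hW : cutoffG φ γ p (ev x) • byParts s0 s1 W x = W)
    (hu : ∀ W', cutoffG φ γ p (ev x) • byParts s0 s1 W' x = W' → W' = W) (y : HolderC κ) :
    IsEllipticSolution φ γ p s0 (ev x) (ev y.toC) ↔ y = PH hκ1 W := by
  have hκ : (0 : ℝ) < κ := hκ0
  obtain ⟨U, hU, hU0, hUa⟩ :=
    exists_isYoungPath_ev (y.incrHolder.comp h0') hx hκ ha ha1 hκa
  rw [isEllipticSolution_iff ha hU hUa]
  constructor
  · intro h
    have hbp := isYoungPath_byParts hs (cutoffG φ γ p (ev x) • U) hx ha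
    rw [← h] at hbp
    have e := hU.eq_of_zero hbp hU0 (byParts_zero _ _ _ _)
    have e2 := hu (cutoffG φ γ p (ev x) • U) (by rw [← e])
    refine HolderC.ext_ev fun t _ _ => ?_
    rw [h, e2, toC_PH]
  · rintro rfl
    have e := hU.eq_of_zero (isYoungPath_byParts hs W hx ha) hU0 (byParts_zero _ _ _ _)
    rw [toC_PH, e, hW]

/-- The equation for `Φ_s` has exactly one solution, given by the resolvent. -/
theorem linearEquation_iff {κ : ℝ≥0} (hκ0 : 0 < κ) (hκ1 : κ ≤ 1) {a : ℝ} (ha : 0 < a)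
    (ha1 : a ≤ 1) (hκa : 1 < κ + a) (hs : ∀ y, HasDerivAt s0 (s1 y) y)
    (hs1 : ∀ y, HasDerivAt s1 (s2 y) y) (h0 : ∀ y, |s0 y| ≤ c) (h1 : ∀ y, |s1 y| ≤ c)
    (h1' : ∀ u v, |s1 u - s1 v| ≤ c * |u - v|) {φ : ℝ → ℝ} {γ p : ℝ} {x W : CI}
    (hx : IncrHolder a (ev x)) {R : CI →L[ℝ] CI}
    (hR : ∀ V, R (V - cutoffG φ γ p (ev x) • S (byParts s1 s2 W x) V) = V)
    (hR' : ∀ V, R V = V + cutoffG φ γ p (ev x) • S (byParts s1 s2 W x) (R V)) {s : ℝ}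
    (hs0 : 0 ≤ s) (hs1' : s ≤ 1) (y : HolderC κ) :
    (∀ t ∈ Set.Icc (0 : ℝ) 1, ev y.toC t = psiKernel φ γ p s0 (ev x) (ev (PH hκ1 W).toC) s t
      + cutoffG φ γ p (ev x) * youngIntegral
          (fun ξ => greenK t ξ * s1 (ev (PH hκ1 W).toC ξ) * ev y.toC ξ) (ev x) 0 1) ↔
    y = (cutoffG φ γ p (ev x) * s0 (ev (P W) s)) •
          (greenH hκ1 s + PH hκ1 (R (cutoffG φ γ p (ev x) • greenPath (byParts s1 s2 W x) s)))
        + (2 * deriv φ (sobolevPow γ p (ev x)) * muTerm γ p (ev x) s) •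
          PH hκ1 (R (byParts s0 s1 W x)) := by
  set G := cutoffG φ γ p (ev x)
  set B := byParts s0 s1 W x with hBdef
  set F := byParts s1 s2 W x with hFdef
  have hκ : (0 : ℝ) < κ := hκ0
  have hB := isYoungPath_byParts hs W hx ha
  have hF := isYoungPath_byParts hs1 W hx ha
  have hBa : IncrHolder a (ev B) := hB.incrHolder hx ha.le ha1 fun t _ _ => h0 _
  have hFa : IncrHolder a (ev F) := hF.incrHolder hx ha.le ha1 fun t _ _ => h1 _
  have hf : IncrHolder κ (fun t => s1 (ev (P W) t)) := (PH hκ1 W).incrHolder.comp h1'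
  have hψ : ∀ t, 0 ≤ t → t ≤ 1 → psiKernel φ γ p s0 (ev x) (ev (PH hκ1 W).toC) s t =
      G * s0 (ev (P W) s) * greenK t s
        + 2 * deriv φ (sobolevPow γ p (ev x)) * muTerm γ p (ev x) s * ev (P B) t := by
    intro t ht ht1
    rw [psiKernel, toC_PH,
      (hB.youngValue_greenK hBa ha ht ht1).hasYoungIntegral.youngIntegral_eq zero_le_one]
  set y0 : HolderC κ := (G * s0 (ev (P W) s)) • (greenH hκ1 s + PH hκ1 (R (G • greenPath F s)))
        + (2 * deriv φ (sobolevPow γ p (ev x)) * muTerm γ p (ev x) s) • PH hκ1 (R B) with hy0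
  have hsol : ∀ t, 0 ≤ t → t ≤ 1 → ev y0.toC t =
      psiKernel φ γ p s0 (ev x) (ev (PH hκ1 W).toC) s t
      + G * youngIntegral (fun ξ => greenK t ξ * (s1 (ev (P W) ξ) * ev y0.toC ξ)) (ev x) 0 1 := by
    intro t ht ht1
    rw [hψ t ht ht1]
    refine linearEquation_solution ha ha1 hx (fun t _ _ => h1 _) hF hFa hR' _ _ B hs0 hs1'
      (fun t ht ht1 => ?_) ht ht1
    rw [← ev_greenH hκ1 s ht ht1]
    rfl
  have hassoc : ∀ (y : HolderC κ) t,
      (fun ξ => greenK t ξ * s1 (ev (PH hκ1 W).toC ξ) * ev y.toC ξ) =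
        fun ξ => greenK t ξ * (s1 (ev (P W) ξ) * ev y.toC ξ) :=
    fun y t => funext fun ξ => mul_assoc _ _ _
  constructor
  · intro h
    refine linearEquation_unique hκ0 ha ha1 hκa hf hx hF hFa hR (fun t ht ht1 => ?_) hsol
    rw [← hassoc]
    exact h t ⟨ht, ht1⟩
  · rintro rfl t ⟨ht, ht1⟩
    rw [hassoc]
    exact hsol t ht ht1

end FixedPoint

theorem theorem3p5 (γ κ : ℝ≥0) (hγ0 : 0 < γ) (hγ1 : γ < 1) (hκ0 : 0 < κ) (hκ1 : κ < 1)
    (hγκ : 1 < γ + κ) (p : ℝ) (hp : 1 ≤ p) (M : ℝ) (hM : 0 < M)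
    (φ : ℝ → ℝ) (hφ : IsCutoff M φ) :
    ∃ c : ℝ, 0 < c ∧
      ∀ σ : ℝ → ℝ, ContDiff ℝ 4 σ →
      (∀ j : ℕ, j ≤ 4 → ∃ C : ℝ, ∀ y : ℝ, |iteratedDeriv j σ y| ≤ C) →
      (∀ j : ℕ, j ≤ 2 → ∀ y : ℝ, |iteratedDeriv j σ y| ≤ c / (M + 1)) →
      ∀ ε : ℝ≥0, 1 / (2 * p) < (ε : ℝ) →
      ∃ z : HolderC (γ + ε) → HolderC κ,
        (∀ (x : HolderC (γ + ε)) (y : HolderC κ), IsEllipticSolution φ γ p σ x y ↔ y = z x) ∧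
        ∀ x : HolderC (γ + ε), ∃ D : HolderC (γ + ε) →L[ℝ] HolderC κ,
          HasFDerivAt z D x ∧
          ∃ Φ : ℝ → HolderC κ,
            (∀ s ∈ Set.Icc (0 : ℝ) 1, ∀ y : HolderC κ,
              (∀ t ∈ Set.Icc (0 : ℝ) 1,
                y t = psiKernel φ γ p σ x (z x) s t
                  + cutoffG φ γ p x
                    * youngIntegral (fun ξ => greenK t ξ * deriv σ (z x ξ) * y ξ) x 0 1)
                ↔ y = Φ s) ∧
            ∀ h : HolderC (γ + ε), ∀ t ∈ Set.Icc (0 : ℝ) 1,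
              HasYoungIntegral (fun s => Φ s t) h 0 1 (D h t) := by
  have hγ0' : (0 : ℝ) < γ := hγ0
  have hγ1' : (γ : ℝ) ≤ 1 := by exact_mod_cast hγ1.le
  have hκγ : (1 : ℝ) < κ + γ := by rw [add_comm]; exact_mod_cast hγκ
  obtain ⟨Λ, hΛ0, hΛ⟩ := hφ.exists_cutoffG_mul_norm_pin_le hM hγ0' hp
  have hc0 : 0 < 1 / (16 * (Λ + 1)) := by positivity
  -- This yields `c |G_M(x)| ‖x - x_0‖ ≤ 1/16`, the smallness used in the fixed point argument; the
  -- `+ 1` excludes division by zero.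
  set c := 1 / (16 * (Λ + 1)) with hc
  refine ⟨c, hc0, fun σ hσ hbd hsmall ε hε => ?_⟩
  have hcM : c / (M + 1) ≤ c := div_le_self hc0.le (by linarith)
  have hd0 : ∀ y, HasDerivAt σ (deriv σ y) y := fun y =>
    (hσ.differentiable (by norm_num) y).hasDerivAt
  have hσ1 : ContDiff ℝ 3 (deriv σ) := ContDiff.deriv' (n := 3) (by exact_mod_cast hσ)
  have hσ2 : ContDiff ℝ 2 (deriv (deriv σ)) := ContDiff.deriv' (n := 2) (by exact_mod_cast hσ1)
  have hd1 : ∀ y, HasDerivAt (deriv σ) (deriv (deriv σ) y) y := fun y =>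
    (hσ1.differentiable (by norm_num) y).hasDerivAt
  have hd2 : ∀ y, HasDerivAt (deriv (deriv σ)) (deriv (deriv (deriv σ)) y) y := fun y =>
    (hσ2.differentiable (by norm_num) y).hasDerivAt
  have b0 : ∀ y, |σ y| ≤ c := fun y => by
    simpa using (hsmall 0 (by norm_num) y).trans hcM
  have b1 : ∀ y, |deriv σ y| ≤ c := fun y => by
    simpa using (hsmall 1 (by norm_num) y).trans hcM
  have b2 : ∀ y, |deriv (deriv σ) y| ≤ c := fun y => by
    simpa [iteratedDeriv_succ] using (hsmall 2 le_rfl y).trans hcM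
  obtain ⟨C3, hC3⟩ := hbd 3 (by norm_num)
  have b3 : ∀ y, |deriv (deriv (deriv σ)) y| ≤ C3 := fun y => by
    simpa [iteratedDeriv_succ] using hC3 y
  obtain ⟨s0, hs0⟩ : ∃ s : C(ℝ, ℝ), ⇑s = σ := ⟨⟨σ, hσ.continuous⟩, rfl⟩
  obtain ⟨s1, hs1⟩ : ∃ s : C(ℝ, ℝ), ⇑s = deriv σ := ⟨⟨_, hσ1.continuous⟩, rfl⟩
  obtain ⟨s2, hs2⟩ : ∃ s : C(ℝ, ℝ), ⇑s = deriv (deriv σ) := ⟨⟨_, hσ2.continuous⟩, rfl⟩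
  have l0 := abs_sub_le_of_hasDerivAt hd0 b1
  have l1 := abs_sub_le_of_hasDerivAt hd1 b2
  have l2 := abs_sub_le_of_hasDerivAt hd2 b3
  rw [← hs2] at b2 hd1 l2
  rw [← hs1] at b1 hd0 hd1 l1 ⊢
  rw [← hs0] at b0 hd0 l0 ⊢
  have hα : 0 < γ + ε := add_pos_of_pos_of_nonneg hγ0 ε.2
  have hε' : 1 < 2 * p * ((γ + ε : ℝ≥0) - (γ : ℝ)) := by
    rw [NNReal.coe_add, add_sub_cancel_left]
    rwa [div_lt_iff₀' (by positivity)] at hε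
  set N : HolderC (γ + ε) → ℝ := fun x => cutoffG φ γ p (ev x.toC) with hN
  have hsm : ∀ x : HolderC (γ + ε), c * (|N x| * ‖pin x.toC‖) ≤ 1 / 16 := fun x => by
    calc c * (|N x| * ‖pin x.toC‖) ≤ c * Λ := mul_le_mul_of_nonneg_left (hΛ hα hε' x) hc0.le
      _ ≤ 1 / (16 * (Λ + 1)) * (Λ + 1) := by rw [← hc]; gcongr; linarith
      _ = 1 / 16 := by field_simp
  -- From here on the Young calculus uses only the exponent `γ ≤ 1`, since `γ + ε` may exceed `1`.
  have hxγ : ∀ x : HolderC (γ + ε), IncrHolder γ (ev x.toC) := fun x =>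
    x.incrHolder.weaken γ.2 (by rw [NNReal.coe_add]; linarith [ε.2])
  choose W hW1 hW hWu using fun x : HolderC (γ + ε) =>
    existsUnique_fixedPoint (s0 := s0) (s1 := s1) b0 b1 l0 l1 x.toC (hsm x)
  refine ⟨fun x => PH hκ1.le (W x), fun x y => isEllipticSolution_iff_eq_PH hκ0 hκ1.le hγ0' hγ1'
    hκγ hd0 l0 (hxγ x) (hW x) (hWu x) y, fun x => ?_⟩
  set F := byParts s1 s2 (W x) x.toC with hF
  -- The operator bound is `8 · 1/16 = 1/2`, so the Neumann series gives the resolvent.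
  have hA : ‖N x • S F‖ < 1 := by
    refine (ContinuousLinearMap.opNorm_smul_le _ _).trans_lt ?_
    rw [Real.norm_eq_abs]
    calc |N x| * ‖S F‖ ≤ |N x| * (8 * c * ‖pin x.toC‖) :=
          mul_le_mul_of_nonneg_left (norm_S_byParts_le b1 b2 x.toC (hW1 x)) (abs_nonneg _)
      _ = 8 * (c * (|N x| * ‖pin x.toC‖)) := by ring
      _ < 1 := by linarith [hsm x]
  obtain ⟨R, hR, hR'⟩ := exists_resolvent hA
  have hφ' : HasDerivAt φ (deriv φ (sobolevPow γ p (ev x.toC))) (sobolevPow γ p (ev x.toC)) :=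
    (hφ.smooth.differentiable (by norm_num) _).hasDerivAt
  have hNd : HasFDerivAt N _ x :=
    hφ'.comp_hasFDerivAt x (hasFDerivAt_sobolevPow (γ := (γ : ℝ)) hα hp hε' x)
  have hWd := hasFDerivAt_cutoff_fixedPoint (L := max c C3) hd0 hd1 b1 l0 l1
    (fun u v => (l1 u v).trans (mul_le_mul_of_nonneg_right (le_max_left _ _) (abs_nonneg _)))
    (fun u v => (l2 u v).trans (mul_le_mul_of_nonneg_right (le_max_right _ _) (abs_nonneg _)))
    hNd hsm hW1 (fun y => (hW y).symm) hR
  -- The witness for `Φ` is read off from `linearEquation_iff`; the derivative is `P` composed with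
  -- that of `W`.
  refine ⟨_, (PH hκ1.le).hasFDerivAt.comp x hWd, _, fun s hs y =>
    linearEquation_iff hκ0 hκ1.le hγ0' hγ1' hκγ hd0 hd1 b0 b1 l1 (hxγ x) hR hR' hs.1 hs.2 y,
    fun h t ht => ?_⟩
  have hH := isYoungPath_byParts hd0 (W x) (hxγ h) hγ0'
  have hHa := hH.incrHolder (hxγ h) hγ0'.le hγ1' fun t _ _ => b0 _
  refine ((youngValue_resolvent hγ0' hR hH hHa (youngValue_muTerm hα hp hε' x h)
    (deriv φ (sobolevPow γ p (ev x.toC))) (byParts s0 s1 (W x) x.toC) ht.1 ht.2).congr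
    (fun s hs hs1 => ?_) rfl).hasYoungIntegral
  rw [← ev_greenH hκ1.le s ht.1 ht.2]
  rfl
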